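/- Let $k$ be a field of characteristic zero, $\mathbf x=\{x_1,\dots,x_n\}$, $\mathbf y=\{y_1,\dots,y_m\}$, $\mathbf z=\{z_1,\dots,z_p\}$ finite sets of variables, and $W\in k[[\mathbf x]]$, $V\in k[[\mathbf y]]$, $U\in k[[\mathbf z]]$. A linear factorisation of an element $w$ of a commutative ring $R$ is a $\mathbb Z/2$-graded $R$-module $X$ with an odd $R$-linear map $d$ such that $d^2=w\cdot 1_X$; it is a finite rank matrix factorisation if $X^0,X^1$ are free of finite rank. Morphisms in the homotopy category $\mathrm{HF}(R,w)$ are even $R$-linear maps commuting with $d$, modulo maps $dh+hd$ with $h$ odd and $R$-linear; the suspension $X[1]$ has the shifted grading and differential $-d$. All tensor products of maps carry Koszul signs. Let $E$ be a finite rank matrix factorisation of $V-W$ over $k[[\mathbf x,\mathbf y]]$ with a chosen homogeneous basis, and $F$ a finite rank matrix factorisation of $U-V$ over $k[[\mathbf y,\mathbf z]]$. Let $\pi^\bullet(F)=F\,\widehat\otimes_k k[[\mathbf x]]$ and $\pi^\bullet(E)=E\,\widehat\otimes_k k[[\mathbf z]]$, where $M\,\widehat\otimes_B N$ (for $M$ over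 $A_1$, $N$ over $A_2$) is the completion of $M\otimes_B N$ in the topology of the ideal $\mathfrak m_{1}\otimes A_2+A_1\otimes\mathfrak m_{2}$ of $A_1\otimes_B A_2$, with $\mathfrak m_i\subset A_i$ generated by the variables; put $$F\boxtimes E=\pi^\bullet(F)\otimes_{k[[\mathbf x,\mathbf y,\mathbf z]]}\pi^\bullet(E),$$ and let $F\star E$ be $F\boxtimes E$ regarded as a linear factorisation over $k[[\mathbf x,\mathbf z]]$. Write $\mathbf t=(\partial_{y_1}V,\dots,\partial_{y_m}V)$ and $J_V=k[[\mathbf y]]/\mathbf t\,k[[\mathbf y]]$, and regard $F\boxtimes E$ as a module over the polynomial ring $k[[\mathbf x,\mathbf z]][\mathbf t]=k[[\mathbf x,\mathbf z]][t_1,\dots,t_m]$, with $t_i$ acting as $\partial_{y_i}V$. Theorem. Suppose that $\dim_k J_V<\infty$. Then $F\star E$ is a linear factorisation and $F/\mathbf tF\,\widehat\otimes_{k[[\mathbf y]]}E/\mathbf tE$ is a finite rank matrix factorisation of $U-W$ over $k[[\mathbf x,\mathbf z]]$; the canonical map identifies $(F\boxtimes E)/\mathbf t(F\boxtimes E)$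 with $F/\mathbf tF\,\widehat\otimes_{k[[\mathbf y]]}E/\mathbf tE$; and there are morphisms in $\mathrm{HF}(k[[\mathbf x,\mathbf z]],U-W)$ $$\psi: F/\mathbf tF\,\widehat\otimes_{k[[\mathbf y]]}E/\mathbf tE\longrightarrow (F\star E)[m],\qquad \vartheta:(F\star E)[m]\longrightarrow F/\mathbf tF\,\widehat\otimes_{k[[\mathbf y]]}E/\mathbf tE$$ with $\psi\circ\vartheta=1$ and with the idempotent $e=\vartheta\circ\psi$ given by $$e=\frac1{m!}(-1)^{\binom{m+1}{2}}\,\partial_{y_1}(d_E)\cdots\partial_{y_m}(d_E)\,\mathrm{At}(F\boxtimes E)^m .$$ Here $\partial_{y_i}(d_E)$ is the entrywise derivative of the matrix of $d_E$ in the chosen basis, acting on $F\boxtimes E$ as $1\otimes\partial_{y_i}(d_E)$, and $\mathrm{At}(F\boxtimes E)=[d,\nabla]$ is the Atiyah class relative to $k[[\mathbf x,\mathbf z]][\mathbf t]/k[[\mathbf x,\mathbf z]]$, for any $k[[\mathbf x,\mathbf z]]$-linear connection $\nabla:F\boxtimes E\to (F\boxtimes E)\otimes\Omega^1$ of degree zero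 over $k[[\mathbf x,\mathbf z]][\mathbf t]$ (such a connection exists if $J_V\neq0$). Its $m$-th power, a map into $(F\boxtimes E)\otimes\Omega^m$, is regarded as an endomorphism of $F\boxtimes E$ by means of the trivialisation $dt_1\wedge\cdots\wedge dt_m$ of $\Omega^m$; the displayed operator on $F\boxtimes E$ descends to $(F\boxtimes E)/\mathbf t(F\boxtimes E)\cong F/\mathbf tF\,\widehat\otimes_{k[[\mathbf y]]}E/\mathbf tE$. -/

import Mathlib

open scoped TensorProduct

universe u v w

namespace MFConv

noncomputable section

/-! ### Restriction of scalars along a ring morphism -/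

/-- The module `X` over `R`, regarded as a module over `A` through `φ : A → R`. -/
def Restrict {A R : Type*} [CommRing A] [CommRing R] (_φ : A →+* R) (X : Type*) : Type _ := X

section Restrict

variable {A R : Type*} [CommRing A] [CommRing R] (φ : A →+* R)
  {X Y : Type*} [AddCommGroup X] [Module R X] [AddCommGroup Y] [Module R Y]

instance : AddCommGroup (Restrict φ X) := inferInstanceAs (AddCommGroup X)

instance : Module A (Restrict φ X) := Module.compHom X φ

/-- The identity map `X → φ_* X`. -/
def toRestrict : X ≃+ Restrict φ X := AddEquiv.refl X

theorem smul_toRestrict (a : A) (x : X) :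
    a • toRestrict φ x = toRestrict φ (φ a • x) := rfl

/-- An `R`-linear map, regarded as an `A`-linear map. -/
def restrictMap (f : X →ₗ[R] Y) : Restrict φ X →ₗ[A] Restrict φ Y where
  toFun x := toRestrict φ (f ((toRestrict φ).symm x))
  map_add' x y := f.map_add x y
  map_smul' a x := f.map_smul (φ a) x

end Restrict

/-! ### Factorisations -/

/-- A `ℤ/2`-graded `R`-module `X` with an odd `R`-linear endomorphism `d`. The grading is recorded
by its grading operator `G x = (-1)^|x| x`; this is the same thing as a decomposition
`X = X⁰ ⊕ X¹` as soon as `2` is invertible in `R`, see `isCompl_evenPart_oddPart`. -/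
structure OddEnd (R : Type*) [CommRing R] (X : Type*) [AddCommGroup X] [Module R X] where
  /-- the grading operator -/
  G : X →ₗ[R] X
  /-- the differential -/
  d : X →ₗ[R] X
  G_G : ∀ x, G (G x) = x
  d_G : ∀ x, d (G x) = -G (d x)

namespace OddEnd

section

variable {R : Type*} [CommRing R] {X Y : Type*} [AddCommGroup X] [Module R X]
  [AddCommGroup Y] [Module R Y] (D : OddEnd R X) (D' : OddEnd R Y)

/-- The component `X⁰`. -/
def evenPart : Submodule R X := LinearMap.ker (D.G - LinearMap.id)

/-- The component `X¹`. -/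
def oddPart : Submodule R X := LinearMap.ker (D.G + LinearMap.id)

theorem isCompl_evenPart_oddPart [Invertible (2 : R)] : IsCompl D.evenPart D.oddPart := by
  constructor
  · rw [Submodule.disjoint_def]
    intro x hx hy
    have h0 : D.G x - x = 0 := by simpa [evenPart] using hx
    have h1 : D.G x + x = 0 := by simpa [oddPart] using hy
    have h2 : (2 : R) • x = 0 := by
      rw [two_smul, ← sub_eq_zero.mp h0]
      nth_rewrite 2 [sub_eq_zero.mp h0]
      exact h1
    rw [← invOf_smul_smul (2 : R) x, h2, smul_zero]
  · rw [codisjoint_iff, Submodule.eq_top_iff']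
    intro x
    have hx : x = (⅟(2 : R)) • (x + D.G x) + (⅟(2 : R)) • (x - D.G x) := by
      rw [← smul_add, add_add_sub_cancel, ← two_smul R x, invOf_smul_smul]
    rw [hx]
    refine Submodule.add_mem_sup ?_ ?_
    · refine Submodule.smul_mem _ _ ?_
      simp [evenPart, D.G_G, add_comm]
    · refine Submodule.smul_mem _ _ ?_
      simp [oddPart, D.G_G]

/-- `(X, d)` is a linear factorisation of `W`. -/
def IsLinearFactorisation (W : R) : Prop := ∀ x, D.d (D.d x) = W • x

/-- `(X, d)` is a finite rank matrix factorisation of `W`: both components are free of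
finite rank. -/
structure IsFiniteRankMF (W : R) : Prop where
  sq : D.IsLinearFactorisation W
  free_even : Module.Free R D.evenPart
  finite_even : Module.Finite R D.evenPart
  free_odd : Module.Free R D.oddPart
  finite_odd : Module.Finite R D.oddPart

/-- The `m`-fold suspension `X[m]`. -/
def shift (m : ℕ) : OddEnd R X where
  G := (-1 : R) ^ m • D.G
  d := (-1 : R) ^ m • D.d
  G_G x := by
    simp [D.G_G, smul_smul, ← mul_pow]
  d_G x := by
    simp [D.d_G]

/-- A morphism of factorisations: an even `R`-linear map commuting with the differentials. -/
structure IsMorphism (f : X →ₗ[R] Y) : Prop where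
  even : ∀ x, f (D.G x) = D'.G (f x)
  comm : ∀ x, f (D.d x) = D'.d (f x)

/-- Two even `R`-linear maps are homotopic if their difference is the boundary of an odd
`R`-linear map. -/
def Homotopic (f g : X →ₗ[R] Y) : Prop :=
  ∃ h : X →ₗ[R] Y, (∀ x, h (D.G x) = -D'.G (h x)) ∧ ∀ x, f x - g x = D'.d (h x) + h (D.d x)

/-- The tensor product of factorisations, with the Koszul sign in
`d = d ⊗ 1 + 1 ⊗ d`, so that `d (x ⊗ y) = d x ⊗ y + (-1)^|x| x ⊗ d y`. -/
def tensor : OddEnd R (X ⊗[R] Y) where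
  G := TensorProduct.map D.G D'.G
  d := TensorProduct.map D.d LinearMap.id + TensorProduct.map D.G D'.d
  G_G x := by
    induction x with
    | zero => simp
    | tmul x y => simp [D.G_G, D'.G_G]
    | add x y hx hy => rw [map_add, map_add, hx, hy]
  d_G x := by
    induction x with
    | zero => simp
    | tmul x y => simp [D.d_G, D'.d_G, TensorProduct.neg_tmul, TensorProduct.tmul_neg]; abel
    | add x y hx hy => rw [map_add, map_add, map_add, map_add, hx, hy]; abel

/-- The linear factorisation induced on `X / J X`. -/
def quot (J : Ideal R) : OddEnd R (X ⧸ (J • ⊤ : Submodule R X)) where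
  G := Submodule.mapQ _ _ D.G (Submodule.smul_top_le_comap_smul_top J D.G)
  d := Submodule.mapQ _ _ D.d (Submodule.smul_top_le_comap_smul_top J D.d)
  G_G x := by
    induction x using Submodule.Quotient.induction_on with
    | H x => simp [D.G_G]
  d_G x := by
    induction x using Submodule.Quotient.induction_on with
    | H x => simp [D.d_G]

/-- The pushforward along a ring morphism. -/
def restrict {A : Type*} [CommRing A] (φ : A →+* R) : OddEnd A (Restrict φ X) where
  G := restrictMap φ D.G
  d := restrictMap φ D.d
  G_G x := D.G_G x
  d_G x := D.d_G x

end

/-- A ring, viewed as a factorisation of zero concentrated in degree zero. -/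
def unit (R : Type*) [CommRing R] : OddEnd R R where
  G := LinearMap.id
  d := 0
  G_G _ := rfl
  d_G _ := by simp

section

variable {R : Type*} [CommRing R] {X : Type*} [AddCommGroup X] [Module R X] (D : OddEnd R X)

/-- A basis all of whose elements are homogeneous. -/
def IsHomogeneousBasis {ι : Type*} (b : Module.Basis ι R X) : Prop :=
  ∀ i, b i ∈ D.evenPart ∨ b i ∈ D.oddPart

/-- The endomorphism `∂(d)` obtained by writing `d` as a matrix in the basis `b` and applying
the derivation `∂` to all entries. -/
def derivD {K : Type*} [CommRing K] [Algebra K R] {ι : Type*} [Fintype ι] [DecidableEq ι]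
    (b : Module.Basis ι R X) (δ : Derivation K R R) : X →ₗ[R] X :=
  Matrix.toLin b b ((LinearMap.toMatrix b b D.d).map δ)

end

end OddEnd

/-! ### Completed tensor products -/

section CompletedTensor

variable (B : Type*) {A₁ A₂ : Type*} [CommRing B] [CommRing A₁] [CommRing A₂]
  [Algebra B A₁] [Algebra B A₂]

/-- The tensor product `M ⊗_B N` of an `A₁`-module and an `A₂`-module, regarded as a module over
`A₁ ⊗_B A₂`. -/
def ExtTensor (A₁ A₂ M N : Type*) [CommRing A₁] [CommRing A₂] [AddCommGroup M] [AddCommGroup N]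
    [Module A₁ M] [Module A₂ N] [Module B M] [Module B N] : Type _ := M ⊗[B] N

section

variable {M N M' N' : Type*} [AddCommGroup M] [AddCommGroup N] [AddCommGroup M'] [AddCommGroup N']
  [Module A₁ M] [Module A₂ N] [Module A₁ M'] [Module A₂ N']
  [Module B M] [Module B N] [Module B M'] [Module B N']
  [IsScalarTower B A₁ M] [IsScalarTower B A₂ N] [IsScalarTower B A₁ M'] [IsScalarTower B A₂ N']

instance : AddCommGroup (ExtTensor B A₁ A₂ M N) := inferInstanceAs (AddCommGroup (M ⊗[B] N))

/-- The action of `A₁ ⊗_B A₂` on `M ⊗_B N`. -/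
def extAction : A₁ ⊗[B] A₂ →ₐ[B] Module.End B (M ⊗[B] N) :=
  (Module.endTensorEndAlgHom (R := B) (S := B) (A := B)).comp
    (Algebra.TensorProduct.map (Algebra.lsmul B B M : A₁ →ₐ[B] Module.End B M)
      (Algebra.lsmul B B N : A₂ →ₐ[B] Module.End B N))

theorem extAction_tmul (a : A₁) (b : A₂) (x : M) (y : N) :
    extAction B (a ⊗ₜ[B] b) (x ⊗ₜ[B] y) = (a • x) ⊗ₜ[B] (b • y) := rfl

instance : Module (A₁ ⊗[B] A₂) (ExtTensor B A₁ A₂ M N) :=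
  Module.compHom (M ⊗[B] N) (extAction B (A₁ := A₁) (A₂ := A₂) (M := M) (N := N)).toRingHom

/-- The pure tensor `x ⊗ y`. -/
def ExtTensor.tmul (x : M) (y : N) : ExtTensor B A₁ A₂ M N := x ⊗ₜ[B] y

theorem ExtTensor.smul_tmul (a : A₁) (b : A₂) (x : M) (y : N) :
    (a ⊗ₜ[B] b) • ExtTensor.tmul B (A₁ := A₁) (A₂ := A₂) x y =
      ExtTensor.tmul B (a • x) (b • y) := rfl

/-- The map `f ⊗ g` (without sign). -/
def ExtTensor.map (f : M →ₗ[A₁] M') (g : N →ₗ[A₂] N') :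
    ExtTensor B A₁ A₂ M N →ₗ[A₁ ⊗[B] A₂] ExtTensor B A₁ A₂ M' N' where
  toFun x := TensorProduct.map (f.restrictScalars B) (g.restrictScalars B) x
  map_add' x y := map_add (TensorProduct.map (f.restrictScalars B) (g.restrictScalars B)) x y
  map_smul' c x := by
    change TensorProduct.map (f.restrictScalars B) (g.restrictScalars B) (extAction B c x) =
      extAction B c (TensorProduct.map (f.restrictScalars B) (g.restrictScalars B) x)
    change M ⊗[B] N at x
    induction c with
    | zero => simp
    | add c c' hc hc' => simp only [map_add, LinearMap.add_apply, hc, hc']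
    | tmul a b =>
      induction x with
      | zero => simp
      | add x y hx hy => simp only [map_add, hx, hy]
      | tmul x y => simp [extAction_tmul]

/-- The ideal `I₁ ⊗ A₂ + A₁ ⊗ I₂` of `A₁ ⊗_B A₂`. -/
def tensorIdeal (I₁ : Ideal A₁) (I₂ : Ideal A₂) : Ideal (A₁ ⊗[B] A₂) :=
  I₁.map (Algebra.TensorProduct.includeLeft (S := B) : A₁ →ₐ[B] A₁ ⊗[B] A₂) ⊔
    I₂.map (Algebra.TensorProduct.includeRight : A₂ →ₐ[B] A₁ ⊗[B] A₂)

/-- The completed tensor product of rings: the completion of `A₁ ⊗_B A₂` in the topology of the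
ideal `I₁ ⊗ A₂ + A₁ ⊗ I₂`. -/
abbrev CompletedRing (I₁ : Ideal A₁) (I₂ : Ideal A₂) : Type _ :=
  AdicCompletion (tensorIdeal B I₁ I₂) (A₁ ⊗[B] A₂)

/-- The completed tensor product of modules: the completion of `M ⊗_B N` in the topology of the
ideal `I₁ ⊗ A₂ + A₁ ⊗ I₂`. -/
abbrev CompletedTensor (I₁ : Ideal A₁) (I₂ : Ideal A₂) (M N : Type*) [AddCommGroup M]
    [AddCommGroup N] [Module A₁ M] [Module A₂ N] [Module B M] [Module B N]
    [IsScalarTower B A₁ M] [IsScalarTower B A₂ N] : Type _ :=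
  AdicCompletion (tensorIdeal B I₁ I₂) (ExtTensor B A₁ A₂ M N)

variable (I₁ : Ideal A₁) (I₂ : Ideal A₂)

/-- The image of `x ⊗ y` in the completed tensor product. -/
def CompletedTensor.tmul (x : M) (y : N) : CompletedTensor B I₁ I₂ M N :=
  AdicCompletion.of _ _ (ExtTensor.tmul B x y)

/-- The map induced by `f ⊗ g` (without sign) on completed tensor products. -/
def CompletedTensor.map (f : M →ₗ[A₁] M') (g : N →ₗ[A₂] N') :
    CompletedTensor B I₁ I₂ M N →ₗ[CompletedRing B I₁ I₂] CompletedTensor B I₁ I₂ M' N' :=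
  AdicCompletion.map _ (ExtTensor.map B f g)

section

variable {M'' N'' : Type*} [AddCommGroup M''] [AddCommGroup N''] [Module A₁ M''] [Module A₂ N'']
  [Module B M''] [Module B N''] [IsScalarTower B A₁ M''] [IsScalarTower B A₂ N'']

theorem ExtTensor.map_map (f : M →ₗ[A₁] M') (g : N →ₗ[A₂] N') (f' : M' →ₗ[A₁] M'')
    (g' : N' →ₗ[A₂] N'') :
    (ExtTensor.map B f' g').comp (ExtTensor.map B f g) =
      ExtTensor.map B (f'.comp f) (g'.comp g) := by
  ext x
  change M ⊗[B] N at x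
  change TensorProduct.map (f'.restrictScalars B) (g'.restrictScalars B)
      (TensorProduct.map (f.restrictScalars B) (g.restrictScalars B) x) =
    TensorProduct.map ((f'.comp f).restrictScalars B) ((g'.comp g).restrictScalars B) x
  induction x with
  | zero => simp
  | add x y hx hy => simp only [map_add, hx, hy]
  | tmul x y => simp

theorem CompletedTensor.map_map (f : M →ₗ[A₁] M') (g : N →ₗ[A₂] N') (f' : M' →ₗ[A₁] M'')
    (g' : N' →ₗ[A₂] N'') (x : CompletedTensor B I₁ I₂ M N) :
    CompletedTensor.map B I₁ I₂ f' g' (CompletedTensor.map B I₁ I₂ f g x) =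
      CompletedTensor.map B I₁ I₂ (f'.comp f) (g'.comp g) x := by
  rw [CompletedTensor.map, CompletedTensor.map, AdicCompletion.map_comp_apply,
    ExtTensor.map_map, CompletedTensor.map]

end

theorem CompletedTensor.map_id (x : CompletedTensor B I₁ I₂ M N) :
    CompletedTensor.map B I₁ I₂ (LinearMap.id : M →ₗ[A₁] M) (LinearMap.id : N →ₗ[A₂] N) x = x := by
  have h : ExtTensor.map B (LinearMap.id : M →ₗ[A₁] M) (LinearMap.id : N →ₗ[A₂] N) =
      LinearMap.id := by
    ext x
    exact congrArg (fun F : M ⊗[B] N →ₗ[B] M ⊗[B] N => F x) TensorProduct.map_id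
  rw [CompletedTensor.map, h, AdicCompletion.map_id, LinearMap.id_apply]

theorem CompletedTensor.map_neg_of {F F' : ExtTensor B A₁ A₂ M N →ₗ[A₁ ⊗[B] A₂]
      ExtTensor B A₁ A₂ M' N'} (h : F = -F') (x : CompletedTensor B I₁ I₂ M N) :
    AdicCompletion.map (tensorIdeal B I₁ I₂) F x =
      -AdicCompletion.map (tensorIdeal B I₁ I₂) F' x := by
  subst h
  induction x using AdicCompletion.induction_on with
  | _ x =>
    ext j
    simp

theorem CompletedTensor.map_neg_left (f : M →ₗ[A₁] M') (g : N →ₗ[A₂] N')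
    (x : CompletedTensor B I₁ I₂ M N) :
    CompletedTensor.map B I₁ I₂ (-f) g x = -CompletedTensor.map B I₁ I₂ f g x := by
  refine CompletedTensor.map_neg_of B I₁ I₂ ?_ x
  ext x
  change M ⊗[B] N at x
  change TensorProduct.map ((-f).restrictScalars B) (g.restrictScalars B) x =
    -TensorProduct.map (f.restrictScalars B) (g.restrictScalars B) x
  induction x with
  | zero => simp
  | add x y hx hy => rw [map_add, map_add, hx, hy, neg_add]
  | tmul x y => simp [TensorProduct.neg_tmul]

theorem CompletedTensor.map_neg_right (f : M →ₗ[A₁] M') (g : N →ₗ[A₂] N')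
    (x : CompletedTensor B I₁ I₂ M N) :
    CompletedTensor.map B I₁ I₂ f (-g) x = -CompletedTensor.map B I₁ I₂ f g x := by
  refine CompletedTensor.map_neg_of B I₁ I₂ ?_ x
  ext x
  change M ⊗[B] N at x
  change TensorProduct.map (f.restrictScalars B) ((-g).restrictScalars B) x =
    -TensorProduct.map (f.restrictScalars B) (g.restrictScalars B) x
  induction x with
  | zero => simp
  | add x y hx hy => rw [map_add, map_add, hx, hy, neg_add]
  | tmul x y => simp [TensorProduct.tmul_neg]

theorem OddEnd.G_comp_G {R X : Type*} [CommRing R] [AddCommGroup X] [Module R X]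
    (D : OddEnd R X) : D.G.comp D.G = LinearMap.id :=
  LinearMap.ext D.G_G

theorem OddEnd.d_comp_G {R X : Type*} [CommRing R] [AddCommGroup X] [Module R X]
    (D : OddEnd R X) : D.d.comp D.G = -(D.G.comp D.d) :=
  LinearMap.ext D.d_G

/-- The completed tensor product of factorisations, with `d = d ⊗ 1 + 1 ⊗ d` (and the Koszul sign
in the second summand). -/
def OddEnd.ctensor (D : OddEnd A₁ M) (D' : OddEnd A₂ N) :
    OddEnd (CompletedRing B I₁ I₂) (CompletedTensor B I₁ I₂ M N) where
  G := CompletedTensor.map B I₁ I₂ D.G D'.G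
  d := CompletedTensor.map B I₁ I₂ D.d LinearMap.id + CompletedTensor.map B I₁ I₂ D.G D'.d
  G_G x := by
    rw [CompletedTensor.map_map, D.G_comp_G, D'.G_comp_G, CompletedTensor.map_id]
  d_G x := by
    simp only [LinearMap.add_apply, map_add, CompletedTensor.map_map, D.d_comp_G, D'.d_comp_G,
      D.G_comp_G, CompletedTensor.map_neg_left, CompletedTensor.map_neg_right, LinearMap.id_comp,
      LinearMap.comp_id, neg_add_rev]
    abel

end

end CompletedTensor

/-! ### Power series -/

section PowerSeries

variable {k σ A : Type*} [CommRing k] [CommRing A]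

theorem eval₂_mem_pow (I : Ideal A) (c : k →+* A) (a : σ → A) (ha : ∀ s, a s ∈ I) (j : ℕ)
    (P : MvPolynomial σ k) (hP : ∀ e : σ →₀ ℕ, e.degree < j → P.coeff e = 0) :
    MvPolynomial.eval₂ c a P ∈ I ^ j := by
  rw [MvPolynomial.eval₂_eq]
  refine Ideal.sum_mem _ fun e he => Ideal.mul_mem_left _ _ ?_
  have hj : j ≤ e.degree := by
    by_contra h
    exact (MvPolynomial.mem_support_iff.mp he) (hP e (not_le.mp h))
  refine Ideal.pow_le_pow_right hj ?_
  rw [Finsupp.degree_apply, ← Finset.prod_pow_eq_pow_sum]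
  exact Ideal.prod_mem_prod fun s _ => Ideal.pow_mem_pow (ha s) _

theorem mk_eval₂_eq (I : Ideal A) (c : k →+* A) (a : σ → A) {j : ℕ} {P Q : MvPolynomial σ k}
    (hPQ : ∀ e : σ →₀ ℕ, e.degree < j → P.coeff e = Q.coeff e) (ha : ∀ s, a s ∈ I) :
    Ideal.Quotient.mk (I ^ j) (MvPolynomial.eval₂ c a P) =
      Ideal.Quotient.mk (I ^ j) (MvPolynomial.eval₂ c a Q) := by
  rw [Ideal.Quotient.eq, ← MvPolynomial.eval₂_sub]
  exact eval₂_mem_pow I c a ha j _ fun e he => by rw [MvPolynomial.coeff_sub, hPQ e he, sub_self]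

variable [Finite σ] (I : Ideal A) (c : k →+* A) (a : σ → A) (ha : ∀ s, a s ∈ I)

/-- Substitution of `a` in power series, modulo `I ^ j`. -/
def psMapMod (j : ℕ) : MvPowerSeries σ k →+* A ⧸ I ^ j where
  toFun f := Ideal.Quotient.mk (I ^ j) (MvPolynomial.eval₂ c a (f.truncTotal j))
  map_one' := by
    rw [← map_one (Ideal.Quotient.mk (I ^ j)), ← MvPolynomial.eval₂_one c a]
    exact mk_eval₂_eq I c a (fun e he => by
      classical
      rw [MvPowerSeries.coeff_truncTotal _ he, MvPowerSeries.coeff_one,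
        MvPolynomial.coeff_one]
      simp [eq_comm]) ha
  map_mul' f g := by
    rw [← map_mul, ← MvPolynomial.eval₂_mul]
    exact mk_eval₂_eq I c a (fun e he => by
      rw [MvPowerSeries.coeff_truncTotal _ he,
        MvPowerSeries.coeff_truncTotal_mul_truncTotal_eq_coeff_mul _ _ he]) ha
  map_zero' := by simp
  map_add' f g := by simp [MvPolynomial.eval₂_add]

/-- The continuous ring morphism `k⟦σ⟧ → Â` into the `I`-adic completion of `A`, given by `c` on
coefficients and sending the variable `s` to `a s ∈ I`. -/
def psMap : MvPowerSeries σ k →+* AdicCompletion I A :=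
  AdicCompletion.liftRingHom I (psMapMod I c a ha) fun {i j} hij => by
    ext f
    change Ideal.Quotient.factorPow I hij (Ideal.Quotient.mk (I ^ j) _) =
      Ideal.Quotient.mk (I ^ i) _
    change Ideal.Quotient.mk (I ^ i) _ = _
    exact mk_eval₂_eq I c a (fun e he => by
      rw [MvPowerSeries.coeff_truncTotal _ he,
        MvPowerSeries.coeff_truncTotal _ (he.trans_le hij)]) ha

end PowerSeries

/-! ### Connections and Atiyah classes -/

section Atiyah

variable (S : Type*) {A M : Type*} [CommRing S] [CommRing A] [Algebra S A]
  [AddCommGroup M] [Module A M]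

/-- An `S`-linear connection `M → M ⊗_A Ω¹_{A/S}` on the `A`-module `M`. -/
structure Connection (A M : Type*) [CommRing A] [Algebra S A] [AddCommGroup M] [Module A M] where
  /-- the underlying additive map -/
  nabla : M →+ M ⊗[A] Ω[A⁄S]
  map_base : ∀ (s : S) (x : M), nabla (algebraMap S A s • x) = algebraMap S A s • nabla x
  leibniz : ∀ (a : A) (x : M), nabla (a • x) = a • nabla x + x ⊗ₜ[A] KaehlerDifferential.D S A a

variable {S}

/-- The connection is a map of degree zero. -/
def Connection.IsEven (N : Connection S A M) (D : OddEnd A M) : Prop :=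
  ∀ x, N.nabla (D.G x) = D.G.rTensor (Ω[A⁄S]) (N.nabla x)

/-- The Atiyah class `[d, ∇] : M → M ⊗ Ω¹`. -/
def Connection.atiyah (N : Connection S A M) (D : OddEnd A M) : M →ₗ[A] M ⊗[A] Ω[A⁄S] where
  toFun x := D.d.rTensor (Ω[A⁄S]) (N.nabla x) - N.nabla (D.d x)
  map_add' x y := by simp only [map_add]; abel
  map_smul' a x := by
    simp only [N.leibniz, map_add, map_smul, LinearMap.rTensor_tmul, RingHom.id_apply, smul_sub]
    abel

/-- Multiplication `Ω¹ ⊗ ⋀Ω¹ → ⋀Ω¹`. -/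
def wedgeMul (A Om : Type*) [CommRing A] [AddCommGroup Om] [Module A Om] :
    Om ⊗[A] ExteriorAlgebra A Om →ₗ[A] ExteriorAlgebra A Om :=
  TensorProduct.lift ((LinearMap.mul A (ExteriorAlgebra A Om)).comp (ExteriorAlgebra.ι A))

/-- The Atiyah class extended to `M ⊗ ⋀Ω¹`: if `[d, ∇] x = ∑ xᵢ ⊗ ωᵢ`, then `x ⊗ ω` is sent to
`∑ xᵢ ⊗ (ωᵢ ∧ ω)`. -/
def Connection.atiyahWedge (N : Connection S A M) (D : OddEnd A M) :
    Module.End A (M ⊗[A] ExteriorAlgebra A (Ω[A⁄S])) :=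
  (wedgeMul A (Ω[A⁄S])).lTensor M ∘ₗ
    (TensorProduct.assoc A M (Ω[A⁄S]) (ExteriorAlgebra A (Ω[A⁄S]))).toLinearMap ∘ₗ
    (N.atiyah D).rTensor (ExteriorAlgebra A (Ω[A⁄S]))

/-- The form `dt₁ ∧ ⋯ ∧ dt_m` on `S[t₁, …, t_m]`. -/
def topForm (S : Type*) [CommRing S] (m : ℕ) :
    ExteriorAlgebra (MvPolynomial (Fin m) S) (Ω[MvPolynomial (Fin m) S⁄S]) :=
  ExteriorAlgebra.ιMulti (MvPolynomial (Fin m) S) m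
    fun j => KaehlerDifferential.D S (MvPolynomial (Fin m) S) (MvPolynomial.X j)

/-- `α` is the `m`-th power `M → M ⊗ Ω^m ≅ M` of the Atiyah class relative to
`S[t₁, …, t_m] / S`, where `Ω^m` is trivialised by `dt₁ ∧ ⋯ ∧ dt_m`. -/
def Connection.IsAtiyahPower {m : ℕ} {M : Type*} [AddCommGroup M]
    [Module (MvPolynomial (Fin m) S) M] (N : Connection S (MvPolynomial (Fin m) S) M)
    (D : OddEnd (MvPolynomial (Fin m) S) M) (α : M →ₗ[MvPolynomial (Fin m) S] M) : Prop :=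
  ∀ x, α x ⊗ₜ topForm S m = ((N.atiyahWedge D) ^ m) (x ⊗ₜ 1)

end Atiyah

/-! ### Convolution over power series rings -/

section Convolution

open Sum

/-- The ideal generated by the variables. -/
def varIdeal (k σ : Type*) [CommRing k] : Ideal (MvPowerSeries σ k) :=
  Ideal.span (Set.range MvPowerSeries.X)

theorem X_mem_varIdeal (k : Type*) {σ : Type*} [CommRing k] (s : σ) :
    (MvPowerSeries.X s : MvPowerSeries σ k) ∈ varIdeal k σ :=
  Ideal.subset_span ⟨s, rfl⟩

section

variable {B A₁ A₂ : Type*} [CommRing B] [CommRing A₁] [CommRing A₂]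
  [Algebra B A₁] [Algebra B A₂] {I₁ : Ideal A₁} {I₂ : Ideal A₂}

theorem tmul_one_mem {a : A₁} (ha : a ∈ I₁) : a ⊗ₜ[B] (1 : A₂) ∈ tensorIdeal B I₁ I₂ :=
  Ideal.mem_sup_left (Ideal.mem_map_of_mem _ ha)

theorem one_tmul_mem {a : A₂} (ha : a ∈ I₂) : (1 : A₁) ⊗ₜ[B] a ∈ tensorIdeal B I₁ I₂ :=
  Ideal.mem_sup_right (Ideal.mem_map_of_mem _ ha)

end

/-- `k⟦y⟧ → k⟦y, z⟧` (the variables in the first group). -/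
instance algebraInl (k σ τ : Type*) [CommRing k] [Finite σ] :
    Algebra (MvPowerSeries σ k) (MvPowerSeries (σ ⊕ τ) k) :=
  (MvPowerSeries.rename (R := k) (inl : σ → σ ⊕ τ)).toRingHom.toAlgebra

/-- `k⟦y⟧ → k⟦x, y⟧` (the variables in the second group). -/
instance algebraInr (k σ τ : Type*) [CommRing k] [Finite τ] :
    Algebra (MvPowerSeries τ k) (MvPowerSeries (σ ⊕ τ) k) :=
  (MvPowerSeries.rename (R := k) (inr : τ → σ ⊕ τ)).toRingHom.toAlgebra

/-- The inclusion `π_{xz} : k⟦x, z⟧ → k⟦x, y, z⟧`. -/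
def piXZ (k : Type*) [CommRing k] (n m p : ℕ) :
    MvPowerSeries (Fin n ⊕ Fin p) k →+* MvPowerSeries (Fin n ⊕ Fin m ⊕ Fin p) k :=
  (MvPowerSeries.rename (R := k)
    (Sum.map id inr : Fin n ⊕ Fin p → Fin n ⊕ Fin m ⊕ Fin p)).toRingHom

/-- The canonical map `k⟦x, y, z⟧ → k⟦y, z⟧ ⊗̂_k k⟦x⟧`. -/
def rhoF (k : Type*) [CommRing k] (n m p : ℕ) :
    MvPowerSeries (Fin n ⊕ Fin m ⊕ Fin p) k →+*
      CompletedRing k (varIdeal k (Fin m ⊕ Fin p)) (varIdeal k (Fin n)) :=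
  psMap _ (algebraMap k _)
    (Sum.elim (fun i => 1 ⊗ₜ MvPowerSeries.X i) (fun s => MvPowerSeries.X s ⊗ₜ 1))
    (by
      rintro (i | s)
      · exact one_tmul_mem (X_mem_varIdeal k i)
      · exact tmul_one_mem (X_mem_varIdeal k s))

/-- The canonical map `k⟦x, y, z⟧ → k⟦x, y⟧ ⊗̂_k k⟦z⟧`. -/
def rhoE (k : Type*) [CommRing k] (n m p : ℕ) :
    MvPowerSeries (Fin n ⊕ Fin m ⊕ Fin p) k →+*
      CompletedRing k (varIdeal k (Fin n ⊕ Fin m)) (varIdeal k (Fin p)) :=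
  psMap _ (algebraMap k _)
    (Sum.elim (fun i => MvPowerSeries.X (inl i) ⊗ₜ 1)
      (Sum.elim (fun j => MvPowerSeries.X (inr j) ⊗ₜ 1) (fun l => 1 ⊗ₜ MvPowerSeries.X l)))
    (by
      rintro (i | j | l)
      · exact tmul_one_mem (X_mem_varIdeal k _)
      · exact tmul_one_mem (X_mem_varIdeal k _)
      · exact one_tmul_mem (X_mem_varIdeal k l))

/-- The canonical map `k⟦x, y, z⟧ → k⟦y, z⟧ ⊗̂_{k⟦y⟧} k⟦x, y⟧`. -/
def rhoFE (k : Type*) [CommRing k] (n m p : ℕ) :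
    MvPowerSeries (Fin n ⊕ Fin m ⊕ Fin p) k →+*
      CompletedRing (MvPowerSeries (Fin m) k) (varIdeal k (Fin m ⊕ Fin p))
        (varIdeal k (Fin n ⊕ Fin m)) :=
  psMap _ ((algebraMap (MvPowerSeries (Fin m) k) _).comp MvPowerSeries.C)
    (Sum.elim (fun i => 1 ⊗ₜ MvPowerSeries.X (inl i)) (fun s => MvPowerSeries.X s ⊗ₜ 1))
    (by
      rintro (i | s)
      · exact one_tmul_mem (X_mem_varIdeal k _)
      · exact tmul_one_mem (X_mem_varIdeal k s))

variable {k : Type u} [Field k] {n m p : ℕ}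
  {F : Type w} [AddCommGroup F] [Module (MvPowerSeries (Fin m ⊕ Fin p) k) F]
  [Module k F] [IsScalarTower k (MvPowerSeries (Fin m ⊕ Fin p) k) F]
  [Module (MvPowerSeries (Fin m) k) F]
  [IsScalarTower (MvPowerSeries (Fin m) k) (MvPowerSeries (Fin m ⊕ Fin p) k) F]
  {E : Type v} [AddCommGroup E] [Module (MvPowerSeries (Fin n ⊕ Fin m) k) E]
  [Module k E] [IsScalarTower k (MvPowerSeries (Fin n ⊕ Fin m) k) E]
  [Module (MvPowerSeries (Fin m) k) E]
  [IsScalarTower (MvPowerSeries (Fin m) k) (MvPowerSeries (Fin n ⊕ Fin m) k) E]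

variable (k n m p F) in
/-- `π^•_{yz}(F) = F ⊗̂_k k⟦x⟧`, a module over `k⟦x, y, z⟧`. -/
abbrev PiF : Type _ :=
  Restrict (rhoF k n m p)
    (CompletedTensor k (varIdeal k (Fin m ⊕ Fin p)) (varIdeal k (Fin n)) F
      (MvPowerSeries (Fin n) k))

variable (k n m p E) in
/-- `π^•_{xy}(E) = E ⊗̂_k k⟦z⟧`, a module over `k⟦x, y, z⟧`. -/
abbrev PiE : Type _ :=
  Restrict (rhoE k n m p)
    (CompletedTensor k (varIdeal k (Fin n ⊕ Fin m)) (varIdeal k (Fin p)) E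
      (MvPowerSeries (Fin p) k))

variable (n) in
/-- The factorisation `π^•_{yz}(F)`. -/
def piF (DF : OddEnd (MvPowerSeries (Fin m ⊕ Fin p) k) F) :
    OddEnd (MvPowerSeries (Fin n ⊕ Fin m ⊕ Fin p) k) (PiF k n m p F) :=
  (OddEnd.ctensor k _ _ DF (OddEnd.unit (MvPowerSeries (Fin n) k))).restrict _

variable (p) in
/-- The factorisation `π^•_{xy}(E)`. -/
def piE (DE : OddEnd (MvPowerSeries (Fin n ⊕ Fin m) k) E) :
    OddEnd (MvPowerSeries (Fin n ⊕ Fin m ⊕ Fin p) k) (PiE k n m p E) :=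
  (OddEnd.ctensor k _ _ DE (OddEnd.unit (MvPowerSeries (Fin p) k))).restrict _

variable (k n m p F E) in
/-- The module underlying the external tensor product `F ⊠ E`. -/
abbrev Box : Type _ :=
  PiF k n m p F ⊗[MvPowerSeries (Fin n ⊕ Fin m ⊕ Fin p) k] PiE k n m p E

/-- The external tensor product `F ⊠ E`. -/
def box (DF : OddEnd (MvPowerSeries (Fin m ⊕ Fin p) k) F)
    (DE : OddEnd (MvPowerSeries (Fin n ⊕ Fin m) k) E) :
    OddEnd (MvPowerSeries (Fin n ⊕ Fin m ⊕ Fin p) k) (Box k n m p F E) :=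
  (piF n DF).tensor (piE p DE)

/-- The element `(f ⊗̂ 1) ⊗ (e ⊗̂ 1)` of `F ⊠ E`. -/
def boxTmul (f : F) (e : E) : Box k n m p F E :=
  toRestrict (rhoF k n m p) (CompletedTensor.tmul k _ _ f 1) ⊗ₜ
    toRestrict (rhoE k n m p) (CompletedTensor.tmul k _ _ e 1)

/-- The convolution `F ⋆ E`, the pushforward of `F ⊠ E` to `k⟦x, z⟧`. -/
def conv (DF : OddEnd (MvPowerSeries (Fin m ⊕ Fin p) k) F)
    (DE : OddEnd (MvPowerSeries (Fin n ⊕ Fin m) k) E) :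
    OddEnd (MvPowerSeries (Fin n ⊕ Fin p) k) (Restrict (piXZ k n m p) (Box k n m p F E)) :=
  (box DF DE).restrict (piXZ k n m p)

/-- The sequence `t = (∂V/∂y₁, …, ∂V/∂y_m)`. -/
def tSeq (V : MvPowerSeries (Fin m) k) (i : Fin m) : MvPowerSeries (Fin m) k :=
  MvPowerSeries.pderiv k i V

/-- The ideal generated by `t` in a `k⟦y⟧`-algebra. -/
def tIdeal (V : MvPowerSeries (Fin m) k) (A : Type*) [CommRing A]
    [Algebra (MvPowerSeries (Fin m) k) A] : Ideal A :=
  Ideal.span (Set.range fun i => algebraMap (MvPowerSeries (Fin m) k) A (tSeq V i))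

/-- The Jacobi algebra `J_V = k⟦y⟧ / (∂V/∂y₁, …, ∂V/∂y_m)`. -/
abbrev Jacobi (V : MvPowerSeries (Fin m) k) : Type u :=
  MvPowerSeries (Fin m) k ⧸ Ideal.span (Set.range (tSeq V))

variable (n p) in
/-- The elements `t` in `k⟦x, y, z⟧`. -/
def tSeqXYZ (V : MvPowerSeries (Fin m) k) (i : Fin m) :
    MvPowerSeries (Fin n ⊕ Fin m ⊕ Fin p) k :=
  MvPowerSeries.rename (fun j : Fin m => (inr (inl j) : Fin n ⊕ Fin m ⊕ Fin p)) (tSeq V i)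

variable (n p F E) in
/-- The module underlying `F/tF ⊗̂_{k⟦y⟧} E/tE`, over `k⟦x, y, z⟧`. -/
abbrev QuotTensor (V : MvPowerSeries (Fin m) k) : Type _ :=
  Restrict (rhoFE k n m p)
    (CompletedTensor (MvPowerSeries (Fin m) k) (varIdeal k (Fin m ⊕ Fin p))
      (varIdeal k (Fin n ⊕ Fin m))
      (F ⧸ (tIdeal V (MvPowerSeries (Fin m ⊕ Fin p) k) •
        (⊤ : Submodule (MvPowerSeries (Fin m ⊕ Fin p) k) F)))
      (E ⧸ (tIdeal V (MvPowerSeries (Fin n ⊕ Fin m) k) •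
        (⊤ : Submodule (MvPowerSeries (Fin n ⊕ Fin m) k) E))))

/-- The factorisation `F/tF ⊗̂_{k⟦y⟧} E/tE` over `k⟦x, y, z⟧`. -/
def quotTensorXYZ (V : MvPowerSeries (Fin m) k)
    (DF : OddEnd (MvPowerSeries (Fin m ⊕ Fin p) k) F)
    (DE : OddEnd (MvPowerSeries (Fin n ⊕ Fin m) k) E) :
    OddEnd (MvPowerSeries (Fin n ⊕ Fin m ⊕ Fin p) k) (QuotTensor n p F E V) :=
  (OddEnd.ctensor (MvPowerSeries (Fin m) k) _ _ (DF.quot (tIdeal V _))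
    (DE.quot (tIdeal V _))).restrict _

/-- The factorisation `F/tF ⊗̂_{k⟦y⟧} E/tE` over `k⟦x, z⟧`. -/
def quotTensor (V : MvPowerSeries (Fin m) k)
    (DF : OddEnd (MvPowerSeries (Fin m ⊕ Fin p) k) F)
    (DE : OddEnd (MvPowerSeries (Fin n ⊕ Fin m) k) E) :
    OddEnd (MvPowerSeries (Fin n ⊕ Fin p) k)
      (Restrict (piXZ k n m p) (QuotTensor n p F E V)) :=
  (quotTensorXYZ V DF DE).restrict (piXZ k n m p)

/-- The element `[f] ⊗̂ [e]` of `F/tF ⊗̂_{k⟦y⟧} E/tE`. -/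
def quotTmul (V : MvPowerSeries (Fin m) k) (f : F) (e : E) : QuotTensor n p F E V :=
  toRestrict (rhoFE k n m p) (CompletedTensor.tmul (MvPowerSeries (Fin m) k) _ _
    (Submodule.Quotient.mk f) (Submodule.Quotient.mk e))

/-- `γ` is the canonical map `F ⊠ E → F/tF ⊗̂_{k⟦y⟧} E/tE`, and it identifies
`(F ⊠ E) / t (F ⊠ E)` with `F/tF ⊗̂_{k⟦y⟧} E/tE`. -/
structure IsReduction (V : MvPowerSeries (Fin m) k)
    (γ : Box k n m p F E →ₗ[MvPowerSeries (Fin n ⊕ Fin m ⊕ Fin p) k] QuotTensor n p F E V) :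
    Prop where
  apply_tmul : ∀ (f : F) (e : E), γ (boxTmul f e) = quotTmul V f e
  surjective : Function.Surjective γ
  ker : LinearMap.ker γ = Ideal.span (Set.range (tSeqXYZ n p V)) • ⊤

/-- The operator `∂_{yᵢ}(d_E)` on `E`, computed in the basis `b`. -/
def partialE (DE : OddEnd (MvPowerSeries (Fin n ⊕ Fin m) k) E) {ι : Type*} [Fintype ι]
    [DecidableEq ι] (b : Module.Basis ι (MvPowerSeries (Fin n ⊕ Fin m) k) E) (i : Fin m) :
    E →ₗ[MvPowerSeries (Fin n ⊕ Fin m) k] E :=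
  DE.derivD b (MvPowerSeries.pderiv k (inr i))

/-- The operator `1 ⊗ ∂_{yᵢ}(d_E)` on `F ⊠ E`, with the Koszul sign
`x ⊗ y ↦ (-1)^|x| x ⊗ ∂_{yᵢ}(d_E) y`. -/
def lam (DF : OddEnd (MvPowerSeries (Fin m ⊕ Fin p) k) F)
    (DE : OddEnd (MvPowerSeries (Fin n ⊕ Fin m) k) E) {ι : Type*} [Fintype ι]
    [DecidableEq ι] (b : Module.Basis ι (MvPowerSeries (Fin n ⊕ Fin m) k) E) (i : Fin m) :
    Module.End (MvPowerSeries (Fin n ⊕ Fin m ⊕ Fin p) k) (Box k n m p F E) :=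
  TensorProduct.map (piF n DF).G
    (restrictMap (rhoE k n m p)
      (CompletedTensor.map k (varIdeal k (Fin n ⊕ Fin m)) (varIdeal k (Fin p))
        (partialE DE b i) LinearMap.id))

/-- The product `∂_{y₁}(d_E) ⋯ ∂_{y_m}(d_E)` acting on `F ⊠ E`. -/
def lamProd (DF : OddEnd (MvPowerSeries (Fin m ⊕ Fin p) k) F)
    (DE : OddEnd (MvPowerSeries (Fin n ⊕ Fin m) k) E) {ι : Type*} [Fintype ι]
    [DecidableEq ι] (b : Module.Basis ι (MvPowerSeries (Fin n ⊕ Fin m) k) E) :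
    Module.End (MvPowerSeries (Fin n ⊕ Fin m ⊕ Fin p) k) (Box k n m p F E) :=
  (List.ofFn (lam DF DE b)).prod

variable (n p) in
/-- The ring morphism `k⟦x, z⟧[t₁, …, t_m] → k⟦x, y, z⟧` sending `tᵢ` to `∂V/∂yᵢ`. -/
def evalT (V : MvPowerSeries (Fin m) k) :
    MvPolynomial (Fin m) (MvPowerSeries (Fin n ⊕ Fin p) k) →+*
      MvPowerSeries (Fin n ⊕ Fin m ⊕ Fin p) k :=
  MvPolynomial.eval₂Hom (piXZ k n m p) (tSeqXYZ n p V)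

/-- `k⟦x, z⟧`-linear connections on `F ⊠ E` as a module over `k⟦x, z⟧[t]`. -/
abbrev BoxConnection (k : Type u) [Field k] (n p : ℕ) {m : ℕ} (F : Type w) [AddCommGroup F]
    [Module (MvPowerSeries (Fin m ⊕ Fin p) k) F] [Module k F]
    [IsScalarTower k (MvPowerSeries (Fin m ⊕ Fin p) k) F] (E : Type v) [AddCommGroup E]
    [Module (MvPowerSeries (Fin n ⊕ Fin m) k) E] [Module k E]
    [IsScalarTower k (MvPowerSeries (Fin n ⊕ Fin m) k) E] (V : MvPowerSeries (Fin m) k) :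
    Type _ :=
  Connection (MvPowerSeries (Fin n ⊕ Fin p) k)
    (MvPolynomial (Fin m) (MvPowerSeries (Fin n ⊕ Fin p) k))
    (Restrict (evalT n p V) (Box k n m p F E))

/-- `F ⊠ E` as a factorisation over `k⟦x, z⟧[t]`. -/
def boxT (V : MvPowerSeries (Fin m) k) (DF : OddEnd (MvPowerSeries (Fin m ⊕ Fin p) k) F)
    (DE : OddEnd (MvPowerSeries (Fin n ⊕ Fin m) k) E) :
    OddEnd (MvPolynomial (Fin m) (MvPowerSeries (Fin n ⊕ Fin p) k))
      (Restrict (evalT n p V) (Box k n m p F E)) :=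
  (box DF DE).restrict (evalT n p V)

/-- The operator `(1/m!) (-1)^(m+1 choose 2) ∂_{y₁}(d_E) ⋯ ∂_{y_m}(d_E) ∘ α` on `F ⊠ E`. -/
def idemFormula (V : MvPowerSeries (Fin m) k)
    (DF : OddEnd (MvPowerSeries (Fin m ⊕ Fin p) k) F)
    (DE : OddEnd (MvPowerSeries (Fin n ⊕ Fin m) k) E) {ι : Type*} [Fintype ι]
    [DecidableEq ι] (b : Module.Basis ι (MvPowerSeries (Fin n ⊕ Fin m) k) E)
    (α : Module.End (MvPolynomial (Fin m) (MvPowerSeries (Fin n ⊕ Fin p) k))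
      (Restrict (evalT n p V) (Box k n m p F E)))
    (x : Box k n m p F E) : Box k n m p F E :=
  (MvPowerSeries.C ((m.factorial : k)⁻¹ * (-1) ^ (m + 1).choose 2) :
      MvPowerSeries (Fin n ⊕ Fin m ⊕ Fin p) k) •
    lamProd DF DE b ((toRestrict (evalT n p V)).symm (α (toRestrict (evalT n p V) x)))

end Convolution

end

end MFConv

namespace MFConv
noncomputable section

/-! ### Koszul relations of a sequence containing a regular sequence -/

section Koszul

variable {R : Type u} [CommRing R]

/-! Write `X = F ⊠ E`, `R = k⟦x, y, z⟧` and `S = k⟦x, z⟧`. The proof rests on three properties of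
the action of `t` on `X`. First, every `t_i` is null-homotopic: differentiating `d_E² = V - W`
entrywise with respect to `y_i` shows that `λ_i = 1 ⊗ ∂_{y_i}(d_E)` satisfies `d λ_i + λ_i d = t_i`
(`lam_d`), and `λ_i` is `R`-linear, hence commutes with all `t_j`. Second, if `J_V ≠ 0`, then `x, t,
z` is a system of parameters of `R`, so `R` is finite free over itself through the substitution `y ↦
t` (`exists_basis_restrict`), and `X` becomes a finite sum of copies of `S⟦t⟧`. In these
coordinates, division by `t_i` with the remainder discarded is an `S`-linear left inverse of `t_i`
commuting with the other `t_j`, and `∂/∂t_i` gives a connection. Third, `X / tX` is `F/tF ⊗̂ E/tE`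
(`exists_isReduction`), which is free over `S` on the coordinate basis (`free_finite_quotTensor`).

For one element `T` of the sequence with left inverse `H`, the exact sequence `0 → X → X → X/TX → 0`
splits over `S` through the section `s = 1 - TH`, and its connecting morphism `X/TX → X[1]` is
`T⁻¹(ds - sd)`. As `T` is the boundary of `λ`, the map `x ↦ [λ x]` is a right inverse of it up to
homotopy (`conn_mk_L`). If `∇T = T∇ + 1`, its composite with the projection `X → X/TX` is homotopic
to `-[d, ∇]` (`mk_conn`). Iteration over the sequence (`exists_section`) produces `ψ`, the right
inverse `θ = q λ_1 ⋯ λ_m`, where `q` is the projection `X → X/tX`, and `q ψ ≃ (-1)^m A_m ⋯ A_1` with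
`A_i = [d, ∇_i]`.

The `A_i` anticommute up to homotopy, because `A_i A_j + A_j A_i` is the boundary of `[∇_i, A_j]`.
Hence the antisymmetrised product of the `A_i` is homotopic to `m! (-1)^(m choose 2) A_m ⋯ A_1`; by
`isAtiyahPower_atiyahPower` it is the `m`-th power of the Atiyah class. With `m + (m choose 2) = (m
+ 1 choose 2)` this is the asserted formula. If `J_V = 0`, the `t_i` generate the unit ideal; then
`X` is contractible, the quotient is zero, and `ψ = θ = 0`.

Two points of commutative algebra are proved by hand. Finite freeness over the substitution is a
form of the local criterion of flatness, whose input is the vanishing of the first Koszul homology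
of a system of parameters. The uncompleted tensor products of power series rings need not be
Noetherian, so their completions are compared with `k⟦σ⟧` modulo each power of the ideal, and
Krull's intersection theorem is applied only in `k⟦σ⟧`. -/

theorem mem_ideal_smul_top_iff_repr {K ι : Type*} [AddCommGroup K] [Module R K]
    (B : Module.Basis ι R K) (J : Ideal R) (x : K) :
    x ∈ (J • ⊤ : Submodule R K) ↔ ∀ i, B.repr x i ∈ J := by
  constructor
  · intro hx i
    refine Submodule.smul_induction_on hx (fun r hr n _ => ?_) (fun y z hy hz => ?_)
    · simpa using J.mul_mem_right _ hr
    · simpa using J.add_mem hy hz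
  · intro h
    rw [← B.linearCombination_repr x, Finsupp.linearCombination_apply]
    exact Submodule.sum_mem _ fun i _ => Submodule.smul_mem_smul (h i) trivial

theorem exteriorPower_eq_zero [Nontrivial R] {M : Type*} [AddCommGroup M] [Module R M]
    [Module.Free R M] [Module.Finite R M] {n : ℕ} (h : Module.finrank R M < n)
    {x : ExteriorAlgebra R M} (hx : x ∈ ⋀[R]^n M) : x = 0 := by
  have h0 : Module.finrank R (⋀[R]^n M) = 0 := by
    rw [exteriorPower.finrank_eq, Nat.choose_eq_zero_of_lt h]
  have : Subsingleton (⋀[R]^n M) := Module.subsingleton_of_rank_zero (R := R) (by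
    rw [← Module.finrank_eq_rank, h0, Nat.cast_zero])
  exact congrArg Subtype.val (Subsingleton.elim (⟨x, hx⟩ : ⋀[R]^n M) 0)

variable {M : Type v} [AddCommGroup M] [Module R M] (f : Module.Dual R M)

/-- The differential of the Koszul complex of a linear form. -/
def koszulD : ExteriorAlgebra R M →ₗ[R] ExteriorAlgebra R M :=
  CliffordAlgebra.contractLeft f

theorem koszulD_ι_mul (x : M) (w : ExteriorAlgebra R M) :
    koszulD f (ExteriorAlgebra.ι R x * w) = f x • w - ExteriorAlgebra.ι R x * koszulD f w :=
  CliffordAlgebra.contractLeft_ι_mul _ _ _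

theorem koszulD_koszulD (w : ExteriorAlgebra R M) : koszulD f (koszulD f w) = 0 :=
  CliffordAlgebra.contractLeft_contractLeft _ w

theorem koszulD_ι (x : M) : koszulD f (ExteriorAlgebra.ι R x) = algebraMap R _ (f x) :=
  CliffordAlgebra.contractLeft_ι (0 : QuadraticForm R M) (d := f) x

theorem koszulD_algebraMap (r : R) : koszulD f (algebraMap R _ r) = 0 :=
  CliffordAlgebra.contractLeft_algebraMap (0 : QuadraticForm R M) (d := f) r

theorem map_mem_ideal_smul_top {K L : Type*} [AddCommGroup K] [Module R K] [AddCommGroup L]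
    [Module R L] (g : K →ₗ[R] L) (J : Ideal R) {x : K} (hx : x ∈ (J • ⊤ : Submodule R K)) :
    g x ∈ (J • ⊤ : Submodule R L) := Submodule.smul_top_le_comap_smul_top J g hx

/-- If the values of a linear form on a module of rank `q` contain a regular sequence of length
`q`, then the Koszul complex is exact in degree one. -/
theorem koszul_exact_one [Nontrivial R] [Module.Free R M] [Module.Finite R M] (c : ℕ → M)
    (hc : ∀ r < Module.finrank R M, ∀ z : R,
      f (c r) * z ∈ Ideal.span ((fun j => f (c j)) '' Set.Iio r) →
        z ∈ Ideal.span ((fun j => f (c j)) '' Set.Iio r))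
    (v : M) (hv : f v = 0) : ∃ w, ExteriorAlgebra.ι R v = koszulD f w := by
  classical
  set q := Module.finrank R M with hq
  set J : ℕ → Ideal R := fun r => Ideal.span ((fun j => f (c j)) '' Set.Iio r) with hJ
  -- Descending induction on `r`: modulo `J r`, cycles of degree `r + 1` are boundaries. It starts
  -- at `r = q`, where the exterior power of degree `q + 1` vanishes, and ends at `r = 0`, where `J
  -- 0 = ⊥`. The degree of the primitive is not tracked.
  have key : ∀ i r, r + i = q → ∀ w ∈ ⋀[R]^(r + 1) M,
      koszulD f w ∈ (J r • ⊤ : Submodule R (ExteriorAlgebra R M)) →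
      ∃ v, w - koszulD f v ∈ (J r • ⊤ : Submodule R (ExteriorAlgebra R M)) := by
    intro i
    induction i with
    | zero =>
      intro r hr w hw _
      refine ⟨0, ?_⟩
      rw [exteriorPower_eq_zero (by omega) hw]
      simp
    | succ i ih =>
      intro r hr z hz hdz
      set s := f (c r) with hs
      have hJs : J (r + 1) = J r ⊔ Ideal.span {s} := by
        simp only [hJ]
        rw [← Ideal.span_union, ← Set.image_singleton (f := fun j => f (c j)), ← Set.image_union]
        congr 2
        ext j
        simp
      have hle : J r ≤ J (r + 1) := hJs ▸ le_sup_left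
      have hsm : s ∈ J (r + 1) := hJs ▸ Ideal.mem_sup_right (Ideal.mem_span_singleton_self s)
      -- Wedging with `c r` raises the degree by one, and `d(c ∧ z) = s z - c ∧ dz` is zero modulo
      -- `J (r + 1)`, the ideal that contains `s` as well.
      obtain ⟨v, hv⟩ := ih (r + 1) (by omega) (ExteriorAlgebra.ι R (c r) * z) (by
          have h1 : ExteriorAlgebra.ι R (c r) ∈
              LinearMap.range (ExteriorAlgebra.ι R (M := M)) ^ 1 := by
            rw [pow_one]; exact ⟨_, rfl⟩
          have := Submodule.mul_mem_mul h1 hz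
          rwa [← pow_add, add_comm 1 (r + 1)] at this) (by
          rw [koszulD_ι_mul]
          refine Submodule.sub_mem _ (Submodule.smul_mem_smul hsm trivial) ?_
          exact Submodule.smul_mono_left hle
            (map_mem_ideal_smul_top (LinearMap.mulLeft R _) _ hdz))
      rw [hJs, Submodule.sup_smul, Submodule.mem_sup] at hv
      obtain ⟨j, hj, y, hy, hjy⟩ := hv
      rw [Submodule.ideal_span_singleton_smul] at hy
      obtain ⟨w', -, rfl⟩ := hy
      refine ⟨w', ?_⟩
      have hw : ExteriorAlgebra.ι R (c r) * z = koszulD f v + (j + s • w') := by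
        rw [show j + s • w' = _ from hjy]; abel
      have h2 := congrArg (koszulD f) hw
      rw [koszulD_ι_mul, map_add, koszulD_koszulD, zero_add, map_add, map_smul] at h2
      -- The differential of `c ∧ z = dv + j + s w'` leaves `s (z - dw')` in `J r`; the factor `s`
      -- is then cancelled in each coordinate of a basis of the exterior algebra.
      have h3 : s • (z - koszulD f w') ∈ (J r • ⊤ : Submodule R (ExteriorAlgebra R M)) := by
        have : s • (z - koszulD f w') =
            koszulD f j + ExteriorAlgebra.ι R (c r) * koszulD f z := by
          rw [smul_sub, sub_eq_iff_eq_add, add_right_comm, ← h2, sub_add_cancel]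
        rw [this]
        exact Submodule.add_mem _ (map_mem_ideal_smul_top _ _ hj)
          (map_mem_ideal_smul_top (LinearMap.mulLeft R _) _ hdz)
      obtain ⟨I, b⟩ := Module.Free.exists_basis (R := R) (M := M)
      let : LinearOrder I := linearOrderOfSTO (WellOrderingRel (α := I))
      rw [mem_ideal_smul_top_iff_repr b.ExteriorAlgebra] at h3 ⊢
      intro i'
      refine hc r (by omega) _ ?_
      simpa using h3 i'
  obtain ⟨w, hw⟩ := key q 0 (by omega) (ExteriorAlgebra.ι R v) (by simp)
    (by rw [koszulD_ι, hv, map_zero]; exact Submodule.zero_mem _)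
  refine ⟨w, sub_eq_zero.mp ?_⟩
  have : J 0 = ⊥ := by simp [hJ]
  rw [this, Submodule.bot_smul] at hw
  simpa using hw

theorem ιInv_algebraMap (r : R) :
    ExteriorAlgebra.ιInv (algebraMap R (ExteriorAlgebra R M) r) = 0 := by
  let : Module Rᵐᵒᵖ M := Module.compHom _ ((RingHom.id R).fromOpposite mul_comm)
  have : IsCentralScalar R M := ⟨fun r m => rfl⟩
  change (ExteriorAlgebra.toTrivSqZeroExt (algebraMap R (ExteriorAlgebra R M) r)).snd = 0
  rw [AlgHom.commutes, TrivSqZeroExt.algebraMap_eq_inl, TrivSqZeroExt.snd_inl]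

/-- `ιInv` is the degree-one part, computed in the trivial square-zero extension, where only the
scalar part of `w` survives multiplication by `x`. -/
theorem ιInv_ι_mul (x : M) (w : ExteriorAlgebra R M) :
    ExteriorAlgebra.ιInv (ExteriorAlgebra.ι R x * w) = ExteriorAlgebra.algebraMapInv w • x := by
  let : Module Rᵐᵒᵖ M := Module.compHom _ ((RingHom.id R).fromOpposite mul_comm)
  have : IsCentralScalar R M := ⟨fun r m => rfl⟩
  have h : (TrivSqZeroExt.fstHom R R M).comp ExteriorAlgebra.toTrivSqZeroExt =
      ExteriorAlgebra.algebraMapInv := by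
    ext
    simp [ExteriorAlgebra.algebraMapInv]
  have h' := DFunLike.congr_fun h w
  change (ExteriorAlgebra.toTrivSqZeroExt (ExteriorAlgebra.ι R x * w)).snd = _
  rw [map_mul, ExteriorAlgebra.toTrivSqZeroExt_ι, TrivSqZeroExt.snd_mul, ← h']
  simp

/-- The differential lowers the degree by one, so the scalar part of a boundary only sees the
degree-one part of `w`. -/
theorem algebraMapInv_koszulD (w : ExteriorAlgebra R M) :
    ExteriorAlgebra.algebraMapInv (koszulD f w) = f (ExteriorAlgebra.ιInv w) := by
  induction w using CliffordAlgebra.left_induction with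
  | algebraMap r =>
    have h1 := koszulD_algebraMap f r
    have h2 := ιInv_algebraMap (M := M) r
    exact (congrArg _ h1).trans (by rw [map_zero, ← map_zero f]; exact (congrArg f h2).symm)
  | add x y hx hy => simp only [map_add, hx, hy]
  | ι_mul x m hx =>
    have h1 := koszulD_ι_mul f m x
    have h2 := ιInv_ι_mul m x
    refine (congrArg _ h1).trans (Eq.trans ?_ (congrArg f h2).symm)
    rw [map_sub, map_smul, map_mul, map_smul, smul_eq_mul, smul_eq_mul, mul_comm]
    simp [ExteriorAlgebra.algebraMapInv]

/-- If `a` contains a regular sequence of full length in its span, then all relations between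
the elements of `a` are generated by the trivial ones. -/
theorem exists_trivial_relation {σ : Type*} [Fintype σ] [Nontrivial R] (a : σ → R) (s : ℕ → R)
    (hs : ∀ r, s r ∈ Ideal.span (Set.range a))
    (hreg : ∀ r < Fintype.card σ, ∀ z : R,
      s r * z ∈ Ideal.span (s '' Set.Iio r) → z ∈ Ideal.span (s '' Set.Iio r))
    (v : σ → R) (hv : ∑ i, a i * v i = 0) :
    ∃ w : σ → σ → R, ∀ i, v i = ∑ l, a l * (w l i - w i l) := by
  classical
  let f : Module.Dual R (σ → R) := Fintype.linearCombination R a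
  have hf : ∀ x, f x = ∑ i, a i * x i := fun x => by
    simp [f, Fintype.linearCombination_apply, mul_comm]
  choose c hc using fun r => (Submodule.mem_span_range_iff_exists_fun R).mp (hs r)
  have hc' : (fun r => f (c r)) = s := by
    ext r
    rw [hf, ← hc r]
    simp [mul_comm]
  obtain ⟨w, hw⟩ := koszul_exact_one f c (by
    intro r hr z
    have := congrFun hc' r
    rw [Module.finrank_fintype_fun_eq_card] at hr
    simpa only [hc', this] using hreg r hr z) v (by rw [hf, hv])
  -- Writing `w₁` for the degree-one part of `w`, that of `d(x ∧ w)` is `f(x) w₁ - f(w₁) x`. This is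
  -- the trivial relation with coefficients `x_l (w₁)_i`.
  have key : ∀ w : ExteriorAlgebra R (σ → R), ∃ u : σ → σ → R, ∀ i,
      ExteriorAlgebra.ιInv (koszulD f w) i = ∑ l, a l * (u l i - u i l) := by
    intro w
    induction w using CliffordAlgebra.left_induction with
    | algebraMap r =>
      refine ⟨0, fun i => ?_⟩
      have h1 := koszulD_algebraMap f r
      refine (congrFun (congrArg ExteriorAlgebra.ιInv h1) i).trans ?_
      simp
    | add x y hx hy =>
      obtain ⟨u, hu⟩ := hx
      obtain ⟨u', hu'⟩ := hy
      refine ⟨u + u', fun i => ?_⟩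
      rw [map_add, map_add, Pi.add_apply, hu, hu', ← Finset.sum_add_distrib]
      exact Finset.sum_congr rfl fun l _ => by simp only [Pi.add_apply]; ring
    | ι_mul w x hx =>
      refine ⟨fun l i => x l * ExteriorAlgebra.ιInv w i, fun i => ?_⟩
      have h1 := koszulD_ι_mul f x w
      refine (congrFun (congrArg ExteriorAlgebra.ιInv h1) i).trans ?_
      rw [map_sub, map_smul, ιInv_ι_mul, algebraMapInv_koszulD, hf, hf, Pi.sub_apply,
        Pi.smul_apply, Pi.smul_apply, smul_eq_mul, smul_eq_mul, Finset.sum_mul, Finset.sum_mul,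
        ← Finset.sum_sub_distrib]
      exact Finset.sum_congr rfl fun l _ => by ring
  obtain ⟨u, hu⟩ := key w
  refine ⟨u, fun i => ?_⟩
  rw [← hu, ← hw, ExteriorAlgebra.ι_leftInverse]

end Koszul


/-! ### Ideals of power series rings generated by powers of the variables -/

section PowerSeriesIdeals

variable {σ : Type*} {k : Type*} [CommRing k]

theorem coeff_X_pow_mul_ite (i : σ) (N : ℕ) (e : σ →₀ ℕ) (g : MvPowerSeries σ k) :
    MvPowerSeries.coeff e (MvPowerSeries.X i ^ N * g) =
      if N ≤ e i then MvPowerSeries.coeff (e - Finsupp.single i N) g else 0 := by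
  classical
  rw [MvPowerSeries.X_pow_eq, MvPowerSeries.coeff_monomial_mul]
  simp

/-- Every exponent that is at least `N` in some variable of `T` is assigned to one such variable,
and `g i` collects the monomials assigned to `i`, divided by `X i ^ N`. The last clause controls the
order of vanishing of `g i`. -/
theorem exists_eq_sum_X_pow_mul (T : Finset σ) (N : ℕ) (f : MvPowerSeries σ k)
    (hf : ∀ e : σ →₀ ℕ, (∀ i ∈ T, e i < N) → MvPowerSeries.coeff e f = 0) :
    ∃ g : σ → MvPowerSeries σ k, f = ∑ i ∈ T, MvPowerSeries.X i ^ N * g i ∧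
      ∀ i d, MvPowerSeries.coeff d (g i) = 0 ∨
        MvPowerSeries.coeff d (g i) = MvPowerSeries.coeff (d + Finsupp.single i N) f := by
  classical
  have hch : ∀ e : σ →₀ ℕ, ∃ o : Option σ, (∀ i ∈ o, i ∈ T ∧ N ≤ e i) ∧
      (o = none → ∀ i ∈ T, e i < N) := by
    intro e
    by_cases h : ∃ i ∈ T, N ≤ e i
    · obtain ⟨i, hi, hN⟩ := h
      exact ⟨some i, by simp [hi, hN], by simp⟩
    · push Not at h
      exact ⟨none, by simp, fun _ => h⟩
  choose c hc hc' using hch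
  let g : σ → MvPowerSeries σ k := fun i d =>
    if c (d + Finsupp.single i N) = some i then
      MvPowerSeries.coeff (d + Finsupp.single i N) f else 0
  have hg : ∀ i d, MvPowerSeries.coeff d (g i) = if c (d + Finsupp.single i N) = some i then
      MvPowerSeries.coeff (d + Finsupp.single i N) f else 0 := fun _ _ => rfl
  refine ⟨g, ?_, fun i d => ?_⟩
  · ext e
    rw [map_sum]
    have h1 : ∀ i ∈ T, MvPowerSeries.coeff e (MvPowerSeries.X i ^ N * g i) =
        if c e = some i then MvPowerSeries.coeff e f else 0 := by
      intro i _
      rw [coeff_X_pow_mul_ite, hg]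
      by_cases hi : N ≤ e i
      · rw [if_pos hi, tsub_add_cancel_of_le (by simpa using hi)]
      · rw [if_neg hi, if_neg (c := c e = some i) fun h => hi (hc e i h).2]
    rw [Finset.sum_congr rfl h1]
    rcases h : c e with _ | i
    · simp [hf e (hc' e h)]
    · have := (hc e i h).1
      simp [this]
  · rw [hg]
    split_ifs
    · exact Or.inr rfl
    · exact Or.inl rfl

theorem mem_span_X_pow_iff (T : Finset σ) (N : ℕ) (f : MvPowerSeries σ k) :
    f ∈ Ideal.span ((fun i => (MvPowerSeries.X i : MvPowerSeries σ k) ^ N) '' (T : Set σ)) ↔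
      ∀ e : σ →₀ ℕ, (∀ i ∈ T, e i < N) → MvPowerSeries.coeff e f = 0 := by
  classical
  constructor
  · intro h e he
    refine Submodule.span_induction (p := fun f _ => MvPowerSeries.coeff e f = 0) ?_ ?_ ?_ ?_ h
    · rintro _ ⟨i, hi, rfl⟩
      change MvPowerSeries.coeff e ((MvPowerSeries.X i : MvPowerSeries σ k) ^ N) = 0
      rw [← mul_one (_ ^ N), coeff_X_pow_mul_ite, if_neg (not_le.mpr (he i hi))]
    · simp
    · intro x y _ _ hx hy
      rw [map_add, hx, hy, add_zero]
    · intro a x hx hx'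
      clear hx'
      obtain ⟨c, rfl⟩ : ∃ c : T → MvPowerSeries σ k,
          ∑ i, c i * (MvPowerSeries.X i.1 : MvPowerSeries σ k) ^ N = x := by
        rw [Set.image_eq_range] at hx
        exact (Submodule.mem_span_range_iff_exists_fun _).mp hx
      rw [smul_eq_mul, Finset.mul_sum, map_sum]
      refine Finset.sum_eq_zero fun i _ => ?_
      rw [← mul_assoc, mul_comm, coeff_X_pow_mul_ite, if_neg (not_le.mpr (he i i.2))]
  · intro h
    obtain ⟨g, hg, -⟩ := exists_eq_sum_X_pow_mul T N f h
    rw [hg]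
    exact Ideal.sum_mem _ fun i hi => Ideal.mul_mem_right _ _ (Ideal.subset_span ⟨i, hi, rfl⟩)

/-- This is the regularity of the sequence of powers `X i ^ N`: shifting exponents by `N` in a
variable outside `T` does not affect the coefficientwise criterion for membership. -/
theorem mem_span_X_pow_of_X_pow_mul_mem (T : Finset σ) (N : ℕ) (i : σ) (hi : i ∉ T)
    (f : MvPowerSeries σ k)
    (h : MvPowerSeries.X i ^ N * f ∈
      Ideal.span ((fun i => (MvPowerSeries.X i : MvPowerSeries σ k) ^ N) '' (T : Set σ))) :
    f ∈ Ideal.span ((fun i => (MvPowerSeries.X i : MvPowerSeries σ k) ^ N) '' (T : Set σ)) := by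
  classical
  rw [mem_span_X_pow_iff] at h ⊢
  intro e he
  have := h (e + Finsupp.single i N) fun j hj => by
    have : i ≠ j := fun h => hi (h ▸ hj)
    simpa [Finsupp.single_apply, this] using he j hj
  rw [coeff_X_pow_mul_ite, if_pos (by simp)] at this
  simpa using this

variable [Finite σ]

/-- For the converse, a series without constant term is `∑ X i * g i` with each `g i` built from
coefficients of `f` of degree one higher, so the order of vanishing drops by exactly one. -/
theorem mem_varIdeal_pow_iff (n : ℕ) (f : MvPowerSeries σ k) :
    f ∈ varIdeal k σ ^ n ↔ ∀ e : σ →₀ ℕ, e.degree < n → MvPowerSeries.coeff e f = 0 := by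
  classical
  have := Fintype.ofFinite σ
  induction n generalizing f with
  | zero => simp
  | succ n ih =>
    constructor
    · intro h e he
      rw [pow_succ'] at h
      refine Submodule.smul_induction_on h ?_ ?_
      · intro a ha b hb
        rw [smul_eq_mul]
        refine Submodule.span_induction
          (p := fun a _ => ∀ b ∈ varIdeal k σ ^ n, MvPowerSeries.coeff e (a * b) = 0)
          ?_ ?_ ?_ ?_ ha b hb
        · rintro _ ⟨i, rfl⟩ b hb
          rw [← pow_one (MvPowerSeries.X i), coeff_X_pow_mul_ite]
          split_ifs with h1
          · refine (ih b).mp hb _ ?_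
            have h2 : e - Finsupp.single i 1 + Finsupp.single i 1 = e :=
              tsub_add_cancel_of_le (by simpa using h1)
            have h3 := congrArg Finsupp.degree h2
            rw [map_add, Finsupp.degree_single] at h3
            omega
          · rfl
        · simp
        · intro x y _ _ hx hy b hb
          rw [add_mul, map_add, hx b hb, hy b hb, add_zero]
        · intro c x _ hx b hb
          rw [smul_eq_mul, mul_comm c x, mul_assoc]
          exact hx _ (Ideal.mul_mem_left _ _ hb)
      · intro x y hx hy
        rw [map_add, hx, hy, add_zero]
    · intro h
      obtain ⟨g, hg, hg'⟩ := exists_eq_sum_X_pow_mul Finset.univ 1 f fun e he => h e (by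
        have : e = 0 := by
          ext i
          have := he i (Finset.mem_univ i)
          simpa using this
        simp [this])
      rw [hg, pow_succ']
      refine Ideal.sum_mem _ fun i _ => ?_
      rw [pow_one]
      refine Ideal.mul_mem_mul (X_mem_varIdeal k i) ((ih _).mpr fun d hd => ?_)
      rcases hg' i d with h0 | h0
      · exact h0
      · rw [h0]
        exact h _ (by rw [map_add, Finsupp.degree_single]; omega)

theorem mem_varIdeal_iff (f : MvPowerSeries σ k) :
    f ∈ varIdeal k σ ↔ MvPowerSeries.constantCoeff f = 0 := by
  have := mem_varIdeal_pow_iff 1 f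
  rw [pow_one] at this
  rw [this, ← MvPowerSeries.coeff_zero_eq_constantCoeff_apply]
  refine ⟨fun h => h 0 (by simp), fun h e he => ?_⟩
  rw [Nat.lt_one_iff, Finsupp.degree_eq_zero_iff] at he
  rw [he, h]

theorem isAdicComplete_varIdeal : IsAdicComplete (varIdeal k σ) (MvPowerSeries σ k) where
  haus' x hx := by
    ext e
    have := hx (e.degree + 1)
    rw [SModEq.zero, smul_eq_mul, Ideal.mul_top, mem_varIdeal_pow_iff] at this
    simpa using this e (by omega)
  prec' f hf := by
    -- From `f (d + 1)` onwards the coefficients of degree `d` no longer change.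
    let l : MvPowerSeries σ k := fun e => MvPowerSeries.coeff e (f (e.degree + 1))
    have hl : ∀ e, MvPowerSeries.coeff e l = MvPowerSeries.coeff e (f (e.degree + 1)) :=
      fun _ => rfl
    refine ⟨l, fun n => ?_⟩
    rw [SModEq.sub_mem, smul_eq_mul, Ideal.mul_top, mem_varIdeal_pow_iff]
    intro e he
    have h1 := hf (show e.degree + 1 ≤ n by omega)
    rw [SModEq.sub_mem, smul_eq_mul, Ideal.mul_top, mem_varIdeal_pow_iff] at h1
    have h2 := h1 e (by omega)
    rw [map_sub] at h2 ⊢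
    rw [hl, ← neg_eq_zero, ← h2, neg_sub]

end PowerSeriesIdeals

theorem maximalIdeal_eq_varIdeal (k σ : Type*) [Field k] [Finite σ] :
    IsLocalRing.maximalIdeal (MvPowerSeries σ k) = varIdeal k σ := by
  ext f
  rw [mem_varIdeal_iff, IsLocalRing.mem_maximalIdeal, mem_nonunits_iff,
    MvPowerSeries.isUnit_iff_constantCoeff, isUnit_iff_ne_zero, not_not]

/-! ### Finite free substitutions -/

section FiniteFree

variable {σ : Type u} {k : Type v} [Field k] [Finite σ]

instance isPrecomplete_pi {A ι : Type*} [CommRing A] (I : Ideal A) [IsPrecomplete I A] [Finite ι] :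
    IsPrecomplete I (ι → A) where
  prec' f hf := by
    classical
    have := Fintype.ofFinite ι
    have h : ∀ (n : ℕ) (x : ι → A), x ∈ (I ^ n • ⊤ : Submodule A (ι → A)) ↔ ∀ i, x i ∈ I ^ n := by
      intro n x
      rw [mem_ideal_smul_top_iff_repr (Pi.basisFun A ι)]
      simp
    have h1 : ∀ i, ∃ L, ∀ n, f n i ≡ L [SMOD (I ^ n • ⊤ : Submodule A A)] := by
      intro i
      refine IsPrecomplete.prec' (fun n => f n i) fun {a b} hab => ?_
      have := hf hab
      rw [SModEq.sub_mem, h] at this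
      rw [SModEq.sub_mem, smul_eq_mul, Ideal.mul_top]
      exact this i
    choose L hL using h1
    refine ⟨L, fun n => ?_⟩
    rw [SModEq.sub_mem, h]
    intro i
    have := hL i n
    rwa [SModEq.sub_mem, smul_eq_mul, Ideal.mul_top] at this

/-- The quotient is Artinian, so `J` contains a power of the maximal ideal. -/
theorem exists_X_pow_mem (J : Ideal (MvPowerSeries σ k))
    [Module.Finite k (MvPowerSeries σ k ⧸ J)] :
    ∃ N : ℕ, ∀ i, (MvPowerSeries.X i : MvPowerSeries σ k) ^ N ∈ J := by
  have : IsArtinianRing (MvPowerSeries σ k ⧸ J) := IsArtinianRing.of_finite k _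
  obtain ⟨N, hN⟩ := IsLocalRing.exists_maximalIdeal_pow_le_of_isArtinianRing_quotient J
  rw [maximalIdeal_eq_varIdeal] at hN
  exact ⟨N, fun i => hN (Ideal.pow_mem_pow (X_mem_varIdeal k i) N)⟩

/-- The regularity of `a` itself is not needed: its ideal contains the regular sequence of the `X i
^ N`, which has the same length. -/
theorem exists_trivial_relation_of_finite [Fintype σ] (a : σ → MvPowerSeries σ k)
    [Module.Finite k (MvPowerSeries σ k ⧸ Ideal.span (Set.range a))]
    (v : σ → MvPowerSeries σ k) (hv : ∑ i, a i * v i = 0) :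
    ∃ w : σ → σ → MvPowerSeries σ k, ∀ i, v i = ∑ l, a l * (w l i - w i l) := by
  classical
  obtain ⟨N, hN⟩ := exists_X_pow_mem (Ideal.span (Set.range a))
  let en := (Fintype.equivFin σ).symm
  -- Only the first `card σ` terms matter; the value `0` beyond them is a default.
  let s : ℕ → MvPowerSeries σ k := fun r =>
    if h : r < Fintype.card σ then MvPowerSeries.X (en ⟨r, h⟩) ^ N else 0
  refine exists_trivial_relation a s (fun r => ?_) (fun r hr z hz => ?_) v hv
  · by_cases h : r < Fintype.card σ
    · simpa only [s, dif_pos h] using hN _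
    · simp only [s, dif_neg h, Ideal.zero_mem]
  · let T : Finset σ := Finset.univ.filter fun i => (en.symm i : ℕ) < r
    have hT : s '' Set.Iio r =
        (fun i => (MvPowerSeries.X i : MvPowerSeries σ k) ^ N) '' (T : Set σ) := by
      ext x
      constructor
      · rintro ⟨j, hj, rfl⟩
        have hj' : j < r := hj
        refine ⟨en ⟨j, hj'.trans hr⟩, by simpa [T] using hj', ?_⟩
        simp only [s, dif_pos (hj'.trans hr)]
      · rintro ⟨i, hi, rfl⟩
        refine ⟨en.symm i, by simpa [T] using hi, ?_⟩
        simp [s]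
    rw [hT] at hz ⊢
    refine mem_span_X_pow_of_X_pow_mul_mem T N (en ⟨r, hr⟩) (by simp [T]) z ?_
    simpa only [s, dif_pos hr] using hz

/-- If `a` is a system of parameters of `k⟦σ⟧` indexed by `σ`, then `k⟦σ⟧` is finite free as a
module over itself, through the substitution `X i ↦ a i`. -/
theorem exists_basis_restrict (a : σ → MvPowerSeries σ k)
    (ha : ∀ i, MvPowerSeries.constantCoeff (a i) = 0)
    [Module.Finite k (MvPowerSeries σ k ⧸ Ideal.span (Set.range a))]
    (φ : MvPowerSeries σ k →ₐ[k] MvPowerSeries σ k) (hφ : ∀ i, φ (MvPowerSeries.X i) = a i) :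
    ∃ μ : ℕ, Nonempty (Module.Basis (Fin μ) (MvPowerSeries σ k)
      (Restrict (φ : MvPowerSeries σ k →+* MvPowerSeries σ k) (MvPowerSeries σ k))) := by
  classical
  have := Fintype.ofFinite σ
  have := isAdicComplete_varIdeal (σ := σ) (k := k)
  set J := Ideal.span (Set.range a) with hJ
  set Y := Restrict (φ : MvPowerSeries σ k →+* MvPowerSeries σ k) (MvPowerSeries σ k) with hY
  let τ : MvPowerSeries σ k ≃+ Y := toRestrict _
  have hτ : ∀ r x, r • τ x = τ (φ r * x) := fun _ _ => rfl
  have hJm : J ≤ varIdeal k σ := by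
    rw [hJ, Ideal.span_le]
    rintro _ ⟨i, rfl⟩
    exact (mem_varIdeal_iff _).mpr (ha i)
  have hφJ : ∀ r ∈ varIdeal k σ, φ r ∈ J := by
    intro r hr
    have : varIdeal k σ ≤ J.comap (φ : MvPowerSeries σ k →+* MvPowerSeries σ k) := by
      rw [varIdeal, Ideal.span_le]
      rintro _ ⟨i, rfl⟩
      exact Ideal.subset_span ⟨i, (hφ i).symm⟩
    exact this hr
  have hJY : ∀ x ∈ J, τ x ∈ (varIdeal k σ • ⊤ : Submodule (MvPowerSeries σ k) Y) := by
    intro x hx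
    obtain ⟨c, rfl⟩ := (Submodule.mem_span_range_iff_exists_fun _).mp hx
    rw [map_sum]
    refine Submodule.sum_mem _ fun i _ => ?_
    rw [smul_eq_mul, mul_comm, ← hφ, ← hτ]
    exact Submodule.smul_mem_smul (X_mem_varIdeal k i) trivial
  have hYm : ∀ (n : ℕ) (y : Y), y ∈ (varIdeal k σ ^ n • ⊤ : Submodule (MvPowerSeries σ k) Y) →
      τ.symm y ∈ varIdeal k σ ^ n := by
    intro n y hy
    refine Submodule.smul_induction_on hy (fun r hr x _ => ?_) fun x y hx hy => ?_
    · obtain ⟨x, rfl⟩ := τ.surjective x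
      rw [hτ, AddEquiv.symm_apply_apply]
      refine Ideal.mul_mem_right _ _ ?_
      have := Ideal.mem_map_of_mem (φ : MvPowerSeries σ k →+* MvPowerSeries σ k) hr
      rw [Ideal.map_pow] at this
      refine Ideal.pow_right_mono (Ideal.map_le_iff_le_comap.mpr fun r hr => ?_) n this
      exact hJm (hφJ r hr)
    · rw [map_add]
      exact Ideal.add_mem _ hx hy
  have : IsHausdorff (varIdeal k σ) Y := ⟨fun y hy => by
    refine τ.symm.injective ?_
    rw [map_zero]
    refine IsHausdorff.haus' (I := varIdeal k σ) _ fun n => ?_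
    rw [SModEq.zero, smul_eq_mul, Ideal.mul_top]
    exact hYm n y (SModEq.zero.mp (hy n))⟩
  let b := Module.finBasis k (MvPowerSeries σ k ⧸ J)
  choose e he using fun j => Ideal.Quotient.mk_surjective (b j)
  let π : (Fin _ → MvPowerSeries σ k) →ₗ[MvPowerSeries σ k] Y :=
    Fintype.linearCombination _ fun j => τ (e j)
  have hπ : ∀ f, π f = τ (∑ j, φ (f j) * e j) := by
    intro f
    simp only [π, Fintype.linearCombination_apply, hτ, map_sum]
  have hmk : ∀ f : Fin _ → k, Ideal.Quotient.mk J (∑ j, φ (algebraMap k _ (f j)) * e j) =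
      ∑ j, f j • b j := by
    intro f
    rw [map_sum]
    refine Finset.sum_congr rfl fun j _ => ?_
    rw [AlgHom.commutes, ← Algebra.smul_def, ← he]
    rfl
  -- Nakayama's lemma for complete modules: the lifts `e j` of a `k`-basis of the quotient by `J`
  -- generate `Y`, since `J` lies in `varIdeal · Y`.
  have hsurj : Function.Surjective π := by
    refine surjective_of_mkQ_comp_surjective (I := varIdeal k σ) fun y => ?_
    obtain ⟨y, rfl⟩ := Submodule.mkQ_surjective _ y
    obtain ⟨x, rfl⟩ := τ.surjective y
    refine ⟨fun j => algebraMap k _ (b.repr (Ideal.Quotient.mk J x) j), ?_⟩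
    rw [LinearMap.comp_apply, Submodule.mkQ_apply, Submodule.mkQ_apply, Submodule.Quotient.eq, hπ,
      ← map_sub]
    refine hJY _ ?_
    rw [← Ideal.Quotient.eq, hmk, b.sum_repr]
  -- Nakayama's lemma for the kernel. A kernel element has coordinates in the maximal ideal; writing
  -- them as `∑ g j i * X i` turns it into a relation between the `a i`, which is trivial.
  have hker : LinearMap.ker π = ⊥ := by
    refine Submodule.eq_bot_of_le_smul_of_le_jacobson_bot (varIdeal k σ) _
      (IsNoetherian.noetherian _) (fun f hf => ?_) (by
        rw [← maximalIdeal_eq_varIdeal]; exact IsLocalRing.maximalIdeal_le_jacobson _)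
    have hf0 : ∑ j, φ (f j) * e j = 0 := by
      have := LinearMap.mem_ker.mp hf
      rwa [hπ, map_eq_zero_iff _ τ.injective] at this
    have hfm : ∀ j, f j ∈ varIdeal k σ := by
      have h1 : ∀ j, f j - algebraMap k _ (MvPowerSeries.constantCoeff (f j)) ∈ varIdeal k σ := by
        intro j
        rw [mem_varIdeal_iff, map_sub, sub_eq_zero]
        exact (MvPowerSeries.constantCoeff_C _).symm
      have h2 : ∑ j, MvPowerSeries.constantCoeff (f j) • b j = 0 := by
        rw [← hmk, Ideal.Quotient.eq_zero_iff_mem]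
        have h3 : ∑ j, φ (algebraMap k _ (MvPowerSeries.constantCoeff (f j))) * e j =
            -∑ j, φ (f j - algebraMap k _ (MvPowerSeries.constantCoeff (f j))) * e j := by
          rw [← zero_sub, ← hf0, ← sub_eq_zero]
          simp only [map_sub, sub_mul, Finset.sum_sub_distrib]
          abel
        rw [h3]
        exact J.neg_mem (J.sum_mem fun j _ => J.mul_mem_right _ (hφJ _ (h1 j)))
      intro j
      rw [mem_varIdeal_iff]
      exact Fintype.linearIndependent_iff.mp b.linearIndependent _ h2 j
    have hg : ∀ j, ∃ g : σ → MvPowerSeries σ k, ∑ i, g i * MvPowerSeries.X i = f j := fun j =>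
      (Submodule.mem_span_range_iff_exists_fun _).mp (hfm j)
    choose g hg using hg
    obtain ⟨w, hw⟩ := exists_trivial_relation_of_finite a (fun i => ∑ j, φ (g j i) * e j) (by
      rw [← hf0]
      simp only [Finset.mul_sum]
      rw [Finset.sum_comm]
      refine Finset.sum_congr rfl fun j _ => ?_
      rw [← hg j, map_sum, Finset.sum_mul]
      refine Finset.sum_congr rfl fun i _ => ?_
      rw [map_mul, hφ]
      ring)
    choose c hc using fun l i => hsurj (τ (w l i))
    -- The correction by lifts of the trivial relation puts every `g' i` into the kernel. Being
    -- antisymmetric in `i` and `l`, it drops out of `∑ X i • g' i`, which is therefore still `f`.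
    let g' : σ → Fin _ → MvPowerSeries σ k := fun i =>
      (fun j => g j i) - ∑ l, (MvPowerSeries.X l : MvPowerSeries σ k) • (c l i - c i l)
    have hg' : ∀ i, g' i ∈ LinearMap.ker π := by
      intro i
      rw [LinearMap.mem_ker, map_sub, map_sum, sub_eq_zero, hπ, hw, map_sum]
      refine Finset.sum_congr rfl fun l _ => ?_
      rw [map_smul, map_sub, hc, hc, ← map_sub, hτ, hφ]
    have hfg : f = ∑ i, (MvPowerSeries.X i : MvPowerSeries σ k) • g' i := by
      simp only [g', smul_sub, Finset.sum_sub_distrib, Finset.smul_sum]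
      have h1 : ∑ i, (MvPowerSeries.X i : MvPowerSeries σ k) • (fun j => g j i) = f := by
        ext1 j
        rw [Finset.sum_apply, ← hg j]
        exact Finset.sum_congr rfl fun i _ => by simp [mul_comm]
      have h2 : ∑ i, ∑ l, (MvPowerSeries.X i : MvPowerSeries σ k) •
            (MvPowerSeries.X l : MvPowerSeries σ k) • c l i =
          ∑ i, ∑ l, (MvPowerSeries.X i : MvPowerSeries σ k) •
            (MvPowerSeries.X l : MvPowerSeries σ k) • c i l := by
        rw [Finset.sum_comm]
        exact Finset.sum_congr rfl fun i _ => Finset.sum_congr rfl fun l _ => by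
          rw [smul_smul, smul_smul, mul_comm]
      rw [h1, h2, sub_self, sub_zero]
    rw [hfg]
    exact Submodule.sum_mem _ fun i _ => Submodule.smul_mem_smul (X_mem_varIdeal k i) (hg' i)
  exact ⟨_, ⟨Module.Basis.ofEquivFun (LinearEquiv.ofBijective π
    ⟨LinearMap.ker_eq_bot.mp hker, hsurj⟩).symm⟩⟩

end FiniteFree


/-! ### Splitting off the Koszul homology, one element at a time -/

section Tower

variable {S : Type*} [CommRing S]

/-- The endomorphism of `X / TX` induced by an endomorphism commuting with `T`. -/
def quotEnd {X : Type*} [AddCommGroup X] [Module S X] (T f : Module.End S X)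
    (h : ∀ x, f (T x) = T (f x)) : Module.End S (X ⧸ LinearMap.range T) :=
  Submodule.mapQ _ _ f (by rintro _ ⟨x, rfl⟩; exact ⟨f x, (h x).symm⟩)

theorem quotEnd_mk {X : Type*} [AddCommGroup X] [Module S X] (T f : Module.End S X)
    (h : ∀ x, f (T x) = T (f x)) (x : X) :
    quotEnd T f h (Submodule.Quotient.mk x) = Submodule.Quotient.mk (f x) := rfl

/-- A sequence of commuting endomorphisms `T i` of a factorisation, with null-homotopies `L i`
and left inverses `H i` commuting with the other `T j`. -/
structure SplitSequence {X : Type*} [AddCommGroup X] [Module S X] (D : OddEnd S X) (m : ℕ) where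
  /-- the sequence -/
  T : Fin m → Module.End S X
  /-- the null-homotopies -/
  L : Fin m → Module.End S X
  /-- the left inverses -/
  H : Fin m → Module.End S X
  T_T : ∀ i j x, T i (T j x) = T j (T i x)
  G_T : ∀ i x, D.G (T i x) = T i (D.G x)
  d_T : ∀ i x, D.d (T i x) = T i (D.d x)
  L_G : ∀ i x, L i (D.G x) = -D.G (L i x)
  d_L : ∀ i x, D.d (L i x) + L i (D.d x) = T i x
  L_T : ∀ i j x, L i (T j x) = T j (L i x)
  H_G : ∀ i x, H i (D.G x) = D.G (H i x)
  H_T_self : ∀ i x, H i (T i x) = x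
  H_T : ∀ i j x, i ≠ j → H i (T j x) = T j (H i x)

namespace SplitSequence

variable {X : Type*} [AddCommGroup X] [Module S X] {D : OddEnd S X} {m : ℕ}

/-- The factorisation induced on `X / T X`, for the last element `T` of the sequence. -/
def quotD (P : SplitSequence D (m + 1)) : OddEnd S (X ⧸ LinearMap.range (P.T (Fin.last m))) where
  G := quotEnd _ D.G (P.G_T _)
  d := quotEnd _ D.d (P.d_T _)
  G_G x := by
    induction x using Submodule.Quotient.induction_on with
    | H x => simp [quotEnd_mk, D.G_G]
  d_G x := by
    induction x using Submodule.Quotient.induction_on with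
    | H x => simp [quotEnd_mk, D.d_G]

/-- The induced sequence on `X / T X`, for the last element `T` of the sequence. -/
def quot (P : SplitSequence D (m + 1)) : SplitSequence P.quotD m where
  T i := quotEnd _ (P.T i.castSucc) (P.T_T _ _)
  L i := quotEnd _ (P.L i.castSucc) (P.L_T _ _)
  H i := quotEnd _ (P.H i.castSucc) fun x => P.H_T _ _ x (Fin.castSucc_lt_last i).ne
  T_T i j x := by
    induction x using Submodule.Quotient.induction_on with
    | H x => simp only [quotEnd_mk, P.T_T i.castSucc j.castSucc]
  G_T i x := by
    induction x using Submodule.Quotient.induction_on with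
    | H x => simp only [quotD, quotEnd_mk, P.G_T]
  d_T i x := by
    induction x using Submodule.Quotient.induction_on with
    | H x => simp only [quotD, quotEnd_mk, P.d_T]
  L_G i x := by
    induction x using Submodule.Quotient.induction_on with
    | H x => simp only [quotD, quotEnd_mk, P.L_G, Submodule.Quotient.mk_neg]
  d_L i x := by
    induction x using Submodule.Quotient.induction_on with
    | H x => simp only [quotD, quotEnd_mk, ← Submodule.Quotient.mk_add, P.d_L]
  L_T i j x := by
    induction x using Submodule.Quotient.induction_on with
    | H x => simp only [quotEnd_mk, P.L_T i.castSucc j.castSucc]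
  H_G i x := by
    induction x using Submodule.Quotient.induction_on with
    | H x => simp only [quotD, quotEnd_mk, P.H_G]
  H_T_self i x := by
    induction x using Submodule.Quotient.induction_on with
    | H x => simp only [quotEnd_mk, P.H_T_self]
  H_T i j x hij := by
    induction x using Submodule.Quotient.induction_on with
    | H x => simp only [quotEnd_mk, P.H_T i.castSucc j.castSucc _ (by simpa using hij)]

/-- The projector `1 - T H` onto a complement of `T X`. -/
def proj (P : SplitSequence D m) (i : Fin m) (x : X) : X := x - P.T i (P.H i x)

/-- The connecting morphism `X / T X → X[1]`. -/
def conn (P : SplitSequence D (m + 1)) : X ⧸ LinearMap.range (P.T (Fin.last m)) →ₗ[S] X :=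
  Submodule.liftQ _ (P.H (Fin.last m) ∘ₗ D.d ∘ₗ
    (LinearMap.id - P.T (Fin.last m) ∘ₗ P.H (Fin.last m))) (by
      rintro _ ⟨x, rfl⟩
      simp [P.H_T_self])

theorem conn_mk (P : SplitSequence D (m + 1)) (x : X) :
    P.conn (Submodule.Quotient.mk x) =
      P.H (Fin.last m) (D.d (P.proj (Fin.last m) x)) := rfl

theorem mk_T (P : SplitSequence D (m + 1)) (x : X) :
    (Submodule.Quotient.mk (P.T (Fin.last m) x) :
      X ⧸ LinearMap.range (P.T (Fin.last m))) = 0 :=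
  (Submodule.Quotient.mk_eq_zero _).mpr ⟨x, rfl⟩

theorem proj_T (P : SplitSequence D m) (i : Fin m) (x : X) : P.proj i (P.T i x) = 0 := by
  rw [proj, P.H_T_self, sub_self]

theorem proj_sub (P : SplitSequence D m) (i : Fin m) (x y : X) :
    P.proj i (x - y) = P.proj i x - P.proj i y := by
  simp only [proj, map_sub]; abel

theorem proj_smul (P : SplitSequence D m) (i : Fin m) (c : S) (x : X) :
    P.proj i (c • x) = c • P.proj i x := by
  simp only [proj, map_smul, smul_sub]

/-- `proj i x` differs from `x` by an element of `T X`, which `d` preserves and the projector kills.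
-/
theorem proj_d_proj (P : SplitSequence D m) (i : Fin m) (x : X) :
    P.proj i (D.d (P.proj i x)) = P.proj i (D.d x) := by
  have h : D.d (P.proj i x) = D.d x - P.T i (D.d (P.H i x)) := by rw [proj, map_sub, P.d_T]
  rw [h, proj_sub, proj_T, sub_zero]

theorem T_injective (P : SplitSequence D m) (i : Fin m) : Function.Injective (P.T i) :=
  Function.LeftInverse.injective (g := P.H i) (P.H_T_self i)

theorem T_H (P : SplitSequence D m) (i : Fin m) (x : X) : P.T i (P.H i x) = x - P.proj i x := by
  rw [proj, sub_sub_cancel]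

theorem conn_G (P : SplitSequence D (m + 1)) (x) : P.conn (P.quotD.G x) = -D.G (P.conn x) := by
  induction x using Submodule.Quotient.induction_on with
  | H x =>
    simp only [quotD, quotEnd_mk, conn_mk, proj, P.H_G, map_sub, D.d_G, ← P.G_T, map_neg]
    abel

/-- It suffices to compare after applying the injective `T`, where `conn` becomes `ds - sd` for the
section `s`. Since `s` commutes with `d² = c`, what remains is an anticommutation with `d`, which is
the sign of the shift. -/
theorem conn_d (P : SplitSequence D (m + 1)) {c : S} (hD : D.IsLinearFactorisation c) (x) :
    P.conn (P.quotD.d x) = -D.d (P.conn x) := by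
  induction x using Submodule.Quotient.induction_on with
  | H x =>
    simp only [quotD, quotEnd_mk, conn_mk]
    apply P.T_injective (Fin.last m)
    rw [map_neg, ← P.d_T, P.T_H, P.T_H, map_sub, hD]
    have h1 := P.proj_d_proj (Fin.last m) (D.d x)
    rw [hD, proj_smul] at h1
    rw [h1, P.proj_d_proj]
    abel

/-- As `dL + Ld = T` and `HT = 1`, applying `H` to `d (Lx - THLx)` returns `x` up to the boundary of
`HL`. Thus `x ↦ [L x]` is a right inverse of `conn` up to homotopy. -/
theorem conn_mk_L (P : SplitSequence D (m + 1)) (x : X) :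
    P.conn (Submodule.Quotient.mk (P.L (Fin.last m) x)) =
      x - (D.d (P.H (Fin.last m) (P.L (Fin.last m) x)) +
        P.H (Fin.last m) (P.L (Fin.last m) (D.d x))) := by
  rw [conn_mk, proj, map_sub, P.d_T, map_sub, P.H_T_self, eq_sub_of_add_eq (P.d_L _ x), map_sub,
    P.H_T_self]
  abel

/-- The Atiyah operator `[d, ∇]`. -/
def atiyahOp (D : OddEnd S X) (N : Module.End S X) (x : X) : X := D.d (N x) - N (D.d x)

/-- Modulo `T X` the connection inverts `T`, because `N T y = T N y + y`. Hence `conn` is congruent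
to `N (ds - sd)`, that is, to the boundary of `N s` minus `[d, N] s`. The operator `[d, N]` commutes
with `T`, so the section `s` may be dropped from the last term. -/
theorem mk_conn (P : SplitSequence D (m + 1)) (N : Module.End S X)
    (hN : ∀ x, N (P.T (Fin.last m) x) = P.T (Fin.last m) (N x) + x) (x : X) :
    (Submodule.Quotient.mk (P.conn (Submodule.Quotient.mk x)) :
      X ⧸ LinearMap.range (P.T (Fin.last m))) =
    Submodule.Quotient.mk (D.d (N (P.proj (Fin.last m) x))) -
      Submodule.Quotient.mk (N (P.proj (Fin.last m) (D.d x))) -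
      Submodule.Quotient.mk (atiyahOp D N x) := by
  have h1 : atiyahOp D N x = atiyahOp D N (P.proj (Fin.last m) x) +
      P.T (Fin.last m) (atiyahOp D N (P.H (Fin.last m) x)) := by
    simp only [atiyahOp, proj, map_sub, hN, P.d_T, map_add]
    abel
  have h2 : N (D.d (P.proj (Fin.last m) x)) = N (P.proj (Fin.last m) (D.d x)) +
      (P.T (Fin.last m) (N (P.conn (Submodule.Quotient.mk x))) +
        P.conn (Submodule.Quotient.mk x)) := by
    rw [← P.proj_d_proj (Fin.last m) x, ← hN, ← map_add, conn_mk, P.T_H, add_sub_cancel]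
  have h3 : P.conn (Submodule.Quotient.mk x) = D.d (N (P.proj (Fin.last m) x)) -
      N (P.proj (Fin.last m) (D.d x)) - atiyahOp D N x +
      P.T (Fin.last m) (atiyahOp D N (P.H (Fin.last m) x) -
        N (P.conn (Submodule.Quotient.mk x))) := by
    rw [h1, atiyahOp, h2, map_sub]
    abel
  conv_lhs => rw [h3]
  rw [Submodule.Quotient.mk_add, P.mk_T, add_zero, Submodule.Quotient.mk_sub,
    Submodule.Quotient.mk_sub]

theorem atiyahOp_d {c : S} (hD : D.IsLinearFactorisation c) (N : Module.End S X) (x : X) :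
    atiyahOp D N (D.d x) = -D.d (atiyahOp D N x) := by
  simp only [atiyahOp, map_sub, hD x, hD (N x), map_smul]
  abel

theorem atiyahOp_G (N : Module.End S X) (hN : ∀ x, N (D.G x) = D.G (N x)) (x : X) :
    atiyahOp D N (D.G x) = -D.G (atiyahOp D N x) := by
  simp only [atiyahOp, map_sub, hN, D.d_G, map_neg]
  abel

/-- The homotopy in `mk_conn`. -/
def connHomotopy (P : SplitSequence D (m + 1)) (N : Module.End S X) :
    Module.End S (X ⧸ LinearMap.range (P.T (Fin.last m))) :=
  Submodule.liftQ _ (Submodule.mkQ _ ∘ₗ N ∘ₗ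
    (LinearMap.id - P.T (Fin.last m) ∘ₗ P.H (Fin.last m))) (by
      rintro _ ⟨x, rfl⟩
      simp [P.H_T_self])

theorem connHomotopy_mk (P : SplitSequence D (m + 1)) (N : Module.End S X) (x : X) :
    P.connHomotopy N (Submodule.Quotient.mk x) =
      Submodule.Quotient.mk (N (P.proj (Fin.last m) x)) := rfl

theorem connHomotopy_G (P : SplitSequence D (m + 1)) (N : Module.End S X)
    (hN : ∀ x, N (D.G x) = D.G (N x)) (x) :
    P.connHomotopy N (P.quotD.G x) = P.quotD.G (P.connHomotopy N x) := by
  induction x using Submodule.Quotient.induction_on with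
  | H x =>
    simp only [quotD, quotEnd_mk, connHomotopy_mk, proj, P.H_G, map_sub, ← P.G_T, hN]

theorem quotD_isLinearFactorisation (P : SplitSequence D (m + 1)) {c : S}
    (hD : D.IsLinearFactorisation c) : P.quotD.IsLinearFactorisation c := by
  intro x
  induction x using Submodule.Quotient.induction_on with
  | H x => simp only [quotD, quotEnd_mk, hD x, Submodule.Quotient.mk_smul]

/-- The iterated connecting morphism `ψ : Y → X[m]` on the quotient `Y` of `X` by the sequence,
together with its homotopy inverse on one side and its composite with the projection. -/
theorem exists_section {S : Type*} [CommRing S] (m : ℕ) {X : Type v} [AddCommGroup X] [Module S X]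
    {D : OddEnd S X} (P : SplitSequence D m) {c : S} (hD : D.IsLinearFactorisation c)
    {Y : Type w} [AddCommGroup Y] [Module S Y] (DY : OddEnd S Y) (q : X →ₗ[S] Y)
    (hq : Function.Surjective q) (hqG : ∀ x, q (D.G x) = DY.G (q x))
    (hqd : ∀ x, q (D.d x) = DY.d (q x)) (hker : LinearMap.ker q = ⨆ i, LinearMap.range (P.T i)) :
    ∃ ψ : Y →ₗ[S] X, (∀ y, ψ (DY.G y) = (-1 : S) ^ m • D.G (ψ y)) ∧
      (∀ y, ψ (DY.d y) = (-1 : S) ^ m • D.d (ψ y)) ∧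
      (∃ h : X →ₗ[S] X, (∀ x, h (D.G x) = -D.G (h x)) ∧
        ∀ x, ψ (q ((List.ofFn P.L).prod x)) - x = D.d (h x) + h (D.d x)) ∧
      ∀ N : Fin m → Module.End S X, (∀ i x, N i (D.G x) = D.G (N i x)) →
        (∀ i x, N i (P.T i x) = P.T i (N i x) + x) →
        (∀ i j x, i ≠ j → N i (P.T j x) = P.T j (N i x)) →
        ∀ A : Fin m → Module.End S Y, (∀ i x, A i (q x) = q (atiyahOp D (N i) x)) →
          ∃ K : Y →ₗ[S] Y, (∀ y, K (DY.G y) = -((-1 : S) ^ m • DY.G (K y))) ∧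
            ∀ y, q (ψ y) - (-1 : S) ^ m • (List.ofFn A).reverse.prod y =
              DY.d (K y) + (-1 : S) ^ m • K (DY.d y) := by
  induction m generalizing X with
  | zero =>
    have hinj : Function.Injective q := by
      rw [← LinearMap.ker_eq_bot, hker, iSup_of_empty]
    let e := LinearEquiv.ofBijective q ⟨hinj, hq⟩
    have he : ∀ y, q (e.symm y) = y := e.apply_symm_apply
    refine ⟨e.symm.toLinearMap, fun y => hinj ?_, fun y => hinj ?_, ⟨0, by simp, fun x => ?_⟩, ?_⟩
    · simp [he, hqG]
    · simp [he, hqd]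
    · have : e.symm (q x) = x := e.symm_apply_apply x
      simp [this]
    · intro N _ _ _ A _
      refine ⟨0, by simp, fun y => ?_⟩
      simp [he]
  | succ m ih =>
    -- The last element is divided out first; the remaining ones form a split sequence on the
    -- quotient, with the same final quotient `Y`.
    let q' : (X ⧸ LinearMap.range (P.T (Fin.last m))) →ₗ[S] Y :=
      Submodule.liftQ _ q (by rw [hker]; exact le_iSup (fun i => LinearMap.range (P.T i)) _)
    have hq'mk : ∀ x, q' (Submodule.Quotient.mk x) = q x := fun _ => rfl
    obtain ⟨ψ, hψG, hψd, ⟨h, hhG, hh⟩, hN⟩ := ih P.quot (P.quotD_isLinearFactorisation hD) q'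
      (fun y => by obtain ⟨x, rfl⟩ := hq y; exact ⟨_, hq'mk x⟩)
      (fun x => by
        induction x using Submodule.Quotient.induction_on with
        | H x => simp only [quotD, quotEnd_mk, hq'mk, hqG])
      (fun x => by
        induction x using Submodule.Quotient.induction_on with
        | H x => simp only [quotD, quotEnd_mk, hq'mk, hqd])
      (by
        have h1 : LinearMap.ker q' = (LinearMap.ker q).map (Submodule.mkQ _) :=
          Submodule.ker_liftQ _ _ _
        rw [h1, hker, Submodule.map_iSup]
        have h2 : ∀ i, (LinearMap.range (P.T i)).map
            (Submodule.mkQ (LinearMap.range (P.T (Fin.last m)))) =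
            LinearMap.range (Submodule.mkQ (LinearMap.range (P.T (Fin.last m))) ∘ₗ P.T i) :=
          fun i => (LinearMap.range_comp _ _).symm
        have h3 : ∀ i : Fin m, LinearMap.range (P.quot.T i) =
            LinearMap.range (Submodule.mkQ (LinearMap.range (P.T (Fin.last m))) ∘ₗ
              P.T i.castSucc) := by
          intro i
          have : P.quot.T i ∘ₗ Submodule.mkQ _ =
            Submodule.mkQ (LinearMap.range (P.T (Fin.last m))) ∘ₗ P.T i.castSucc := rfl
          rw [← this, LinearMap.range_comp, Submodule.range_mkQ, Submodule.map_top]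
        simp only [h2, h3]
        apply le_antisymm
        · refine iSup_le fun i => ?_
          induction i using Fin.lastCases with
          | last =>
            rintro _ ⟨x, rfl⟩
            have : (Submodule.mkQ (LinearMap.range (P.T (Fin.last m))) ∘ₗ
              P.T (Fin.last m)) x = 0 := P.mk_T x
            rw [this]
            exact Submodule.zero_mem _
          | cast i => exact le_iSup (fun i : Fin m => LinearMap.range (Submodule.mkQ
              (LinearMap.range (P.T (Fin.last m))) ∘ₗ P.T i.castSucc)) i
        · exact iSup_le fun i => le_iSup (fun i => LinearMap.range (Submodule.mkQ
              (LinearMap.range (P.T (Fin.last m))) ∘ₗ P.T i)) i.castSucc)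
    have hq'd : ∀ x, q' (P.quotD.d x) = DY.d (q' x) := fun x => by
      induction x using Submodule.Quotient.induction_on with
      | H x => simp only [quotD, quotEnd_mk, hq'mk, hqd]
    have hq'G : ∀ x, q' (P.quotD.G x) = DY.G (q' x) := fun x => by
      induction x using Submodule.Quotient.induction_on with
      | H x => simp only [quotD, quotEnd_mk, hq'mk, hqG]
    -- The homotopy transports the inductive one through `conn` and `L`, with a sign as `conn`
    -- anticommutes with `d`; the summand `-HL` is the error in `conn_mk_L`.
    refine ⟨P.conn ∘ₗ ψ, fun y => ?_, fun y => ?_, ⟨P.conn ∘ₗ (-h) ∘ₗ Submodule.mkQ _ ∘ₗ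
      P.L (Fin.last m) - P.H (Fin.last m) ∘ₗ P.L (Fin.last m), fun x => ?_, fun x => ?_⟩, ?_⟩
    · rw [LinearMap.comp_apply, LinearMap.comp_apply, hψG, map_smul, conn_G, pow_succ]
      simp
    · rw [LinearMap.comp_apply, LinearMap.comp_apply, hψd, map_smul, P.conn_d hD, pow_succ]
      simp
    · simp only [LinearMap.sub_apply, LinearMap.comp_apply, P.L_G, P.H_G, map_neg,
        LinearMap.neg_apply, Submodule.mkQ_apply]
      have h1 : ∀ x, (Submodule.Quotient.mk (D.G x) : X ⧸ LinearMap.range (P.T (Fin.last m))) =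
        P.quotD.G (Submodule.Quotient.mk x) := fun _ => rfl
      rw [h1, hhG, map_neg, conn_G, map_sub, map_neg]
      abel
    · have h1 : (List.ofFn P.L).prod x =
          (List.ofFn fun i : Fin m => P.L i.castSucc).prod (P.L (Fin.last m) x) := by
        rw [List.ofFn_succ', List.concat_eq_append, List.prod_append, List.prod_singleton]
        rfl
      have h2 : ∀ (l : List (Fin m)) z, (Submodule.Quotient.mk
          ((l.map fun i : Fin m => P.L i.castSucc).prod z) :
            X ⧸ LinearMap.range (P.T (Fin.last m))) =
          (l.map P.quot.L).prod (Submodule.Quotient.mk z) := by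
        intro l
        induction l with
        | nil => exact fun _ => rfl
        | cons i l ihl =>
          intro z
          rw [List.map_cons, List.map_cons, List.prod_cons, List.prod_cons, Module.End.mul_apply,
            Module.End.mul_apply, ← ihl]
          rfl
      have hofn : ∀ {Z : Type v} (f : Fin m → Z), List.ofFn f = (List.finRange m).map f :=
        fun f => List.ofFn_eq_map
      have h3 := hh (Submodule.Quotient.mk (P.L (Fin.last m) x))
      rw [hofn, ← h2, hq'mk] at h3
      have h4 : P.quotD.d (Submodule.Quotient.mk (P.L (Fin.last m) x)) =
          -Submodule.Quotient.mk (P.L (Fin.last m) (D.d x)) := by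
        have h5 : P.quotD.d (Submodule.Quotient.mk (P.L (Fin.last m) x)) =
          Submodule.Quotient.mk (D.d (P.L (Fin.last m) x)) := rfl
        rw [h5, eq_sub_of_add_eq (P.d_L _ x), Submodule.Quotient.mk_sub, P.mk_T, zero_sub]
      rw [LinearMap.comp_apply, h1, hofn, eq_add_of_sub_eq h3, map_add, map_add,
        P.conn_mk_L, P.conn_d hD, h4]
      simp only [LinearMap.sub_apply, LinearMap.comp_apply, LinearMap.neg_apply, map_neg, map_sub,
        Submodule.mkQ_apply]
      abel
    · intro N hNG hNT hNT' A hA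
      have hdA : ∀ i y, A i (DY.d y) = -DY.d (A i y) := by
        intro i y
        obtain ⟨x, rfl⟩ := hq y
        rw [← hqd, hA, atiyahOp_d hD, map_neg, hA, hqd]
      have hGA : ∀ i y, A i (DY.G y) = -DY.G (A i y) := by
        intro i y
        obtain ⟨x, rfl⟩ := hq y
        rw [← hqG, hA, atiyahOp_G _ (hNG i), map_neg, hA, hqG]
      obtain ⟨K, hKG, hK⟩ := hN
        (fun i => quotEnd _ (N i.castSucc) fun x => hNT' _ _ x (Fin.castSucc_lt_last i).ne)
        (fun i x => by
          induction x using Submodule.Quotient.induction_on with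
          | H x => simp only [quotD, quotEnd_mk, hNG])
        (fun i x => by
          induction x using Submodule.Quotient.induction_on with
          | H x => simp only [quot, quotEnd_mk, hNT, Submodule.Quotient.mk_add])
        (fun i j x hij => by
          induction x using Submodule.Quotient.induction_on with
          | H x => simp only [quot, quotEnd_mk,
              hNT' i.castSucc j.castSucc _ (by simpa using hij)])
        (fun i => A i.castSucc)
        (fun i x => by
          induction x using Submodule.Quotient.induction_on with
          | H x => exact hA i.castSucc x)
      have hconn : ∀ z, q (P.conn z) = DY.d (q' (P.connHomotopy (N (Fin.last m)) z)) -
          q' (P.connHomotopy (N (Fin.last m)) (P.quotD.d z)) - A (Fin.last m) (q' z) := by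
        intro z
        induction z using Submodule.Quotient.induction_on with
        | H x =>
          rw [← hq'mk, P.mk_conn _ (hNT _), map_sub, map_sub, hq'mk x, hA, ← hq'd]
          rfl
      have hprod : (List.ofFn A).reverse.prod =
          A (Fin.last m) * (List.ofFn fun i : Fin m => A i.castSucc).reverse.prod := by
        rw [List.ofFn_succ', List.concat_eq_append, List.reverse_append]
        simp
      have hdψ : ∀ y, P.quotD.d (ψ y) = (-1 : S) ^ m • ψ (DY.d y) := fun y => by
        rw [hψd, smul_smul, ← mul_pow]
        simp
      -- The first summand replaces `q ∘ conn` by `-A` for the last index, the second replaces the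
      -- remaining composite by its product; `A` anticommutes with `d`.
      refine ⟨q' ∘ₗ P.connHomotopy (N (Fin.last m)) ∘ₗ ψ + A (Fin.last m) ∘ₗ K,
        fun y => ?_, fun y => ?_⟩
      · simp only [LinearMap.add_apply, LinearMap.comp_apply, hKG, hψG, map_smul,
          P.connHomotopy_G _ (hNG _), hq'G, map_neg, hGA, map_add, pow_succ]
        simp only [mul_neg, mul_one, neg_smul, neg_neg, smul_neg, smul_add]
        rw [neg_add, neg_neg, neg_neg]
      · have h1 := hK y
        rw [hprod, LinearMap.comp_apply, hconn, hdψ, Module.End.mul_apply, eq_add_of_sub_eq h1]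
        simp only [LinearMap.add_apply, LinearMap.comp_apply, map_add, map_smul, hdA, pow_succ,
          smul_add]
        simp
        abel

end SplitSequence

end Tower


/-! ### Products of anticommuting elements -/

section Anticommute

theorem mul_prod_of_anticommute {Q : Type*} [Ring Q] (x : Q) (l : List Q)
    (h : ∀ y ∈ l, x * y = -(y * x)) : x * l.prod = (-1) ^ l.length * (l.prod * x) := by
  induction l with
  | nil => simp
  | cons y l ih =>
    rw [List.prod_cons, ← mul_assoc, h y (by simp), neg_mul, mul_assoc, ih fun z hz =>
      h z (by simp [hz]), List.length_cons, pow_succ, mul_neg_one, neg_mul, ← mul_assoc,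
      ((Commute.neg_one_left y).pow_left _).eq.symm]
    simp only [mul_assoc]

/-- Moving the head to the other end of the list costs one sign for each remaining factor, and these
numbers add up to the binomial coefficient. -/
theorem reverse_prod_of_anticommute {Q : Type*} [Ring Q] (l : List Q)
    (h : ∀ x ∈ l, ∀ y ∈ l, x * y = -(y * x)) :
    l.reverse.prod = (-1) ^ l.length.choose 2 * l.prod := by
  induction l with
  | nil => simp
  | cons x l ih =>
    have h1 := mul_prod_of_anticommute x l fun y hy => h x (by simp) y (by simp [hy])
    have h2 : ((-1 : Q) ^ l.length) * (-1) ^ l.length = 1 := by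
      rw [← pow_add, Even.neg_one_pow ⟨_, rfl⟩]
    rw [List.reverse_cons, List.prod_append, List.prod_singleton, ih fun y hy z hz =>
      h y (by simp [hy]) z (by simp [hz]), List.prod_cons, h1, List.length_cons,
      Nat.choose_succ_succ', Nat.choose_one_right, pow_add, (((Commute.neg_one_left
      ((-1 : Q) ^ l.length.choose 2)).pow_left l.length).eq), mul_assoc, mul_assoc,
      ← mul_assoc ((-1) ^ l.length) ((-1) ^ l.length), h2, one_mul]

/-- As `2` is a unit, linear combinations of the `a i` square to zero, so there is an algebra map
from the exterior algebra. Since wedge products alternate, all `m!` signed products agree. -/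
theorem sum_perm_of_anticommute {S Q : Type*} [CommRing S] [Ring Q] [Algebra S Q]
    (h2 : IsUnit (2 : S)) {m : ℕ} (a : Fin m → Q) (h : ∀ i j, a i * a j + a j * a i = 0) :
    ∑ π : Equiv.Perm (Fin m), Equiv.Perm.sign π • (List.ofFn fun i => a (π i)).prod =
      m.factorial • (List.ofFn a).prod := by
  classical
  let f : (Fin m → S) →ₗ[S] Q := Fintype.linearCombination S a
  have hf : ∀ i, f (Pi.single i 1) = a i := fun i => by simp [f]
  have hsq : ∀ v, f v * f v = 0 := by
    intro v
    have h3 : f v * f v + f v * f v = 0 := by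
      simp only [f, Fintype.linearCombination_apply, Finset.sum_mul_sum]
      nth_rewrite 2 [Finset.sum_comm]
      rw [← Finset.sum_add_distrib]
      refine Finset.sum_eq_zero fun i _ => ?_
      rw [← Finset.sum_add_distrib]
      refine Finset.sum_eq_zero fun j _ => ?_
      rw [smul_mul_smul_comm, smul_mul_smul_comm, mul_comm (v j), ← smul_add, h, smul_zero]
    rw [← two_smul S] at h3
    exact h2.smul_eq_zero.mp h3
  let F := ExteriorAlgebra.lift S ⟨f, hsq⟩
  have hF : ∀ b : Fin m → Fin m, F (ExteriorAlgebra.ιMulti S m fun i => Pi.single (b i) 1) =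
      (List.ofFn fun i => a (b i)).prod := by
    intro b
    rw [ExteriorAlgebra.ιMulti_apply, map_list_prod, List.map_ofFn]
    congr 2
    ext i
    simp [F, hf]
  have h4 : ∀ π : Equiv.Perm (Fin m), Equiv.Perm.sign π • (List.ofFn fun i => a (π i)).prod =
      (List.ofFn a).prod := by
    intro π
    have h5 := (ExteriorAlgebra.ιMulti S m).map_perm
      (fun i : Fin m => (Pi.single i 1 : Fin m → S)) π
    have h6 := congrArg F h5
    have h7 := hF π
    have h8 := hF id
    simp only [id] at h8
    have h9 : F (ExteriorAlgebra.ιMulti S m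
        ((fun i : Fin m => (Pi.single i 1 : Fin m → S)) ∘ π)) =
      (List.ofFn fun i => a (π i)).prod := h7
    rw [h9] at h6
    rw [h6]
    rcases Int.units_eq_one_or (Equiv.Perm.sign π) with h | h <;> simp [h, h8]
  rw [Finset.sum_congr rfl fun π _ => h4 π]
  simp [Fintype.card_perm]

theorem sum_perm_eq_reverse_prod {S Q : Type*} [CommRing S] [Ring Q] [Algebra S Q]
    (h2 : IsUnit (2 : S)) {m : ℕ} (a : Fin m → Q) (h : ∀ i j, a i * a j + a j * a i = 0) :
    ∑ π : Equiv.Perm (Fin m), Equiv.Perm.sign π • (List.ofFn fun i => a (π i)).prod =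
      ((m.factorial : S) * (-1) ^ m.choose 2) • (List.ofFn a).reverse.prod := by
  rw [sum_perm_of_anticommute h2 a h, reverse_prod_of_anticommute, List.length_ofFn, mul_smul,
    ← Nat.cast_smul_eq_nsmul S]
  · congr 1
    rw [Algebra.smul_def, map_pow, map_neg, map_one, ← mul_assoc, ← pow_add,
      Even.neg_one_pow ⟨_, rfl⟩, one_mul]
  · intro x hx y hy
    obtain ⟨i, rfl⟩ := (List.mem_ofFn' _ _).mp hx
    obtain ⟨j, rfl⟩ := (List.mem_ofFn' _ _).mp hy
    exact eq_neg_of_add_eq_zero_left (h i j)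

end Anticommute

/-! ### Closed endomorphisms modulo null-homotopic ones -/

section Closed

variable {S : Type*} [CommRing S] {Y : Type*} [AddCommGroup Y] [Module S Y] (D : OddEnd S Y)

/-- The graded commutator with the differential. -/
def gradedComm (f : Module.End S Y) : Module.End S Y := D.d * f - D.G * f * D.G * D.d

theorem OddEnd.G_mul_G : D.G * D.G = (1 : Module.End S Y) := LinearMap.ext D.G_G

theorem OddEnd.d_mul_G : D.d * D.G = -(D.G * D.d) := LinearMap.ext D.d_G

theorem OddEnd.G_mul_G_mul (f : Module.End S Y) : D.G * (D.G * f) = f := by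
  rw [← mul_assoc, D.G_mul_G, one_mul]

theorem OddEnd.d_mul_G_mul (f : Module.End S Y) : D.d * (D.G * f) = -(D.G * (D.d * f)) := by
  rw [← mul_assoc, D.d_mul_G, neg_mul, mul_assoc]

/-- The algebra of closed endomorphisms. -/
def closedEnd : Subalgebra S (Module.End S Y) where
  carrier := {f | D.d * f = D.G * f * D.G * D.d}
  mul_mem' {f g} hf hg := by
    simp only [Set.mem_ofPred_eq, mul_assoc] at hf hg ⊢
    rw [← mul_assoc, hf, mul_assoc, mul_assoc, mul_assoc, hg, D.G_mul_G_mul]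
  add_mem' {f g} hf hg := by
    simp only [Set.mem_ofPred_eq] at hf hg ⊢
    rw [mul_add, hf, hg]
    noncomm_ring
  algebraMap_mem' s := by
    simp only [Set.mem_ofPred_eq]
    rw [← Algebra.commutes (R := S) s D.G, mul_assoc, mul_assoc, D.G_mul_G_mul]
    exact (Algebra.commutes (R := S) s D.d).symm

theorem mem_closedEnd {f : Module.End S Y} : f ∈ closedEnd D ↔ D.d * f = D.G * f * D.G * D.d :=
  Iff.rfl

theorem gradedComm_mul {f g : Module.End S Y} (hg : g ∈ closedEnd D) :
    gradedComm D (f * g) = gradedComm D f * g := by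
  rw [mem_closedEnd] at hg
  simp only [gradedComm, sub_mul, mul_assoc] at hg ⊢
  rw [hg, D.G_mul_G_mul]

/-- Conjugation by `G` is multiplication by `(-1)^|f|`, written so that `f` need not be homogeneous.
Together with `gradedComm_mul` this makes homotopy compatible with products of closed endomorphisms.
-/
theorem gradedComm_conj_mul {f g : Module.End S Y} (hf : f ∈ closedEnd D) :
    gradedComm D (D.G * f * D.G * g) = f * gradedComm D g := by
  rw [mem_closedEnd] at hf
  have h1 : D.d * (D.G * (f * (D.G * g))) = f * (D.d * g) := by
    rw [D.d_mul_G_mul, ← mul_assoc D.d f, hf]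
    simp only [mul_assoc, D.d_mul_G_mul, D.G_mul_G_mul, mul_neg, neg_neg]
  simp only [gradedComm, mul_sub, mul_assoc, h1, D.G_mul_G_mul]

/-- Homotopy of closed endomorphisms, as a ring congruence. -/
def homotopyCon : RingCon (closedEnd D) where
  r f g := ∃ h, (f : Module.End S Y) - g = gradedComm D h
  iseqv := {
    refl f := ⟨0, by simp [gradedComm]⟩
    symm := by
      rintro f g ⟨h, hh⟩
      refine ⟨-h, ?_⟩
      rw [← neg_sub, hh]
      simp only [gradedComm, mul_neg, neg_mul, neg_sub_neg, neg_sub]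
    trans := by
      rintro f g e ⟨h, hh⟩ ⟨h', hh'⟩
      refine ⟨h + h', ?_⟩
      rw [← sub_add_sub_cancel, hh, hh']
      simp only [gradedComm, mul_add, add_mul]
      abel }
  add' := by
    rintro f g e i ⟨h, hh⟩ ⟨h', hh'⟩
    refine ⟨h + h', ?_⟩
    simp only [Subalgebra.coe_add]
    rw [add_sub_add_comm, hh, hh']
    simp only [gradedComm, mul_add, add_mul]
    abel
  mul' := by
    rintro f g e i ⟨h, hh⟩ ⟨h', hh'⟩
    refine ⟨h * e + D.G * g * D.G * h', ?_⟩
    have h1 : gradedComm D (h * e + D.G * g * D.G * h') =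
        gradedComm D (h * e) + gradedComm D (D.G * g * D.G * h') := by
      simp only [gradedComm, mul_add, add_mul]
      abel
    rw [h1, gradedComm_mul D e.2, gradedComm_conj_mul D g.2, ← hh, ← hh']
    simp only [Subalgebra.coe_mul]
    noncomm_ring

/-- The antisymmetrised product of closed odd endomorphisms that anticommute up to homotopy. -/
theorem exists_sum_perm_sub_eq_gradedComm (h2 : IsUnit (2 : S)) {m : ℕ}
    (A : Fin m → Module.End S Y) (hA : ∀ i, A i ∈ closedEnd D)
    (hAA : ∀ i j, ∃ h, A i * A j + A j * A i = gradedComm D h) :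
    ∃ h, (∑ π : Equiv.Perm (Fin m), Equiv.Perm.sign π • (List.ofFn fun i => A (π i)).prod) -
      ((m.factorial : S) * (-1) ^ m.choose 2) • (List.ofFn A).reverse.prod = gradedComm D h := by
  -- In the ring of closed endomorphisms modulo homotopy the classes anticommute strictly.
  let a : Fin m → (homotopyCon D).Quotient := fun i => ((⟨A i, hA i⟩ : closedEnd D) : _)
  have ha : ∀ i j, a i * a j + a j * a i = 0 := by
    intro i j
    obtain ⟨h, hh⟩ := hAA i j
    refine (RingCon.eq (homotopyCon D)).mpr ?_
    exact ⟨h, by simpa using hh⟩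
  have h1 := sum_perm_eq_reverse_prod h2 a ha
  let B : Fin m → closedEnd D := fun i => ⟨A i, hA i⟩
  have h3 : (homotopyCon D).mk' (∑ π : Equiv.Perm (Fin m),
        Equiv.Perm.sign π • (List.ofFn fun i => B (π i)).prod) =
      (homotopyCon D).mk'
        (((m.factorial : S) * (-1) ^ m.choose 2) • (List.ofFn B).reverse.prod) := by
    have h4 : ∀ l : List (closedEnd D), (homotopyCon D).mk' l.prod =
        (l.map (homotopyCon D).mk').prod := fun l => map_list_prod _ l
    have h5 : ∀ (c : S) (x : closedEnd D), (homotopyCon D).mk' (c • x) =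
      c • (homotopyCon D).mk' x := fun _ _ => rfl
    rw [map_sum, h5, h4, List.map_reverse, List.map_ofFn]
    refine Eq.trans (Finset.sum_congr rfl fun π _ => ?_) h1
    rw [Units.smul_def, Units.smul_def, map_zsmul, h4, List.map_ofFn]
    rfl
  obtain ⟨h, hh⟩ := (RingCon.eq (homotopyCon D)).mp h3
  refine ⟨h, ?_⟩
  rw [← hh]
  have h4 : ∀ l : List (closedEnd D), ((l.prod : closedEnd D) : Module.End S Y) =
      (l.map (closedEnd D).val).prod := fun l => map_list_prod (closedEnd D).val l
  have h5 : (closedEnd D).val ∘ B = A := rfl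
  rw [Subalgebra.coe_smul, h4, List.map_reverse, List.map_ofFn, h5]
  congr 1
  rw [AddSubmonoidClass.coe_finsetSum]
  refine Finset.sum_congr rfl fun π _ => ?_
  rw [Units.smul_def, Units.smul_def]
  refine Eq.trans ?_ (map_zsmul (closedEnd D).val _ _).symm
  rw [Subalgebra.val_apply, h4, List.map_ofFn]
  rfl

end Closed

/-! ### The idempotent of a split sequence -/

section Idempotent

variable {S : Type*} [CommRing S]

/-- The Atiyah operator `[d, ∇]` as a linear map. -/
def atiyahEnd {X : Type*} [AddCommGroup X] [Module S X] (D : OddEnd S X) (N : Module.End S X) :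
    Module.End S X := D.d * N - N * D.d

theorem atiyahEnd_apply {X : Type*} [AddCommGroup X] [Module S X] (D : OddEnd S X)
    (N : Module.End S X) (x : X) : atiyahEnd D N x = SplitSequence.atiyahOp D N x := rfl

theorem list_prod_apply_of_anticommute {X : Type*} [AddCommGroup X] [Module S X]
    (f : Module.End S X) (l : List (Module.End S X)) (h : ∀ g ∈ l, ∀ x, g (f x) = -f (g x))
    (x : X) : l.prod (f x) = (-1 : S) ^ l.length • f (l.prod x) := by
  induction l with
  | nil => simp
  | cons g l ih =>
    rw [List.prod_cons, Module.End.mul_apply, ih fun g hg => h g (by simp [hg]), map_smul,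
      h g (by simp), Module.End.mul_apply, List.length_cons, pow_succ]
    simp

theorem list_prod_map_apply {A X Y ι : Type*} [CommRing A] [AddCommGroup X] [Module S X]
    [AddCommGroup Y] [Module A Y] (q : X → Y) (f : ι → Module.End S X) (g : ι → Module.End A Y)
    (h : ∀ i x, g i (q x) = q (f i x)) (l : List ι) (x : X) :
    (l.map g).prod (q x) = q ((l.map f).prod x) := by
  induction l with
  | nil => rfl
  | cons i l ih =>
    rw [List.map_cons, List.prod_cons, Module.End.mul_apply, ih, h, List.map_cons, List.prod_cons,
      Module.End.mul_apply]

theorem exists_end_of_surjective {X Y : Type*} [AddCommGroup X] [Module S X] [AddCommGroup Y]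
    [Module S Y] (q : X →ₗ[S] Y) (hq : Function.Surjective q) (f : Module.End S X)
    (h : ∀ x, q x = 0 → q (f x) = 0) : ∃ g : Module.End S Y, ∀ x, g (q x) = q (f x) := by
  let e := q.quotKerEquivOfSurjective hq
  let g := Submodule.liftQ (LinearMap.ker q) (q ∘ₗ f) (fun x hx => h x hx)
  refine ⟨g ∘ₗ e.symm.toLinearMap, fun x => ?_⟩
  have : e.symm (q x) = Submodule.Quotient.mk x := by
    rw [LinearEquiv.symm_apply_eq]
    rfl
  rw [LinearMap.comp_apply, LinearEquiv.coe_coe, this]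
  rfl

/-- A graded null-homotopy of a difference of even maps can be chosen odd. -/
theorem homotopic_of_gradedComm (h2 : IsUnit (2 : S)) {Y : Type*} [AddCommGroup Y] [Module S Y]
    (D : OddEnd S Y) (f g : Module.End S Y) (hf : ∀ y, f (D.G y) = D.G (f y))
    (hg : ∀ y, g (D.G y) = D.G (g y)) (h : Module.End S Y) (hh : f - g = gradedComm D h) :
    D.Homotopic D f g := by
  obtain ⟨u, hu⟩ := h2.exists_right_inv
  have h1 : ∀ y, f y - g y = D.d (h y) - D.G (h (D.G (D.d y))) := fun y =>
    LinearMap.congr_fun hh y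
  -- Conjugating the relation by `G` changes nothing on the left, as `f` and `g` are even.
  have h3 : ∀ y, f y - g y = -D.d (D.G (h (D.G y))) + h (D.d y) := by
    intro y
    have h4 := congrArg D.G (h1 (D.G y))
    rw [map_sub, hf, hg, map_sub, D.G_G, D.G_G, D.G_G, D.d_G] at h4
    rw [h4, D.d_G, map_neg, D.G_G, map_neg, sub_neg_eq_add, neg_neg]
  -- The odd part of `h`, with `u` the inverse of `2`.
  refine ⟨u • (h - D.G ∘ₗ h ∘ₗ D.G), fun y => ?_, fun y => ?_⟩
  · simp only [LinearMap.smul_apply, LinearMap.sub_apply, LinearMap.comp_apply, D.G_G, map_smul,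
      map_sub, ← smul_neg]
    rw [neg_sub]
  · have h5 : f y - g y = u • ((f y - g y) + (f y - g y)) := by
      rw [← two_smul S, smul_smul, mul_comm, hu, one_smul]
    rw [h5]
    nth_rewrite 1 [h1]
    rw [h3]
    simp only [LinearMap.smul_apply, LinearMap.sub_apply, LinearMap.comp_apply, map_smul,
      map_sub, ← smul_add]
    congr 1
    abel

/-- Morphisms `ψ : Y → X[m]` and `θ : X[m] → Y` with `ψ ∘ θ ≃ 1`, for the quotient `Y` of `X` by a
split sequence, and the formula for `θ ∘ ψ` in terms of a connection. -/
theorem SplitSequence.exists_idempotent (h2 : IsUnit (2 : S)) {m : ℕ} (u : S)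
    (hu : u * (m.factorial : S) = 1) {X : Type v} [AddCommGroup X] [Module S X]
    {D : OddEnd S X} (P : SplitSequence D m) {c : S} (hD : D.IsLinearFactorisation c)
    {Y : Type w} [AddCommGroup Y] [Module S Y] (DY : OddEnd S Y) (q : X →ₗ[S] Y)
    (hq : Function.Surjective q) (hqG : ∀ x, q (D.G x) = DY.G (q x))
    (hqd : ∀ x, q (D.d x) = DY.d (q x)) (hker : LinearMap.ker q = ⨆ i, LinearMap.range (P.T i)) :
    ∃ (ψ : Y →ₗ[S] X) (θ : X →ₗ[S] Y), DY.IsMorphism (D.shift m) ψ ∧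
      (D.shift m).IsMorphism DY θ ∧ (D.shift m).Homotopic (D.shift m) (ψ ∘ₗ θ) LinearMap.id ∧
      ∀ N : Fin m → Module.End S X, (∀ i x, N i (D.G x) = D.G (N i x)) →
        (∀ i x, N i (P.T i x) = P.T i (N i x) + x) →
        (∀ i j x, i ≠ j → N i (P.T j x) = P.T j (N i x)) →
        ∃ e : Y →ₗ[S] Y, (∀ x, e (q x) = q ((u * (-1) ^ (m + 1).choose 2) •
          (List.ofFn P.L).prod ((∑ π : Equiv.Perm (Fin m), Equiv.Perm.sign π •
            (List.ofFn fun i => atiyahEnd D (N (π i))).prod) x))) ∧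
          DY.Homotopic DY (θ ∘ₗ ψ) e := by
  obtain ⟨ψ, hψG, hψd, ⟨h, hhG, hh⟩, hN⟩ := P.exists_section m hD DY q hq hqG hqd hker
  have hone : (-1 : S) ^ m * (-1 : S) ^ m = 1 := by rw [← pow_add, Even.neg_one_pow ⟨_, rfl⟩]
  have hqT : ∀ i x, q (P.T i x) = 0 := fun i x => by
    have : P.T i x ∈ LinearMap.ker q := by
      rw [hker]
      exact Submodule.mem_iSup_of_mem i ⟨x, rfl⟩
    exact this
  have hdesc : ∀ f : Module.End S X, (∀ i x, f (P.T i x) = P.T i (f x)) →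
      ∃ g : Module.End S Y, ∀ x, g (q x) = q (f x) := by
    intro f hf
    refine exists_end_of_surjective q hq f fun x hx => ?_
    have h1 : LinearMap.ker q ≤ LinearMap.ker (q ∘ₗ f) := by
      rw [hker]
      refine iSup_le fun i => ?_
      rintro _ ⟨x, rfl⟩
      rw [LinearMap.mem_ker, LinearMap.comp_apply, hf, hqT]
    exact h1 hx
  choose L hL using fun i => hdesc (P.L i) (fun j x => P.L_T i j x)
  have hLprod : ∀ x, (List.ofFn L).prod (q x) = q ((List.ofFn P.L).prod x) := by
    intro x
    rw [List.ofFn_eq_map, List.ofFn_eq_map]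
    exact list_prod_map_apply q P.L L hL _ x
  have hLG : ∀ i y, L i (DY.G y) = -DY.G (L i y) := by
    intro i y
    obtain ⟨x, rfl⟩ := hq y
    rw [← hqG, hL, P.L_G, map_neg, hqG, hL]
  have hLd : ∀ i y, L i (DY.d y) = -DY.d (L i y) := by
    intro i y
    obtain ⟨x, rfl⟩ := hq y
    rw [← hqd, hL, eq_sub_of_add_eq' (P.d_L i x), map_sub, hqT, zero_sub, hL, hqd]
  have hmemL : ∀ g ∈ List.ofFn L, ∃ i, g = L i := fun g hg => by
    obtain ⟨i, rfl⟩ := (List.mem_ofFn' _ _).mp hg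
    exact ⟨i, rfl⟩
  have hΛG : ∀ y, (List.ofFn L).prod (DY.G y) = (-1 : S) ^ m • DY.G ((List.ofFn L).prod y) := by
    intro y
    rw [list_prod_apply_of_anticommute, List.length_ofFn]
    intro g hg
    obtain ⟨i, rfl⟩ := hmemL g hg
    exact hLG i
  have hΛd : ∀ y, (List.ofFn L).prod (DY.d y) = (-1 : S) ^ m • DY.d ((List.ofFn L).prod y) := by
    intro y
    rw [list_prod_apply_of_anticommute, List.length_ofFn]
    intro g hg
    obtain ⟨i, rfl⟩ := hmemL g hg
    exact hLd i
  -- The map `θ` is `q λ_1 ⋯ λ_m`. The factor `(-1)^m` on the homotopy compensates the sign of the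
  -- differential of the shift.
  refine ⟨ψ, q ∘ₗ (List.ofFn P.L).prod, ⟨hψG, hψd⟩, ⟨fun x => ?_, fun x => ?_⟩,
    ⟨(-1 : S) ^ m • h, fun x => ?_, fun x => ?_⟩, fun N hNG hNT hNT' => ?_⟩
  · simp only [OddEnd.shift, LinearMap.smul_apply, map_smul, LinearMap.comp_apply]
    rw [← hLprod, ← hLprod, hqG, hΛG, smul_smul, hone, one_smul]
  · simp only [OddEnd.shift, LinearMap.smul_apply, map_smul, LinearMap.comp_apply]
    rw [← hLprod, ← hLprod, hqd, hΛd, smul_smul, hone, one_smul]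
  · simp only [OddEnd.shift, LinearMap.smul_apply, map_smul, hhG, smul_neg]
  · simp only [OddEnd.shift, LinearMap.smul_apply, map_smul, smul_smul, hone, one_smul]
    exact hh x
  -- Although `N i` does not commute with `T i`, the failure is the identity, which cancels in the
  -- commutator with `d`. So the Atiyah operators descend to `Y`.
  have hAT : ∀ i j x, atiyahEnd D (N i) (P.T j x) = P.T j (atiyahEnd D (N i) x) := by
    intro i j x
    simp only [atiyahEnd_apply, SplitSequence.atiyahOp, P.d_T]
    by_cases hij : i = j
    · subst hij
      simp only [hNT, map_add, P.d_T, map_sub]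
      abel
    · simp only [hNT' i j _ hij, P.d_T, map_sub]
  choose A hA using fun i => hdesc (atiyahEnd D (N i)) (hAT i)
  obtain ⟨K, hKG, hK⟩ := hN N hNG hNT hNT' A fun i x => hA i x
  have hAG : ∀ i y, A i (DY.G y) = -DY.G (A i y) := by
    intro i y
    obtain ⟨x, rfl⟩ := hq y
    rw [← hqG, hA, atiyahEnd_apply, SplitSequence.atiyahOp_G _ (hNG i), map_neg, hqG, hA,
      atiyahEnd_apply]
  have hAd : ∀ i y, A i (DY.d y) = -DY.d (A i y) := by
    intro i y
    obtain ⟨x, rfl⟩ := hq y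
    rw [← hqd, hA, atiyahEnd_apply, SplitSequence.atiyahOp_d hD, map_neg, hqd, hA,
      atiyahEnd_apply]
  have hclosed : ∀ f : Module.End S Y, (∀ y, f (DY.G y) = -DY.G (f y)) →
      (∀ y, f (DY.d y) = -DY.d (f y)) → f ∈ closedEnd DY := by
    intro f hf hf'
    rw [mem_closedEnd]
    ext y
    simp only [Module.End.mul_apply, hf, hf', map_neg, DY.G_G, neg_neg]
  obtain ⟨h', hh'⟩ := exists_sum_perm_sub_eq_gradedComm DY h2 A
    (fun i => hclosed _ (hAG i) (hAd i)) (fun i j => by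
      -- `A_i A_j + A_j A_i` is the boundary of `[N_i, A_j]`, which descends to `Y` because it
      -- commutes with the whole sequence.
      obtain ⟨B, hB⟩ := hdesc (N i * atiyahEnd D (N j) - atiyahEnd D (N j) * N i) (fun l x => by
        simp only [LinearMap.sub_apply, Module.End.mul_apply, hAT]
        by_cases hil : i = l
        · subst hil
          simp only [hNT, map_add, hAT, map_sub]
          abel
        · simp only [hNT' i l _ hil, hAT, map_sub])
      refine ⟨B, ?_⟩
      ext y
      obtain ⟨x, rfl⟩ := hq y
      simp only [gradedComm, LinearMap.add_apply, LinearMap.sub_apply, Module.End.mul_apply, hA,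
        hB, ← hqd, ← hqG]
      rw [← map_add, ← map_sub]
      congr 1
      have e1 := SplitSequence.atiyahOp_d hD (N j) x
      have e2 := SplitSequence.atiyahOp_d hD (N j) (N i x)
      have e3 := SplitSequence.atiyahOp_G (N j) (hNG j)
      have e4 : ∀ y, atiyahEnd D (N i) y = D.d (N i y) - N i (D.d y) := fun _ => rfl
      rw [← atiyahEnd_apply, ← atiyahEnd_apply] at e1 e2
      simp only [← atiyahEnd_apply] at e3
      simp only [hNG, e3, map_neg, map_sub, D.G_G, e1, e4 (atiyahEnd D (N j) x), e4 x, e2]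
      abel)
  set Λ := (List.ofFn L).prod
  set R := (List.ofFn A).reverse.prod
  set A' := ∑ π : Equiv.Perm (Fin m), Equiv.Perm.sign π • (List.ofFn fun i => A (π i)).prod
    with hA'def
  have hA' : ∀ x, A' (q x) = q ((∑ π : Equiv.Perm (Fin m), Equiv.Perm.sign π •
      (List.ofFn fun i => atiyahEnd D (N (π i))).prod) x) := by
    intro x
    rw [hA'def, LinearMap.sum_apply, LinearMap.sum_apply, map_sum]
    refine Finset.sum_congr rfl fun π _ => ?_
    rw [Units.smul_def, Units.smul_def, LinearMap.smul_apply, LinearMap.smul_apply, map_zsmul,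
      List.ofFn_eq_map, List.ofFn_eq_map]
    congr 1
    exact list_prod_map_apply q _ _ (fun i x => hA (π i) x) _ x
  have hA'G : ∀ y, A' (DY.G y) = (-1 : S) ^ m • DY.G (A' y) := by
    intro y
    rw [hA'def, LinearMap.sum_apply, LinearMap.sum_apply, map_sum, Finset.smul_sum]
    refine Finset.sum_congr rfl fun π _ => ?_
    rw [Units.smul_def, LinearMap.smul_apply, LinearMap.smul_apply, map_zsmul, smul_comm,
      list_prod_apply_of_anticommute, List.length_ofFn]
    intro g hg
    obtain ⟨i, rfl⟩ := (List.mem_ofFn' _ _).mp hg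
    exact hAG _
  set v := u * (-1 : S) ^ (m + 1).choose 2
  refine ⟨v • (Λ * A'), fun x => ?_, ?_⟩
  · rw [LinearMap.smul_apply, Module.End.mul_apply, hA', hLprod, map_smul]
  have hψq : q ∘ₗ ψ - (-1 : S) ^ m • R = gradedComm DY K := by
    ext y
    refine (hK y).trans ?_
    simp only [gradedComm, LinearMap.sub_apply, Module.End.mul_apply, hKG, map_neg, map_smul,
      DY.G_G, sub_neg_eq_add]
  -- The signs of reversing the product, `(m choose 2)`, and of the scalar `v`, `(m + 1 choose 2)`,
  -- differ by the `(-1)^m` of the iterated connecting morphism.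
  have hsign : v * ((m.factorial : S) * (-1) ^ m.choose 2) = (-1) ^ m := by
    have h1 : (m + 1).choose 2 = m + m.choose 2 := by
      rw [Nat.choose_succ_succ', Nat.choose_one_right]
    have h3 : ((-1 : S) ^ m.choose 2) * (-1) ^ m.choose 2 = 1 := by
      rw [← pow_add, Even.neg_one_pow ⟨_, rfl⟩]
    calc v * ((m.factorial : S) * (-1) ^ m.choose 2)
        = (u * m.factorial) * (-1) ^ m * ((-1) ^ m.choose 2 * (-1) ^ m.choose 2) := by
          simp only [v, h1, pow_add]; ring
      _ = (-1) ^ m := by rw [hu, h3, one_mul, mul_one]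
  have hsub : ∀ f g : Module.End S Y, gradedComm DY (f - g) = gradedComm DY f - gradedComm DY g :=
    fun f g => by simp only [gradedComm, mul_sub, sub_mul]; abel
  have hsmul : ∀ (s : S) (f : Module.End S Y), gradedComm DY (s • f) = s • gradedComm DY f :=
    fun s f => by simp only [gradedComm, mul_smul_comm, smul_mul_assoc, smul_sub]
  have hΛ : Λ ∈ closedEnd DY := Subalgebra.list_prod_mem _ fun g hg => by
    obtain ⟨i, rfl⟩ := hmemL g hg
    exact hclosed _ (hLG i) (hLd i)
  -- One has `θ ψ = Λ (q ψ)`, where `q ψ` agrees with `(-1)^m R` up to the boundary of `K`, and `R`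
  -- with the antisymmetrised product up to that of `h'`. Closedness of `Λ` carries it through these
  -- boundaries.
  refine homotopic_of_gradedComm h2 DY _ _ (fun y => ?_) (fun y => ?_)
    (DY.G * Λ * DY.G * (K - v • h')) ?_
  · rw [LinearMap.comp_apply, LinearMap.comp_apply, LinearMap.comp_apply, LinearMap.comp_apply,
      hψG, map_smul, map_smul, ← hLprod, ← hLprod, hqG, hΛG, smul_smul, hone, one_smul]
  · rw [LinearMap.smul_apply, Module.End.mul_apply, hA'G, map_smul, hΛG, smul_smul _ _ (DY.G _),
      hone, one_smul, LinearMap.smul_apply, Module.End.mul_apply, map_smul]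
  · have h1 : (q ∘ₗ (List.ofFn P.L).prod) ∘ₗ ψ = Λ * (q ∘ₗ ψ) := by
      ext y
      exact (hLprod (ψ y)).symm
    rw [h1, gradedComm_conj_mul DY hΛ, hsub, hsmul, ← hψq, ← hh', smul_sub, smul_smul, hsign,
      sub_sub_sub_cancel_right, mul_sub, mul_smul_comm]

end Idempotent


/-! ### Completed tensor products of power series rings -/

section CompletedPowerSeries

variable {k : Type*} [Field k]

/-- Ring morphisms from a power series ring that vanish on a power of the ideal of the variables
are determined by the coefficients and the variables. -/
theorem ringHom_ext_of_varIdeal_pow {τ Q : Type*} [Finite τ] [CommRing Q]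
    {φ χ : MvPowerSeries τ k →+* Q} (j : ℕ) (hφ : ∀ f ∈ varIdeal k τ ^ j, φ f = 0)
    (hχ : ∀ f ∈ varIdeal k τ ^ j, χ f = 0)
    (hC : ∀ r, φ (MvPowerSeries.C r) = χ (MvPowerSeries.C r))
    (hX : ∀ i, φ (MvPowerSeries.X i) = χ (MvPowerSeries.X i)) : φ = χ := by
  have h1 : φ.comp MvPolynomial.coeToMvPowerSeries.ringHom =
      χ.comp MvPolynomial.coeToMvPowerSeries.ringHom := by
    refine MvPolynomial.ringHom_ext (fun r => ?_) fun i => ?_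
    · simpa using hC r
    · simpa using hX i
  ext f
  have h2 : f - (f.truncTotal j : MvPowerSeries τ k) ∈ varIdeal k τ ^ j := by
    rw [mem_varIdeal_pow_iff]
    intro e he
    rw [map_sub, MvPolynomial.coeff_coe, MvPowerSeries.coeff_truncTotal _ he, sub_self]
  have h3 := RingHom.congr_fun h1 (f.truncTotal j)
  simp only [RingHom.comp_apply, MvPolynomial.coeToMvPowerSeries.ringHom_apply] at h3
  rw [← sub_add_cancel f (f.truncTotal j : MvPowerSeries τ k), map_add, map_add, hφ _ h2, hχ _ h2,
    h3]

theorem rename_mem_varIdeal_pow {τ σ : Type*} [Finite τ] [Finite σ] (e : τ → σ) (j : ℕ)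
    {f : MvPowerSeries τ k} (hf : f ∈ varIdeal k τ ^ j) :
    MvPowerSeries.rename e f ∈ varIdeal k σ ^ j := by
  have h : (varIdeal k τ).map (MvPowerSeries.rename (R := k) e) ≤ varIdeal k σ := by
    rw [Ideal.map_le_iff_le_comap]
    intro f hf
    rw [Ideal.mem_comap, mem_varIdeal_iff, MvPowerSeries.constantCoeff_rename]
    exact (mem_varIdeal_iff f).mp hf
  refine Ideal.pow_right_mono h j ?_
  rw [← Ideal.map_pow]
  exact Ideal.mem_map_of_mem _ hf

theorem evalₐ_eq_of_le {A : Type*} [CommRing A] {I : Ideal A} {x y : AdicCompletion I A} {i j : ℕ}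
    (hij : i ≤ j) (h : AdicCompletion.evalₐ I j x = AdicCompletion.evalₐ I j y) :
    AdicCompletion.evalₐ I i x = AdicCompletion.evalₐ I i y := by
  induction x using AdicCompletion.induction_on with | _ x
  induction y using AdicCompletion.induction_on with | _ y
  rw [AdicCompletion.evalₐ_mk, AdicCompletion.evalₐ_mk, Ideal.Quotient.eq] at h ⊢
  have h1 := fun z : AdicCompletion.AdicCauchySequence I A => z.2 hij
  simp only [SModEq.sub_mem, smul_eq_mul, Ideal.mul_top] at h1
  have h2 := add_mem (h1 x) (sub_mem (Ideal.pow_le_pow_right hij h) (h1 y))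
  convert h2 using 1
  abel

section psMap

variable {σ A : Type*} [Finite σ] [CommRing A] (I : Ideal A) (c : k →+* A) (a : σ → A)
  (ha : ∀ s, a s ∈ I)

theorem psMapMod_eq_zero {j : ℕ} {f : MvPowerSeries σ k} (hf : f ∈ varIdeal k σ ^ j) :
    psMapMod I c a ha j f = 0 := by
  refine Ideal.Quotient.eq_zero_iff_mem.mpr (eval₂_mem_pow I c a ha j _ fun e he => ?_)
  rw [MvPowerSeries.coeff_truncTotal _ he]
  exact (mem_varIdeal_pow_iff j f).mp hf e he

theorem psMapMod_coe (j : ℕ) (P : MvPolynomial σ k) :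
    psMapMod I c a ha j P = Ideal.Quotient.mk (I ^ j) (MvPolynomial.eval₂ c a P) :=
  mk_eval₂_eq I c a (fun e he => by
    rw [MvPowerSeries.coeff_truncTotal _ he, MvPolynomial.coeff_coe]) ha

theorem psMapMod_C (j : ℕ) (r : k) :
    psMapMod I c a ha j (MvPowerSeries.C r) = Ideal.Quotient.mk (I ^ j) (c r) := by
  rw [← MvPolynomial.coe_C, psMapMod_coe, MvPolynomial.eval₂_C]

theorem psMapMod_X (j : ℕ) (s : σ) :
    psMapMod I c a ha j (MvPowerSeries.X s) = Ideal.Quotient.mk (I ^ j) (a s) := by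
  rw [← MvPolynomial.coe_X, psMapMod_coe, MvPolynomial.eval₂_X]

theorem factorPow_comp_psMapMod {i j : ℕ} (hij : i ≤ j) :
    (Ideal.Quotient.factorPow I hij).comp (psMapMod I c a ha j) = psMapMod I c a ha i := by
  refine ringHom_ext_of_varIdeal_pow i (fun f hf => ?_)
    (fun f hf => psMapMod_eq_zero I c a ha hf) (fun r => ?_) fun t => ?_
  · refine Ideal.Quotient.eq_zero_iff_mem.mpr (eval₂_mem_pow I c a ha i _ fun e he => ?_)
    rw [MvPowerSeries.coeff_truncTotal _ (he.trans_le hij)]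
    exact (mem_varIdeal_pow_iff i f).mp hf e he
  · rw [RingHom.comp_apply, psMapMod_C, psMapMod_C]
    rfl
  · rw [RingHom.comp_apply, psMapMod_X, psMapMod_X]
    rfl

theorem evalₐ_psMap (j : ℕ) (f : MvPowerSeries σ k) :
    AdicCompletion.evalₐ I j (psMap I c a ha f) = psMapMod I c a ha j f :=
  AdicCompletion.evalₐ_liftRingHom I _ (fun hij => factorPow_comp_psMapMod I c a ha hij) j f

theorem psMapMod_rename {τ : Type*} [Finite τ] (e : τ → σ) (g : MvPowerSeries τ k →+* A)
    (hgI : ∀ f ∈ varIdeal k τ, g f ∈ I) (hgC : ∀ r, g (MvPowerSeries.C r) = c r)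
    (hgX : ∀ t, g (MvPowerSeries.X t) = a (e t)) (j : ℕ) (f : MvPowerSeries τ k) :
    psMapMod I c a ha j (MvPowerSeries.rename e f) = Ideal.Quotient.mk (I ^ j) (g f) := by
  have h : (psMapMod I c a ha j).comp (MvPowerSeries.rename (R := k) e : _ →+* _) =
      (Ideal.Quotient.mk (I ^ j)).comp g := by
    refine ringHom_ext_of_varIdeal_pow j (fun f hf => ?_) (fun f hf => ?_) (fun r => ?_)
      fun t => ?_
    · exact psMapMod_eq_zero I c a ha (rename_mem_varIdeal_pow e j hf)
    · refine Ideal.Quotient.eq_zero_iff_mem.mpr ?_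
      have h1 : (varIdeal k τ).map g ≤ I := Ideal.map_le_iff_le_comap.mpr hgI
      refine Ideal.pow_right_mono h1 j ?_
      rw [← Ideal.map_pow]
      exact Ideal.mem_map_of_mem _ hf
    · simp only [RingHom.comp_apply, RingHom.coe_coe, MvPowerSeries.rename_C, psMapMod_C, hgC]
    · simp only [RingHom.comp_apply, RingHom.coe_coe, MvPowerSeries.rename_X, psMapMod_X, hgX]
  exact RingHom.congr_fun h f

theorem psMap_rename {τ : Type*} [Finite τ] (e : τ → σ) (g : MvPowerSeries τ k →+* A)
    (hgI : ∀ f ∈ varIdeal k τ, g f ∈ I) (hgC : ∀ r, g (MvPowerSeries.C r) = c r)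
    (hgX : ∀ t, g (MvPowerSeries.X t) = a (e t)) (f : MvPowerSeries τ k) :
    psMap I c a ha (MvPowerSeries.rename e f) = AdicCompletion.of I A (g f) := by
  refine AdicCompletion.ext_evalₐ fun j => ?_
  rw [evalₐ_psMap, AdicCompletion.evalₐ_of]
  exact psMapMod_rename I c a ha e g hgI hgC hgX j f

/-- Modulo `j`-th powers, `μ` induces a left inverse of the map `k⟦σ⟧ / varIdeal ^ j → A / I ^ j`,
which is therefore injective. -/
theorem psMapMod_eq_zero_iff (μ : A →+* MvPowerSeries σ k) (hμC : ∀ r, μ (c r) = MvPowerSeries.C r)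
    (hμX : ∀ s, μ (a s) = MvPowerSeries.X s) (hμI : ∀ x ∈ I, μ x ∈ varIdeal k σ) (j : ℕ)
    (f : MvPowerSeries σ k) : psMapMod I c a ha j f = 0 ↔ f ∈ varIdeal k σ ^ j := by
  refine ⟨fun h => ?_, psMapMod_eq_zero I c a ha⟩
  have hI : I ^ j ≤ (varIdeal k σ ^ j).comap μ := by
    rw [← Ideal.map_le_iff_le_comap, Ideal.map_pow]
    exact Ideal.pow_right_mono (Ideal.map_le_iff_le_comap.mpr hμI) j
  have h1 : (Ideal.quotientMap (varIdeal k σ ^ j) μ hI).comp (psMapMod I c a ha j) =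
      Ideal.Quotient.mk (varIdeal k σ ^ j) := by
    refine ringHom_ext_of_varIdeal_pow j (fun f hf => ?_) (fun f hf => ?_) (fun r => ?_)
      fun t => ?_
    · rw [RingHom.comp_apply, psMapMod_eq_zero I c a ha hf, map_zero]
    · exact Ideal.Quotient.eq_zero_iff_mem.mpr hf
    · rw [RingHom.comp_apply, psMapMod_C, Ideal.quotientMap_mk, hμC]
    · rw [RingHom.comp_apply, psMapMod_X, Ideal.quotientMap_mk, hμX]
  rw [← Ideal.Quotient.eq_zero_iff_mem, ← h1, RingHom.comp_apply, h, map_zero]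

/-- An element of the completion is lifted one power at a time; the condition on kernels makes the
lifts a Cauchy sequence, which converges in `k⟦σ⟧`. -/
theorem psMap_bijective (h0 : ∀ j f, psMapMod I c a ha j f = 0 → f ∈ varIdeal k σ ^ j)
    (hs : ∀ j, Function.Surjective (psMapMod I c a ha j)) :
    Function.Bijective (psMap I c a ha) := by
  have hc := isAdicComplete_varIdeal (k := k) (σ := σ)
  constructor
  · rw [injective_iff_map_eq_zero]
    intro f hf
    refine hc.haus' f fun j => ?_
    rw [SModEq.zero, smul_eq_mul, Ideal.mul_top]
    exact h0 j f (by rw [← evalₐ_psMap, hf, map_zero])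
  · intro x
    choose f hf using fun j => hs j (AdicCompletion.evalₐ I j x)
    obtain ⟨L, hL⟩ := hc.prec' f (fun {i j} hij => by
      rw [SModEq.sub_mem, smul_eq_mul, Ideal.mul_top]
      refine h0 i _ ?_
      rw [map_sub, hf i, ← evalₐ_psMap, sub_eq_zero]
      refine (evalₐ_eq_of_le hij ?_).symm
      rw [evalₐ_psMap, hf])
    refine ⟨L, AdicCompletion.ext_evalₐ fun j => ?_⟩
    have h1 := hL j
    rw [SModEq.sub_mem, smul_eq_mul, Ideal.mul_top] at h1
    rw [evalₐ_psMap, ← hf, ← sub_eq_zero, ← map_sub, ← neg_sub, map_neg,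
      psMapMod_eq_zero _ _ _ _ h1,
      neg_zero]

end psMap

end CompletedPowerSeries

section TensorRingHom

theorem exists_ringHom_tensor {B A₁ A₂ R : Type*} [CommRing B] [CommRing A₁] [CommRing A₂]
    [CommRing R] [Algebra B A₁] [Algebra B A₂] (f : A₁ →+* R) (g : A₂ →+* R)
    (h : ∀ b, f (algebraMap B A₁ b) = g (algebraMap B A₂ b)) :
    ∃ μ : A₁ ⊗[B] A₂ →+* R, (∀ x, μ (x ⊗ₜ 1) = f x) ∧ ∀ y, μ (1 ⊗ₜ y) = g y := by
  let : Algebra B R := (f.comp (algebraMap B A₁)).toAlgebra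
  let f' : A₁ →ₐ[B] R := { f with commutes' := fun b => rfl }
  let g' : A₂ →ₐ[B] R := { g with commutes' := fun b => (h b).symm }
  refine ⟨(Algebra.TensorProduct.productMap f' g' : A₁ ⊗[B] A₂ →+* R), fun x => ?_, fun y => ?_⟩
  · exact Algebra.TensorProduct.productMap_left_apply f' g' x
  · exact Algebra.TensorProduct.productMap_right_apply f' g' y

end TensorRingHom

/-! ### Power series rings as completed tensor products -/

section Presentation

variable {k : Type*} [Field k] {σ₁ σ₂ σ : Type*} [Finite σ₁] [Finite σ₂] [Finite σ]
  {B : Type*} [CommRing B] [Algebra B (MvPowerSeries σ₁ k)] [Algebra B (MvPowerSeries σ₂ k)]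

/-- The data `c` on coefficients and `a` on variables present `k⟦σ⟧` as the completed tensor
product of `k⟦σ₁⟧` and `k⟦σ₂⟧` over `B`. -/
structure IsPresentation (e₁ : σ₁ → σ) (e₂ : σ₂ → σ)
    (c : k →+* MvPowerSeries σ₁ k ⊗[B] MvPowerSeries σ₂ k)
    (a : σ → MvPowerSeries σ₁ k ⊗[B] MvPowerSeries σ₂ k) : Prop where
  c_left : ∀ r, (MvPowerSeries.C r : MvPowerSeries σ₁ k) ⊗ₜ[B] (1 : MvPowerSeries σ₂ k) = c r
  c_right : ∀ r, (1 : MvPowerSeries σ₁ k) ⊗ₜ[B] (MvPowerSeries.C r : MvPowerSeries σ₂ k) = c r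
  a_left : ∀ i, (MvPowerSeries.X i : MvPowerSeries σ₁ k) ⊗ₜ[B] (1 : MvPowerSeries σ₂ k) = a (e₁ i)
  a_right : ∀ i, (1 : MvPowerSeries σ₁ k) ⊗ₜ[B] (MvPowerSeries.X i : MvPowerSeries σ₂ k) = a (e₂ i)
  cover : ∀ s, (∃ i, e₁ i = s) ∨ ∃ i, e₂ i = s
  compat : ∀ b : B, MvPowerSeries.rename (R := k) e₁ (algebraMap B _ b) =
    MvPowerSeries.rename (R := k) e₂ (algebraMap B _ b)

namespace IsPresentation

variable {e₁ : σ₁ → σ} {e₂ : σ₂ → σ} {c : k →+* MvPowerSeries σ₁ k ⊗[B] MvPowerSeries σ₂ k}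
  {a : σ → MvPowerSeries σ₁ k ⊗[B] MvPowerSeries σ₂ k} (h : IsPresentation e₁ e₂ c a)
  (ha : ∀ s, a s ∈ tensorIdeal B (varIdeal k σ₁) (varIdeal k σ₂))

include h

theorem psMapMod_rename_left (j : ℕ) (f : MvPowerSeries σ₁ k) :
    psMapMod _ c a ha j (MvPowerSeries.rename e₁ f) = Ideal.Quotient.mk _ (f ⊗ₜ 1) :=
  psMapMod_rename _ c a ha e₁ Algebra.TensorProduct.includeLeftRingHom
    (fun _ hf => tmul_one_mem hf) h.c_left h.a_left j f

theorem psMapMod_rename_right (j : ℕ) (f : MvPowerSeries σ₂ k) :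
    psMapMod _ c a ha j (MvPowerSeries.rename e₂ f) = Ideal.Quotient.mk _ (1 ⊗ₜ f) :=
  psMapMod_rename _ c a ha e₂ (Algebra.TensorProduct.includeRight :
    MvPowerSeries σ₂ k →ₐ[B] MvPowerSeries σ₁ k ⊗[B] MvPowerSeries σ₂ k)
    (fun _ hf => one_tmul_mem hf) h.c_right h.a_right j f

theorem psMap_rename_left (f : MvPowerSeries σ₁ k) :
    psMap _ c a ha (MvPowerSeries.rename e₁ f) = AdicCompletion.of _ _ (f ⊗ₜ 1) :=
  psMap_rename _ c a ha e₁ Algebra.TensorProduct.includeLeftRingHom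
    (fun _ hf => tmul_one_mem hf) h.c_left h.a_left f

theorem psMap_rename_right (f : MvPowerSeries σ₂ k) :
    psMap _ c a ha (MvPowerSeries.rename e₂ f) = AdicCompletion.of _ _ (1 ⊗ₜ f) :=
  psMap_rename _ c a ha e₂ (Algebra.TensorProduct.includeRight :
    MvPowerSeries σ₂ k →ₐ[B] MvPowerSeries σ₁ k ⊗[B] MvPowerSeries σ₂ k)
    (fun _ hf => one_tmul_mem hf) h.c_right h.a_right f

theorem psMapMod_surjective (j : ℕ) : Function.Surjective (psMapMod _ c a ha j) := by
  intro x
  obtain ⟨x, rfl⟩ := Ideal.Quotient.mk_surjective x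
  induction x with
  | zero => exact ⟨0, by rw [map_zero, map_zero]⟩
  | add x y hx hy =>
    obtain ⟨f, hf⟩ := hx
    obtain ⟨g, hg⟩ := hy
    exact ⟨f + g, by rw [map_add, map_add, hf, hg]⟩
  | tmul x y =>
    refine ⟨MvPowerSeries.rename e₁ x * MvPowerSeries.rename e₂ y, ?_⟩
    rw [map_mul, h.psMapMod_rename_left, h.psMapMod_rename_right, ← map_mul,
      Algebra.TensorProduct.tmul_mul_tmul, one_mul, mul_one]

/-- The retraction is the multiplication map `x ⊗ y ↦ rename e₁ x * rename e₂ y`, well defined over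
`B` by `compat`. -/
theorem psMapMod_eq_zero_iff (j : ℕ) (f : MvPowerSeries σ k) :
    psMapMod _ c a ha j f = 0 ↔ f ∈ varIdeal k σ ^ j := by
  obtain ⟨μ, hμ₁, hμ₂⟩ := exists_ringHom_tensor (MvPowerSeries.rename (R := k) e₁).toRingHom
    (MvPowerSeries.rename (R := k) e₂).toRingHom h.compat
  refine MFConv.psMapMod_eq_zero_iff _ c a ha μ (fun r => ?_) (fun s => ?_) ?_ j f
  · exact (congrArg μ (h.c_left r).symm).trans ((hμ₁ _).trans (MvPowerSeries.rename_C _ r))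
  · obtain ⟨i, rfl⟩ | ⟨i, rfl⟩ := h.cover s
    · exact (congrArg μ (h.a_left i).symm).trans ((hμ₁ _).trans (MvPowerSeries.rename_X _ i))
    · exact (congrArg μ (h.a_right i).symm).trans ((hμ₂ _).trans (MvPowerSeries.rename_X _ i))
  · change tensorIdeal B (varIdeal k σ₁) (varIdeal k σ₂) ≤ (varIdeal k σ).comap μ
    rw [tensorIdeal, sup_le_iff, Ideal.map_le_iff_le_comap, Ideal.map_le_iff_le_comap]
    constructor
    · intro f hf
      rw [Ideal.mem_comap, Ideal.mem_comap]
      have h1 := rename_mem_varIdeal_pow e₁ 1 (f := f) (by rwa [pow_one])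
      rw [pow_one] at h1
      exact (hμ₁ f).symm ▸ h1
    · intro f hf
      rw [Ideal.mem_comap, Ideal.mem_comap]
      have h1 := rename_mem_varIdeal_pow e₂ 1 (f := f) (by rwa [pow_one])
      rw [pow_one] at h1
      exact (hμ₂ f).symm ▸ h1

theorem psMap_bijective : Function.Bijective (psMap _ c a ha) :=
  MFConv.psMap_bijective _ c a ha (fun j f => (h.psMapMod_eq_zero_iff ha j f).mp)
    (h.psMapMod_surjective ha)

end IsPresentation

end Presentation

/-! ### The three completed tensor products isomorphic to `k⟦x, y, z⟧` -/

section Presentations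

variable (k : Type*) [Field k] (n m p : ℕ)

theorem isPresentation_rhoF :
    IsPresentation (B := k) (Sum.inr : Fin m ⊕ Fin p → Fin n ⊕ Fin m ⊕ Fin p) Sum.inl
      (algebraMap k _)
      (Sum.elim (fun i => 1 ⊗ₜ MvPowerSeries.X i) (fun s => MvPowerSeries.X s ⊗ₜ 1)) where
  c_left _ := rfl
  c_right r := (Algebra.TensorProduct.algebraMap_apply' r).symm
  a_left _ := rfl
  a_right _ := rfl
  cover := by rintro (i | s) <;> simp
  compat r := by
    rw [MvPowerSeries.algebraMap_apply, MvPowerSeries.algebraMap_apply, MvPowerSeries.rename_C,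
      MvPowerSeries.rename_C]

theorem isPresentation_rhoE :
    IsPresentation (B := k) (Sum.map id Sum.inl : Fin n ⊕ Fin m → Fin n ⊕ Fin m ⊕ Fin p)
      (Sum.inr ∘ Sum.inr) (algebraMap k _)
      (Sum.elim (fun i => MvPowerSeries.X (Sum.inl i) ⊗ₜ 1)
        (Sum.elim (fun j => MvPowerSeries.X (Sum.inr j) ⊗ₜ 1)
          (fun l => 1 ⊗ₜ MvPowerSeries.X l))) where
  c_left _ := rfl
  c_right r := (Algebra.TensorProduct.algebraMap_apply' r).symm
  a_left := by rintro (i | j) <;> rfl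
  a_right _ := rfl
  cover := by rintro (i | j | l) <;> simp
  compat r := by
    rw [MvPowerSeries.algebraMap_apply, MvPowerSeries.algebraMap_apply, MvPowerSeries.rename_C,
      MvPowerSeries.rename_C]

theorem isPresentation_rhoFE :
    IsPresentation (B := MvPowerSeries (Fin m) k)
      (Sum.inr : Fin m ⊕ Fin p → Fin n ⊕ Fin m ⊕ Fin p) (Sum.map id Sum.inl)
      ((algebraMap (MvPowerSeries (Fin m) k) _).comp MvPowerSeries.C)
      (Sum.elim (fun i => 1 ⊗ₜ MvPowerSeries.X (Sum.inl i)) (fun s => MvPowerSeries.X s ⊗ₜ 1)) where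
  c_left r := by
    have : (MvPowerSeries.C r : MvPowerSeries (Fin m ⊕ Fin p) k) =
        algebraMap (MvPowerSeries (Fin m) k) _ (MvPowerSeries.C r) :=
      (MvPowerSeries.rename_C _ r).symm
    rw [this]
    rfl
  c_right r := by
    have : (MvPowerSeries.C r : MvPowerSeries (Fin n ⊕ Fin m) k) =
        algebraMap (MvPowerSeries (Fin m) k) _ (MvPowerSeries.C r) :=
      (MvPowerSeries.rename_C _ r).symm
    rw [this]
    exact (Algebra.TensorProduct.algebraMap_apply' _).symm
  a_left _ := rfl
  a_right := by
    rintro (i | j)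
    · rfl
    -- The `y`-variables occur in both factors; over `k⟦y⟧` they can be moved from the second to the
    -- first.
    · have h1 : (MvPowerSeries.X (Sum.inr j) : MvPowerSeries (Fin n ⊕ Fin m) k) =
          algebraMap (MvPowerSeries (Fin m) k) _ (MvPowerSeries.X j) :=
        (MvPowerSeries.rename_X _ j).symm
      have h2 : (MvPowerSeries.X (Sum.inl j) : MvPowerSeries (Fin m ⊕ Fin p) k) =
          algebraMap (MvPowerSeries (Fin m) k) _ (MvPowerSeries.X j) :=
        (MvPowerSeries.rename_X _ j).symm
      simp only [Sum.map_inr, Sum.elim_inr]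
      rw [h1, h2, Algebra.algebraMap_eq_smul_one, Algebra.algebraMap_eq_smul_one,
        TensorProduct.smul_tmul]
  cover := by rintro (i | s) <;> simp
  compat f := by
    have h1 : algebraMap (MvPowerSeries (Fin m) k) (MvPowerSeries (Fin m ⊕ Fin p) k) f =
      MvPowerSeries.rename Sum.inl f := rfl
    have h2 : algebraMap (MvPowerSeries (Fin m) k) (MvPowerSeries (Fin n ⊕ Fin m) k) f =
      MvPowerSeries.rename Sum.inr f := rfl
    rw [h1, h2, MvPowerSeries.rename_rename, MvPowerSeries.rename_rename]
    rfl

theorem rhoF_bijective : Function.Bijective (rhoF k n m p) :=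
  (isPresentation_rhoF k n m p).psMap_bijective _

theorem rhoE_bijective : Function.Bijective (rhoE k n m p) :=
  (isPresentation_rhoE k n m p).psMap_bijective _

theorem rhoF_rename (f : MvPowerSeries (Fin m ⊕ Fin p) k) :
    rhoF k n m p (MvPowerSeries.rename Sum.inr f) = AdicCompletion.of _ _ (f ⊗ₜ 1) :=
  (isPresentation_rhoF k n m p).psMap_rename_left _ f

theorem rhoE_rename (f : MvPowerSeries (Fin n ⊕ Fin m) k) :
    rhoE k n m p (MvPowerSeries.rename (Sum.map id Sum.inl) f) = AdicCompletion.of _ _ (f ⊗ₜ 1) :=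
  (isPresentation_rhoE k n m p).psMap_rename_left _ f

end Presentations

/-! ### Completions of free modules -/

section Free

variable {B A₁ A₂ : Type*} [CommRing B] [CommRing A₁] [CommRing A₂] [Algebra B A₁] [Algebra B A₂]
  {M N : Type*} [AddCommGroup M] [AddCommGroup N] [Module A₁ M] [Module A₂ N] [Module B M]
  [Module B N] [IsScalarTower B A₁ M] [IsScalarTower B A₂ N]

theorem exists_basis_extTensor {ι κ : Type*} (b : Module.Basis ι A₁ M)
    (b' : Module.Basis κ A₂ N) : ∃ β : Module.Basis (ι × κ) (A₁ ⊗[B] A₂) (ExtTensor B A₁ A₂ M N),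
      ∀ i j, β (i, j) = ExtTensor.tmul B (b i) (b' j) := by
  let e : M ⊗[B] N ≃ₗ[B] (ι × κ →₀ A₁ ⊗[B] A₂) :=
    (TensorProduct.congr (b.repr.restrictScalars B) (b'.repr.restrictScalars B)).trans
      (finsuppTensorFinsupp B B A₁ A₂ ι κ)
  have he : ∀ x y i j, e (x ⊗ₜ y) (i, j) = b.repr x i ⊗ₜ b'.repr y j := fun x y i j => by
    simp [e, finsuppTensorFinsupp_apply]
  let e' : ExtTensor B A₁ A₂ M N ≃ₗ[A₁ ⊗[B] A₂] (ι × κ →₀ A₁ ⊗[B] A₂) :=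
    { e with
      map_smul' := by
        intro c x
        change M ⊗[B] N at x
        change e (extAction B c x) = c • e x
        induction c with
        | zero => simp
        | add c c' hc hc' => rw [map_add, LinearMap.add_apply, map_add, hc, hc', add_smul]
        | tmul a a' =>
          induction x with
          | zero => simp
          | add x y hx hy => rw [map_add, map_add, map_add, hx, hy, smul_add]
          | tmul x y =>
            ext ⟨i, j⟩
            rw [extAction_tmul, he, Finsupp.smul_apply, he]
            simp }
  refine ⟨Module.Basis.ofRepr e', fun i j => ?_⟩
  rw [Module.Basis.apply_eq_iff]
  change e (b i ⊗ₜ b' j) = _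
  classical
  ext ⟨i', j'⟩
  rw [he, Module.Basis.repr_self, Module.Basis.repr_self]
  by_cases h1 : i = i'
  · by_cases h2 : j = j'
    · subst h1 h2
      simp [Algebra.TensorProduct.one_def]
    · simp [h2, Finsupp.single_apply]
  · simp [h1, Finsupp.single_apply]

/-- The completed coordinate functions form a dual family, and the expansion in it can be checked
modulo each power of `I`. Finite rank suffices; `A` need not be Noetherian. -/
theorem exists_basis_adicCompletion {A : Type*} [CommRing A] (I : Ideal A) {M ι : Type*}
    [AddCommGroup M] [Module A M] [Finite ι] (b : Module.Basis ι A M) :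
    ∃ β : Module.Basis ι (AdicCompletion I A) (AdicCompletion I M),
      ∀ i, β i = AdicCompletion.of I M (b i) := by
  classical
  have := Fintype.ofFinite ι
  let φ : ι → AdicCompletion I M →ₗ[AdicCompletion I A] AdicCompletion I A :=
    fun i => AdicCompletion.map I (b.coord i)
  have hφ : ∀ i j, φ i (AdicCompletion.of I M (b j)) = if i = j then 1 else 0 := by
    intro i j
    have h1 : φ i (AdicCompletion.of I M (b j)) = AdicCompletion.of I A (b.coord i (b j)) :=
      AdicCompletion.map_of _ _ _
    rw [h1, Module.Basis.coord_apply, Module.Basis.repr_self, Finsupp.single_apply]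
    by_cases h : i = j
    · rw [if_pos h, if_pos h.symm]
      rfl
    · rw [if_neg h, if_neg (Ne.symm h), map_zero]
  have hsum : ∀ x, ∑ i, φ i x • AdicCompletion.of I M (b i) = x := by
    intro x
    induction x using AdicCompletion.induction_on with | _ x
    ext j
    rw [AdicCompletion.val_sum_apply]
    have h1 : ∀ i, (φ i (AdicCompletion.mk I M x) • AdicCompletion.of I M (b i)).val j =
        Submodule.Quotient.mk (b.repr (x j) i • b i) := fun i => rfl
    rw [Finset.sum_congr rfl fun i _ => h1 i]
    refine Eq.trans ?_ (congrArg Submodule.Quotient.mk (b.sum_repr (x j)))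
    exact (map_sum (Submodule.mkQ _) _ _).symm
  refine ⟨Module.Basis.mk (v := fun i => AdicCompletion.of I M (b i)) ?_ ?_,
    fun i => Module.Basis.mk_apply _ _ i⟩
  · rw [Fintype.linearIndependent_iff]
    intro g hg i
    have h1 := congrArg (φ i) hg
    rw [map_sum, map_zero] at h1
    simpa [hφ] using h1
  · rintro x -
    rw [← hsum x]
    exact Submodule.sum_mem _ fun i _ => Submodule.smul_mem _ _ (Submodule.subset_span ⟨i, rfl⟩)

theorem exists_basis_restrict_of_bijective {R A : Type*} [CommRing R] [CommRing A] (ρ : R →+* A)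
    (hρ : Function.Bijective ρ) {M ι : Type*} [AddCommGroup M] [Module A M]
    (b : Module.Basis ι A M) :
    ∃ β : Module.Basis ι R (Restrict ρ M), ∀ i, β i = toRestrict ρ (b i) := by
  let : Module A (Restrict ρ M) := inferInstanceAs (Module A M)
  let b' : Module.Basis ι A (Restrict ρ M) := b
  let e := (RingEquiv.ofBijective ρ hρ).symm
  refine ⟨b'.mapCoeffs e fun c x => ?_, fun i => b'.mapCoeffs_apply e _ i⟩
  have h1 : ρ (e c) = c := (RingEquiv.ofBijective ρ hρ).apply_symm_apply c
  have h2 : e c • x = ρ (e c) • x := rfl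
  rw [h2, h1]

end Free


/-! ### Extension of scalars to a completed tensor product -/

section Extension

variable {B A₁ A₂ R : Type*} [CommRing B] [CommRing A₁] [CommRing A₂] [CommRing R]
  [Algebra B A₁] [Algebra B A₂] {I₁ : Ideal A₁} {I₂ : Ideal A₂}
  (ρ : R →+* CompletedRing B I₁ I₂)
  {M M' : Type*} [AddCommGroup M] [Module A₁ M] [Module B M] [IsScalarTower B A₁ M]
  [AddCommGroup M'] [Module A₁ M'] [Module B M'] [IsScalarTower B A₁ M']

/-- The element `x ⊗̂ 1` of the extension of scalars of `M`. -/
def extIn (x : M) : Restrict ρ (CompletedTensor B I₁ I₂ M A₂) :=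
  toRestrict ρ (CompletedTensor.tmul B I₁ I₂ x 1)

/-- The extension of scalars of a linear map. -/
def extMap (f : M →ₗ[A₁] M') : Restrict ρ (CompletedTensor B I₁ I₂ M A₂) →ₗ[R]
    Restrict ρ (CompletedTensor B I₁ I₂ M' A₂) :=
  restrictMap ρ (CompletedTensor.map B I₁ I₂ f LinearMap.id)

theorem extMap_extIn (f : M →ₗ[A₁] M') (x : M) : extMap ρ f (extIn ρ x) = extIn ρ (f x) := by
  change AdicCompletion.map _ (ExtTensor.map B f LinearMap.id) (AdicCompletion.of _ _ _) = _
  rw [AdicCompletion.map_of]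
  rfl

theorem extIn_add (x y : M) : extIn ρ (x + y) = extIn ρ x + extIn ρ y := by
  exact (congrArg (AdicCompletion.of _ (ExtTensor B A₁ A₂ M A₂))
    (TensorProduct.add_tmul x y (1 : A₂))).trans (map_add _ _ _)

theorem of_smul_of {A : Type*} [CommRing A] (I : Ideal A) {M : Type*} [AddCommGroup M] [Module A M]
    (a : A) (x : M) :
    AdicCompletion.of I A a • AdicCompletion.of I M x = AdicCompletion.of I M (a • x) := rfl

theorem smul_extIn {r : R} {a : A₁} (h : ρ r = AdicCompletion.of _ _ (a ⊗ₜ 1)) (x : M) :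
    r • extIn ρ x = extIn ρ (a • x) := by
  change ρ r • AdicCompletion.of _ (ExtTensor B A₁ A₂ M A₂) (ExtTensor.tmul B x 1) = _
  rw [h, of_smul_of, ExtTensor.smul_tmul, one_smul]
  rfl

theorem exists_basis_extIn (hρ : Function.Bijective ρ) {ι : Type*} [Finite ι]
    (b : Module.Basis ι A₁ M) :
    ∃ β : Module.Basis ι R (Restrict ρ (CompletedTensor B I₁ I₂ M A₂)),
      ∀ i, β i = extIn ρ (b i) := by
  obtain ⟨β₁, h₁⟩ := exists_basis_extTensor (B := B) b (Module.Basis.singleton Unit A₂)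
  obtain ⟨β₂, h₂⟩ := exists_basis_adicCompletion (tensorIdeal B I₁ I₂) β₁
  obtain ⟨β₃, h₃⟩ := exists_basis_restrict_of_bijective ρ hρ β₂
  refine ⟨β₃.reindex (Equiv.prodPUnit ι), fun i => ?_⟩
  rw [Module.Basis.reindex_apply, h₃, h₂]
  change toRestrict ρ (AdicCompletion.of _ _ (β₁ (i, ()))) = _
  rw [h₁, Module.Basis.singleton_apply]
  rfl

theorem extIn_hom_ext (hρ : Function.Bijective ρ) [Module.Free A₁ M] [Module.Finite A₁ M]
    {Z : Type*} [AddCommGroup Z] [Module R Z]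
    {f g : Restrict ρ (CompletedTensor B I₁ I₂ M A₂) →ₗ[R] Z}
    (h : ∀ x, f (extIn ρ x) = g (extIn ρ x)) : f = g := by
  obtain ⟨β, hβ⟩ := exists_basis_extIn ρ hρ (Module.Free.chooseBasis A₁ M)
  exact β.ext fun i => by rw [hβ, h]

/-- The extension of scalars of a factorisation. -/
def extOddEnd (D : OddEnd A₁ M) : OddEnd R (Restrict ρ (CompletedTensor B I₁ I₂ M A₂)) :=
  (OddEnd.ctensor B I₁ I₂ D (OddEnd.unit A₂)).restrict ρ

theorem extOddEnd_d_extIn (D : OddEnd A₁ M) (x : M) :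
    (extOddEnd ρ D).d (extIn ρ x) = extIn ρ (D.d x) := by
  have h : (extOddEnd ρ D).d (extIn ρ x) = extMap ρ D.d (extIn ρ x) +
    toRestrict ρ (AdicCompletion.of (tensorIdeal B I₁ I₂) (ExtTensor B A₁ A₂ M A₂)
      (ExtTensor.tmul B (D.G x) 0)) := by
    refine congrArg (extMap ρ D.d (extIn ρ x) + ·) ?_
    change AdicCompletion.map _ (ExtTensor.map B D.G (OddEnd.unit A₂).d)
      (AdicCompletion.of _ _ _) = _
    rw [AdicCompletion.map_of]
    rfl
  have h0 : ExtTensor.tmul B (A₁ := A₁) (A₂ := A₂) (D.G x) (0 : A₂) = 0 :=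
    TensorProduct.tmul_zero _ _
  rw [h, extMap_extIn, h0, map_zero, map_zero, add_zero]

theorem extOddEnd_isLinearFactorisation (hρ : Function.Bijective ρ) [Module.Free A₁ M]
    [Module.Finite A₁ M] {D : OddEnd A₁ M} {a : A₁} (hD : D.IsLinearFactorisation a) {r : R}
    (h : ρ r = AdicCompletion.of _ _ (a ⊗ₜ 1)) : (extOddEnd ρ D).IsLinearFactorisation r := by
  have h1 : (extOddEnd ρ D).d ∘ₗ (extOddEnd ρ D).d = r • LinearMap.id :=
    extIn_hom_ext ρ hρ fun x => by
      rw [LinearMap.comp_apply, extOddEnd_d_extIn, extOddEnd_d_extIn, hD, LinearMap.smul_apply,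
        LinearMap.id_apply, smul_extIn ρ h]
  exact fun x => LinearMap.congr_fun h1 x

end Extension

/-! ### Tensor products of factorisations -/

section Tensor

variable {R : Type*} [CommRing R] {X Y : Type*} [AddCommGroup X] [Module R X]
  [AddCommGroup Y] [Module R Y]

theorem OddEnd.tensor_isLinearFactorisation {D : OddEnd R X} {D' : OddEnd R Y} {a b : R}
    (h : D.IsLinearFactorisation a) (h' : D'.IsLinearFactorisation b) :
    (D.tensor D').IsLinearFactorisation (a + b) := by
  intro x
  induction x with
  | zero => simp
  | add x y hx hy => rw [map_add, map_add, hx, hy, smul_add]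
  | tmul x y =>
    simp only [OddEnd.tensor, LinearMap.add_apply, TensorProduct.map_tmul, LinearMap.id_apply,
      map_add, h x, h' y, D.G_G, D.d_G, TensorProduct.neg_tmul, TensorProduct.tmul_smul,
      add_smul, TensorProduct.smul_tmul']
    abel

/-- The operator `1 ⊗ δ` for an odd operator `δ`. -/
theorem OddEnd.tensor_G_map {D : OddEnd R X} {D' : OddEnd R Y} {δ : Y →ₗ[R] Y}
    (hG : ∀ y, δ (D'.G y) = -D'.G (δ y)) (x : X ⊗[R] Y) :
    TensorProduct.map D.G δ ((D.tensor D').G x) =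
      -(D.tensor D').G (TensorProduct.map D.G δ x) := by
  induction x with
  | zero => simp
  | add x y hx hy => rw [map_add, map_add, hx, hy, map_add, map_add, neg_add]
  | tmul x y => simp [OddEnd.tensor, hG, TensorProduct.tmul_neg]

/-- The contribution of `d ⊗ 1` cancels because `d` anticommutes with `G`; what remains is `1 ⊗ (dδ
+ δd)`. -/
theorem OddEnd.tensor_d_map {D : OddEnd R X} {D' : OddEnd R Y} {δ : Y →ₗ[R] Y} {t : R}
    (hd : ∀ y, D'.d (δ y) + δ (D'.d y) = t • y) (x : X ⊗[R] Y) :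
    (D.tensor D').d (TensorProduct.map D.G δ x) + TensorProduct.map D.G δ ((D.tensor D').d x) =
      t • x := by
  induction x with
  | zero => simp
  | add x y hx hy =>
    rw [smul_add, ← hx, ← hy]
    simp only [map_add]
    abel
  | tmul x y =>
    rw [← TensorProduct.tmul_smul, ← hd]
    simp only [OddEnd.tensor, LinearMap.add_apply, TensorProduct.map_tmul, LinearMap.id_apply,
      map_add, D.G_G, D.d_G, TensorProduct.neg_tmul, TensorProduct.tmul_add]
    abel

end Tensor

/-! ### The derivative of a matrix factorisation -/

section Derivative

variable {K R X ι : Type*} [CommRing K] [CommRing R] [Algebra K R] [AddCommGroup X] [Module R X]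
  [Fintype ι] [DecidableEq ι] (D : OddEnd R X) (b : Module.Basis ι R X) (δ : Derivation K R R)

theorem OddEnd.derivD_basis (i : ι) :
    D.derivD b δ (b i) = ∑ j, δ (b.repr (D.d (b i)) j) • b j := by
  rw [derivD, Matrix.toLin_self]
  simp [LinearMap.toMatrix_apply]

/-- In a homogeneous basis `G` is diagonal with entries `±1`, so oddness of `d` is a condition with
integer coefficients on each matrix entry. A derivation preserves it. -/
theorem OddEnd.derivD_G (hb : D.IsHomogeneousBasis b) (x : X) :
    D.derivD b δ (D.G x) = -D.G (D.derivD b δ x) := by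
  have h1 : ∀ i, ∃ s : ℤ, D.G (b i) = s • b i := fun i => by
    obtain h | h := hb i
    · exact ⟨1, by rw [one_smul]; exact sub_eq_zero.mp h⟩
    · exact ⟨-1, by rw [neg_one_smul]; exact eq_neg_of_add_eq_zero_left h⟩
  choose s hs using h1
  have h2 : ∀ i j, s i • b.repr (D.d (b i)) j = -(s j • b.repr (D.d (b i)) j) := by
    intro i j
    have h3 := congrArg (fun x => b.repr x j) (D.d_G (b i))
    simp only [hs, map_zsmul, map_neg, Finsupp.smul_apply, Finsupp.neg_apply] at h3
    rw [h3]
    congr 1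
    have h4 : b.coord j ∘ₗ D.G = (s j : R) • b.coord j := b.ext fun l => by
      rw [LinearMap.comp_apply, hs, map_zsmul, LinearMap.smul_apply, Module.Basis.coord_apply,
        Module.Basis.repr_self, Finsupp.single_apply]
      by_cases h : l = j
      · simp [h]
      · simp [h]
    exact (LinearMap.congr_fun h4 (D.d (b i))).trans (Int.cast_smul_eq_zsmul R _ _)
  have h5 : D.derivD b δ ∘ₗ D.G = -(D.G ∘ₗ D.derivD b δ) := b.ext fun i => by
    rw [LinearMap.comp_apply, hs, map_zsmul, D.derivD_basis, LinearMap.neg_apply,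
      LinearMap.comp_apply, D.derivD_basis, map_sum, Finset.smul_sum, ← Finset.sum_neg_distrib]
    refine Finset.sum_congr rfl fun j _ => ?_
    rw [map_smul, hs, ← smul_assoc, ← map_zsmul, h2, map_neg, map_zsmul, neg_smul, smul_assoc,
      smul_comm]
  exact LinearMap.congr_fun h5 x

/-- This is the Leibniz rule applied to the entries of the matrix identity `M * M = a • 1`. -/
theorem OddEnd.d_derivD_add {a : R} (hD : D.IsLinearFactorisation a) (x : X) :
    D.d (D.derivD b δ x) + D.derivD b δ (D.d x) = δ a • x := by
  have h1 : D.d ∘ₗ D.d = a • LinearMap.id := LinearMap.ext hD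
  set M := LinearMap.toMatrix b b D.d with hM
  have h2 : M * M = a • (1 : Matrix ι ι R) := by
    rw [hM, ← LinearMap.toMatrix_comp b b b, h1, map_smul, LinearMap.toMatrix_id]
  have h3 : M * M.map δ + M.map δ * M = δ a • (1 : Matrix ι ι R) := by
    ext i j
    have h4 := congrArg δ (congrFun (congrFun h2 i) j)
    rw [Matrix.mul_apply, map_sum] at h4
    rw [Matrix.add_apply, Matrix.mul_apply, Matrix.mul_apply, ← Finset.sum_add_distrib]
    refine Eq.trans (Finset.sum_congr rfl fun l _ => ?_) (h4.trans ?_)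
    · rw [Derivation.leibniz, Matrix.map_apply, Matrix.map_apply, smul_eq_mul, smul_eq_mul,
        mul_comm (M l j)]
    · rw [Matrix.smul_apply, Matrix.smul_apply, smul_eq_mul, smul_eq_mul]
      by_cases h : i = j
      · subst h
        simp [mul_comm]
      · simp [h]
  have h5 : D.d ∘ₗ D.derivD b δ + D.derivD b δ ∘ₗ D.d = δ a • LinearMap.id := by
    have h6 : D.d = Matrix.toLin b b M := (Matrix.toLin_toMatrix b b D.d).symm
    have h7 : D.derivD b δ = Matrix.toLin b b (M.map δ) := rfl
    rw [h7, h6, ← Matrix.toLin_mul b b b, ← Matrix.toLin_mul b b b, ← map_add, h3, map_smul,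
      Matrix.toLin_one]
  exact LinearMap.congr_fun h5 x

theorem OddEnd.IsFiniteRankMF.free_finite [Invertible (2 : R)] {D : OddEnd R X} {a : R}
    (h : D.IsFiniteRankMF a) : Module.Free R X ∧ Module.Finite R X := by
  have := h.free_even
  have := h.finite_even
  have := h.free_odd
  have := h.finite_odd
  let e := Submodule.prodEquivOfIsCompl _ _ D.isCompl_evenPart_oddPart
  exact ⟨Module.Free.of_equiv e, Module.Finite.equiv e⟩

end Derivative


/-! ### Partial derivatives of renamed power series -/

section Rename

variable {k : Type*} [CommRing k] {σ τ : Type*} (e : σ ↪ τ)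

theorem coeff_rename_of_notMem {s : τ} (hs : s ∉ Set.range e) {x : τ →₀ ℕ} (hx : x s ≠ 0)
    (f : MvPowerSeries σ k) : MvPowerSeries.coeff x (MvPowerSeries.rename e f) = 0 := by
  refine MvPowerSeries.coeff_rename_eq_zero _ _ ?_
  rintro ⟨y, rfl⟩
  exact hx (Finsupp.mapDomain_of_notMem_range y s hs)

theorem pderiv_rename (i : σ) (f : MvPowerSeries σ k) :
    MvPowerSeries.pderiv k (e i) (MvPowerSeries.rename e f) =
      MvPowerSeries.rename e (MvPowerSeries.pderiv k i f) := by
  ext x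
  rw [MvPowerSeries.coeff_pderiv]
  by_cases hx : x ∈ Set.range (Finsupp.embDomain e)
  · obtain ⟨y, rfl⟩ := hx
    have : Finsupp.embDomain e y + Finsupp.single (e i) 1 =
        Finsupp.embDomain e (y + Finsupp.single i 1) := by
      rw [Finsupp.embDomain_add, Finsupp.embDomain_single]
    rw [this, MvPowerSeries.coeff_embDomain_rename, MvPowerSeries.coeff_embDomain_rename,
      MvPowerSeries.coeff_pderiv, Finsupp.embDomain_apply_self]
  · rw [Finsupp.mem_range_embDomain_iff, Set.not_subset] at hx
    obtain ⟨s, hs, hse⟩ := hx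
    have hs' : x s ≠ 0 := Finsupp.mem_support_iff.mp hs
    rw [coeff_rename_of_notMem e hse hs', coeff_rename_of_notMem e hse, zero_mul]
    simp [hs']

theorem pderiv_rename_of_notMem {s : τ} (hs : s ∉ Set.range e) (f : MvPowerSeries σ k) :
    MvPowerSeries.pderiv k s (MvPowerSeries.rename e f) = 0 := by
  ext x
  rw [MvPowerSeries.coeff_pderiv, coeff_rename_of_notMem e hs (by simp), zero_mul, map_zero]

end Rename

/-! ### The differential and the null-homotopies on `F ⊠ E` -/

section Box

variable {k : Type u} [Field k] {n m p : ℕ}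
  {F : Type w} [AddCommGroup F] [Module (MvPowerSeries (Fin m ⊕ Fin p) k) F]
  [Module k F] [IsScalarTower k (MvPowerSeries (Fin m ⊕ Fin p) k) F]
  {E : Type v} [AddCommGroup E] [Module (MvPowerSeries (Fin n ⊕ Fin m) k) E]
  [Module k E] [IsScalarTower k (MvPowerSeries (Fin n ⊕ Fin m) k) E]
  {W : MvPowerSeries (Fin n) k} {V : MvPowerSeries (Fin m) k} {U : MvPowerSeries (Fin p) k}
  {DE : OddEnd (MvPowerSeries (Fin n ⊕ Fin m) k) E}
  {DF : OddEnd (MvPowerSeries (Fin m ⊕ Fin p) k) F}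

theorem exists_basis_box {ι κ : Type*} [Finite ι] [Finite κ]
    (bF : Module.Basis ι (MvPowerSeries (Fin m ⊕ Fin p) k) F)
    (bE : Module.Basis κ (MvPowerSeries (Fin n ⊕ Fin m) k) E) :
    ∃ β : Module.Basis (ι × κ) (MvPowerSeries (Fin n ⊕ Fin m ⊕ Fin p) k) (Box k n m p F E),
      ∀ i j, β (i, j) = boxTmul (bF i) (bE j) := by
  obtain ⟨β₁, h₁⟩ := exists_basis_extIn _ (rhoF_bijective k n m p) bF
  obtain ⟨β₂, h₂⟩ := exists_basis_extIn _ (rhoE_bijective k n m p) bE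
  refine ⟨β₁.tensorProduct β₂, fun i j => ?_⟩
  rw [Module.Basis.tensorProduct_apply, h₁, h₂]
  rfl

variable [Module.Free (MvPowerSeries (Fin n ⊕ Fin m) k) E]
  [Module.Finite (MvPowerSeries (Fin n ⊕ Fin m) k) E]

/-- `W` does not involve `y`, so the `y_i`-derivative of `V - W` is `t_i`. The identity is linear
over `k⟦x, y, z⟧` and is checked on the elements `x ⊗̂ 1`. -/
theorem piE_partialE {ι : Type*} [Fintype ι] [DecidableEq ι]
    (b : Module.Basis ι (MvPowerSeries (Fin n ⊕ Fin m) k) E)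
    (hE : DE.IsLinearFactorisation
      (MvPowerSeries.rename Sum.inr V - MvPowerSeries.rename Sum.inl W))
    (i : Fin m) (y : PiE k n m p E) :
    (piE p DE).d (extMap (rhoE k n m p) (partialE DE b i) y) +
      extMap (rhoE k n m p) (partialE DE b i) ((piE p DE).d y) = tSeqXYZ n p V i • y := by
  have h0 : MvPowerSeries.pderiv k (Sum.inr i : Fin n ⊕ Fin m)
      (MvPowerSeries.rename Sum.inr V - MvPowerSeries.rename Sum.inl W) =
      MvPowerSeries.rename Sum.inr (tSeq V i) := by
    have h1 := pderiv_rename (Function.Embedding.inr : Fin m ↪ Fin n ⊕ Fin m) i V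
    have h2 := pderiv_rename_of_notMem (Function.Embedding.inl : Fin n ↪ Fin n ⊕ Fin m)
      (s := Sum.inr i) (by simp) W
    rw [map_sub]
    exact (congrArg₂ _ h1 h2).trans (sub_zero _)
  have h1 : rhoE k n m p (tSeqXYZ n p V i) =
      AdicCompletion.of _ _ (MvPowerSeries.rename Sum.inr (tSeq V i) ⊗ₜ 1) := by
    rw [← rhoE_rename, tSeqXYZ, MvPowerSeries.rename_rename]
    rfl
  have h2 : (piE p DE).d ∘ₗ extMap (rhoE k n m p) (partialE DE b i) +
      extMap (rhoE k n m p) (partialE DE b i) ∘ₗ (piE p DE).d =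
      tSeqXYZ n p V i • LinearMap.id := extIn_hom_ext _ (rhoE_bijective k n m p) fun x => by
    have h3 := extOddEnd_d_extIn (rhoE k n m p) DE
    have h4 : piE p DE = extOddEnd (rhoE k n m p) DE := rfl
    rw [h4, LinearMap.add_apply, LinearMap.comp_apply, LinearMap.comp_apply, extMap_extIn, h3, h3,
      extMap_extIn, ← extIn_add, LinearMap.smul_apply, LinearMap.id_apply, smul_extIn _ h1,
      partialE, DE.d_derivD_add b _ hE, h0]
  exact LinearMap.congr_fun h2 y

theorem lam_d {ι : Type*} [Fintype ι] [DecidableEq ι]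
    (b : Module.Basis ι (MvPowerSeries (Fin n ⊕ Fin m) k) E)
    (hE : DE.IsLinearFactorisation
      (MvPowerSeries.rename Sum.inr V - MvPowerSeries.rename Sum.inl W))
    (i : Fin m) (x : Box k n m p F E) :
    (box DF DE).d (lam DF DE b i x) + lam DF DE b i ((box DF DE).d x) = tSeqXYZ n p V i • x :=
  OddEnd.tensor_d_map (piE_partialE b hE i) x

theorem lam_G {ι : Type*} [Fintype ι] [DecidableEq ι]
    (b : Module.Basis ι (MvPowerSeries (Fin n ⊕ Fin m) k) E) (hb : DE.IsHomogeneousBasis b)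
    (i : Fin m) (x : Box k n m p F E) :
    lam DF DE b i ((box DF DE).G x) = -(box DF DE).G (lam DF DE b i x) := by
  refine OddEnd.tensor_G_map (D' := piE p DE) (fun y => ?_) x
  have h : extMap (rhoE k n m p) (partialE DE b i) ∘ₗ (piE p DE).G =
      -((piE p DE).G ∘ₗ extMap (rhoE k n m p) (partialE DE b i)) :=
    extIn_hom_ext _ (rhoE_bijective k n m p) fun x => by
      have h4 : (piE p DE).G = extMap (rhoE k n m p) DE.G := rfl
      have h5 : ∀ x : E, extIn (rhoE k n m p) (-x) = -extIn (rhoE k n m p) x := fun x => by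
        rw [eq_neg_iff_add_eq_zero, ← extIn_add, neg_add_cancel]
        have h6 := extIn_add (rhoE k n m p) (0 : E) 0
        rw [add_zero] at h6
        exact left_eq_add.mp h6
      rw [h4, LinearMap.comp_apply, extMap_extIn, extMap_extIn, LinearMap.neg_apply,
        LinearMap.comp_apply, extMap_extIn, extMap_extIn, partialE, DE.derivD_G b _ hb, h5]
  exact LinearMap.congr_fun h y

variable [Module.Free (MvPowerSeries (Fin m ⊕ Fin p) k) F]
  [Module.Finite (MvPowerSeries (Fin m ⊕ Fin p) k) F]

/-- Potentials add under the tensor product, and `V` cancels in `(U - V) + (V - W)`. -/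
theorem box_isLinearFactorisation
    (hE : DE.IsLinearFactorisation
      (MvPowerSeries.rename Sum.inr V - MvPowerSeries.rename Sum.inl W))
    (hF : DF.IsLinearFactorisation
      (MvPowerSeries.rename Sum.inr U - MvPowerSeries.rename Sum.inl V)) :
    (box DF DE).IsLinearFactorisation
      (piXZ k n m p (MvPowerSeries.rename Sum.inr U - MvPowerSeries.rename Sum.inl W)) := by
  have h1 := OddEnd.tensor_isLinearFactorisation
    (extOddEnd_isLinearFactorisation _ (rhoF_bijective k n m p) hF (rhoF_rename k n m p _))
    (extOddEnd_isLinearFactorisation _ (rhoE_bijective k n m p) hE (rhoE_rename k n m p _))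
  have h2 : ∀ f, piXZ k n m p f = MvPowerSeries.rename (Sum.map id Sum.inr) f := fun _ => rfl
  have h3 : MvPowerSeries.rename (R := k) (Sum.inr : Fin m ⊕ Fin p → Fin n ⊕ Fin m ⊕ Fin p)
        (MvPowerSeries.rename Sum.inr U - MvPowerSeries.rename Sum.inl V) +
      MvPowerSeries.rename (Sum.map id Sum.inl)
        (MvPowerSeries.rename Sum.inr V - MvPowerSeries.rename Sum.inl W) =
      piXZ k n m p (MvPowerSeries.rename Sum.inr U - MvPowerSeries.rename Sum.inl W) := by
    rw [h2]
    simp only [map_sub, MvPowerSeries.rename_rename]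
    exact sub_add_sub_cancel _ _ _
  rw [h3] at h1
  exact h1

end Box


/-! ### Reduction modulo an ideal of the base -/

section Reduction

variable {B A₁ A₂ : Type*} [CommRing B] [CommRing A₁] [CommRing A₂] [Algebra B A₁] [Algebra B A₂]
  {M N : Type*} [AddCommGroup M] [AddCommGroup N] [Module A₁ M] [Module A₂ N] [Module B M]
  [Module B N] [IsScalarTower B A₁ M] [IsScalarTower B A₂ N]
  {M' N' : Type*} [AddCommGroup M'] [AddCommGroup N'] [Module A₁ M'] [Module A₂ N'] [Module B M']
  [Module B N'] [IsScalarTower B A₁ M'] [IsScalarTower B A₂ N']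
  {J₁ : Ideal A₁} {J₂ : Ideal A₂} {J : Ideal (A₁ ⊗[B] A₂)}

theorem ExtTensor.map_surjective {f : M →ₗ[A₁] M'} {g : N →ₗ[A₂] N'}
    (hf : Function.Surjective f) (hg : Function.Surjective g) :
    Function.Surjective (ExtTensor.map B f g) :=
  TensorProduct.map_surjective (g := f.restrictScalars B) (g' := g.restrictScalars B) hf hg

theorem ExtTensor.tmul_mem_smul_top (h₁ : ∀ a ∈ J₁, a ⊗ₜ[B] (1 : A₂) ∈ J)
    (h₂ : ∀ a ∈ J₂, (1 : A₁) ⊗ₜ[B] a ∈ J) (x : M) (y : N)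
    (h : x ∈ (J₁ • ⊤ : Submodule A₁ M) ∨ y ∈ (J₂ • ⊤ : Submodule A₂ N)) :
    ExtTensor.tmul B x y ∈ (J • ⊤ : Submodule (A₁ ⊗[B] A₂) (ExtTensor B A₁ A₂ M N)) := by
  obtain hx | hy := h
  · induction hx using Submodule.smul_induction_on' with
    | smul a ha x hx =>
      have := ExtTensor.smul_tmul B a (1 : A₂) x y
      rw [one_smul] at this
      rw [← this]
      exact Submodule.smul_mem_smul (h₁ a ha) Submodule.mem_top
    | add x hx x' hx' h h' =>
      have : ExtTensor.tmul B (A₁ := A₁) (A₂ := A₂) (x + x') y =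
        ExtTensor.tmul B x y + ExtTensor.tmul B x' y := TensorProduct.add_tmul _ _ _
      rw [this]
      exact add_mem h h'
  · induction hy using Submodule.smul_induction_on' with
    | smul a ha y hy =>
      have := ExtTensor.smul_tmul B (1 : A₁) a x y
      rw [one_smul] at this
      rw [← this]
      exact Submodule.smul_mem_smul (h₂ a ha) Submodule.mem_top
    | add x' hx x'' hx' h h' =>
      have : ∀ z z' : N, ExtTensor.tmul B (A₁ := A₁) (A₂ := A₂) x (z + z') =
        ExtTensor.tmul B x z + ExtTensor.tmul B x z' := fun _ _ => TensorProduct.tmul_add _ _ _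
      rw [this]
      exact add_mem h h'

/-- By right exactness the kernel of `f ⊗ g` is spanned by the images of `ker f ⊗ N` and `M ⊗ ker
g`. -/
theorem ExtTensor.ker_map_le (h₁ : ∀ a ∈ J₁, a ⊗ₜ[B] (1 : A₂) ∈ J)
    (h₂ : ∀ a ∈ J₂, (1 : A₁) ⊗ₜ[B] a ∈ J) {f : M →ₗ[A₁] M'} {g : N →ₗ[A₂] N'}
    (hf : Function.Surjective f) (hg : Function.Surjective g)
    (hkf : LinearMap.ker f ≤ J₁ • ⊤) (hkg : LinearMap.ker g ≤ J₂ • ⊤) :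
    LinearMap.ker (ExtTensor.map B f g) ≤ J • ⊤ := by
  let fB := f.restrictScalars B
  let gB := g.restrictScalars B
  have h := TensorProduct.map_ker (LinearMap.exact_subtype_ker_map fB) hf
    (LinearMap.exact_subtype_ker_map gB) hg
  have hadd : ∀ x y : M ⊗[B] N,
      (x : ExtTensor B A₁ A₂ M N) ∈
        (J • ⊤ : Submodule (A₁ ⊗[B] A₂) (ExtTensor B A₁ A₂ M N)) →
      (y : ExtTensor B A₁ A₂ M N) ∈
        (J • ⊤ : Submodule (A₁ ⊗[B] A₂) (ExtTensor B A₁ A₂ M N)) →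
      ((x + y : M ⊗[B] N) : ExtTensor B A₁ A₂ M N) ∈
        (J • ⊤ : Submodule (A₁ ⊗[B] A₂) (ExtTensor B A₁ A₂ M N)) :=
    fun x y hx hy => add_mem hx hy
  suffices key : ∀ z : M ⊗[B] N, TensorProduct.map fB gB z = 0 →
      (z : ExtTensor B A₁ A₂ M N) ∈
        (J • ⊤ : Submodule (A₁ ⊗[B] A₂) (ExtTensor B A₁ A₂ M N)) from fun z hz => key z hz
  intro z hz
  have hz' : z ∈ LinearMap.ker (TensorProduct.map fB gB) := hz
  rw [h] at hz'
  obtain ⟨_, ⟨a, rfl⟩, _, ⟨b, rfl⟩, hab⟩ := Submodule.mem_sup.mp hz'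
  rw [← hab]
  refine hadd _ _ ?_ ?_
  · clear hab
    induction a with
    | zero =>
      rw [map_zero]
      exact zero_mem (J • ⊤ : Submodule (A₁ ⊗[B] A₂) (ExtTensor B A₁ A₂ M N))
    | add x y hx hy =>
      rw [map_add]
      exact hadd _ _ hx hy
    | tmul x y => exact ExtTensor.tmul_mem_smul_top h₁ h₂ _ _ (Or.inr (hkg y.2))
  · clear hab
    induction b with
    | zero =>
      rw [map_zero]
      exact zero_mem (J • ⊤ : Submodule (A₁ ⊗[B] A₂) (ExtTensor B A₁ A₂ M N))
    | add x y hx hy =>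
      rw [map_add]
      exact hadd _ _ hx hy
    | tmul x y => exact ExtTensor.tmul_mem_smul_top h₁ h₂ _ _ (Or.inl (hkf x.2))

/-- An element of a free module whose image under a reduction is divisible by `I`. -/
theorem ExtTensor.repr_mem_of_map_mem (h₁ : ∀ a ∈ J₁, a ⊗ₜ[B] (1 : A₂) ∈ J)
    (h₂ : ∀ a ∈ J₂, (1 : A₁) ⊗ₜ[B] a ∈ J) {f : M →ₗ[A₁] M'} {g : N →ₗ[A₂] N'}
    (hf : Function.Surjective f) (hg : Function.Surjective g)
    (hkf : LinearMap.ker f ≤ J₁ • ⊤) (hkg : LinearMap.ker g ≤ J₂ • ⊤) {ι : Type*}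
    (b : Module.Basis ι (A₁ ⊗[B] A₂) (ExtTensor B A₁ A₂ M N)) {I : Ideal (A₁ ⊗[B] A₂)}
    {x : ExtTensor B A₁ A₂ M N}
    (hx : ExtTensor.map B f g x ∈ I • (⊤ : Submodule (A₁ ⊗[B] A₂) _)) (i : ι) :
    b.repr x i ∈ J ⊔ I := by
  rw [← LinearMap.range_eq_top.mpr (ExtTensor.map_surjective (B := B) hf hg), ← Submodule.map_top,
    ← Submodule.map_smul''] at hx
  obtain ⟨y, hy, hxy⟩ := hx
  have h3 : x - y ∈ LinearMap.ker (ExtTensor.map B f g) := by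
    rw [LinearMap.mem_ker, map_sub, hxy, sub_self]
  have h4 := (mem_ideal_smul_top_iff_repr b J _).mp
    (ExtTensor.ker_map_le h₁ h₂ hf hg hkf hkg h3) i
  have h5 := (mem_ideal_smul_top_iff_repr b I _).mp hy i
  rw [← sub_add_cancel x y, map_add, Finsupp.add_apply]
  exact Submodule.add_mem_sup h4 h5

end Reduction

/-! ### Krull's intersection theorem -/

section Krull

theorem mem_of_forall_mem_sup_pow {R : Type*} [CommRing R] [IsNoetherianRing R] [IsLocalRing R]
    (J : Ideal R) (x : R) (h : ∀ j, x ∈ J ⊔ IsLocalRing.maximalIdeal R ^ j) : x ∈ J := by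
  rw [← Ideal.Quotient.eq_zero_iff_mem]
  have hR : IsHausdorff (IsLocalRing.maximalIdeal R) (R ⧸ J) := inferInstance
  refine hR.haus' _ fun j => ?_
  rw [SModEq.zero]
  obtain ⟨a, ha, b, hb, rfl⟩ := Submodule.mem_sup.mp (h j)
  rw [map_add, Ideal.Quotient.eq_zero_iff_mem.mpr ha, zero_add]
  have h1 : Ideal.Quotient.mk J b = b • (1 : R ⧸ J) := by
    rw [← map_one (Ideal.Quotient.mk J)]
    exact (congrArg _ (mul_one b)).symm
  rw [h1]
  exact Submodule.smul_mem_smul hb Submodule.mem_top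

end Krull


/-! ### The kernel of a reduction between completed tensor products -/

section CompletedReduction

/-- Modulo `I ^ j`, coefficients in `k⟦σ⟧` can be exchanged for representatives in `A`, which
reduces statements about the completion to the uncompleted module. -/
theorem val_sum_psMap_smul {k σ A : Type*} [Field k] [CommRing A] [Finite σ] (I : Ideal A)
    (c : k →+* A) (a : σ → A) (ha : ∀ s, a s ∈ I) {M ι : Type*} [AddCommGroup M] [Module A M]
    [Fintype ι] (r : ι → MvPowerSeries σ k) (s : ι → A) (v : ι → M) (j : ℕ)
    (h : ∀ i, Ideal.Quotient.mk (I ^ j) (s i) = psMapMod I c a ha j (r i)) :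
    (∑ i, psMap I c a ha (r i) • AdicCompletion.of I M (v i)).val j =
      Submodule.Quotient.mk (∑ i, s i • v i) := by
  rw [AdicCompletion.val_sum_apply]
  refine Eq.trans (Finset.sum_congr rfl fun i _ => ?_)
    (map_sum (Submodule.mkQ (I ^ j • ⊤ : Submodule A M)) _ _).symm
  exact (AdicCompletion.val_smul_eq_evalₐ_smul I j (psMap I c a ha (r i))
    (Submodule.Quotient.mk (v i))).trans
    (congrArg (fun q : A ⧸ I ^ j => q • (Submodule.Quotient.mk (v i) : M ⧸ (I ^ j • ⊤ :
      Submodule A M))) ((evalₐ_psMap I c a ha j (r i)).trans (h i).symm))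

variable {k : Type*} [Field k] {σ₁ σ₂ σ : Type*} [Finite σ]
  {B : Type*} [CommRing B] [Algebra B (MvPowerSeries σ₁ k)] [Algebra B (MvPowerSeries σ₂ k)]
  {c : k →+* MvPowerSeries σ₁ k ⊗[B] MvPowerSeries σ₂ k}
  {a : σ → MvPowerSeries σ₁ k ⊗[B] MvPowerSeries σ₂ k}
  (ha : ∀ s, a s ∈ tensorIdeal B (varIdeal k σ₁) (varIdeal k σ₂))
  {M N M' N' : Type*} [AddCommGroup M] [AddCommGroup N] [AddCommGroup M'] [AddCommGroup N']
  [Module (MvPowerSeries σ₁ k) M] [Module (MvPowerSeries σ₂ k) N]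
  [Module (MvPowerSeries σ₁ k) M'] [Module (MvPowerSeries σ₂ k) N']
  [Module B M] [Module B N] [Module B M'] [Module B N']
  [IsScalarTower B (MvPowerSeries σ₁ k) M] [IsScalarTower B (MvPowerSeries σ₂ k) N]
  [IsScalarTower B (MvPowerSeries σ₁ k) M'] [IsScalarTower B (MvPowerSeries σ₂ k) N']

variable (c) in
/-- The element `x ⊗̂ y` over `k⟦σ⟧`. -/
def complTmul (x : M) (y : N) : Restrict (psMap _ c a ha)
    (CompletedTensor B (varIdeal k σ₁) (varIdeal k σ₂) M N) :=
  toRestrict _ (CompletedTensor.tmul B _ _ x y)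

theorem complTmul_add_left (x x' : M) (y : N) :
    complTmul c ha (x + x') y = complTmul c ha x y + complTmul c ha x' y :=
  (congrArg (AdicCompletion.of _ (ExtTensor B (MvPowerSeries σ₁ k) (MvPowerSeries σ₂ k) M N))
    (TensorProduct.add_tmul x x' y)).trans (map_add _ _ _)

theorem complTmul_add_right (x : M) (y y' : N) :
    complTmul c ha x (y + y') = complTmul c ha x y + complTmul c ha x y' :=
  (congrArg (AdicCompletion.of _ (ExtTensor B (MvPowerSeries σ₁ k) (MvPowerSeries σ₂ k) M N))
    (TensorProduct.tmul_add x y y')).trans (map_add _ _ _)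

variable (c) in
/-- The map `f ⊗̂ g` over `k⟦σ⟧`. -/
def complMap (f : M →ₗ[MvPowerSeries σ₁ k] M') (g : N →ₗ[MvPowerSeries σ₂ k] N') :
    Restrict (psMap _ c a ha) (CompletedTensor B (varIdeal k σ₁) (varIdeal k σ₂) M N)
      →ₗ[MvPowerSeries σ k]
    Restrict (psMap _ c a ha) (CompletedTensor B (varIdeal k σ₁) (varIdeal k σ₂) M' N') :=
  restrictMap _ (CompletedTensor.map B _ _ f g)

theorem complMap_complTmul (f : M →ₗ[MvPowerSeries σ₁ k] M') (g : N →ₗ[MvPowerSeries σ₂ k] N')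
    (x : M) (y : N) : complMap c ha f g (complTmul c ha x y) = complTmul c ha (f x) (g y) := by
  change AdicCompletion.map _ (ExtTensor.map B f g) (AdicCompletion.of _ _ _) = _
  rw [AdicCompletion.map_of]
  rfl

theorem complMap_surjective {f : M →ₗ[MvPowerSeries σ₁ k] M'} {g : N →ₗ[MvPowerSeries σ₂ k] N'}
    (hf : Function.Surjective f) (hg : Function.Surjective g) :
    Function.Surjective (complMap c ha f g) :=
  AdicCompletion.map_surjective _ (ExtTensor.map_surjective (B := B) hf hg)

variable [Finite σ₁] [Finite σ₂] {e₁ : σ₁ → σ} {e₂ : σ₂ → σ} (h : IsPresentation e₁ e₂ c a)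

include h in
theorem complTmul_smul_left (r : MvPowerSeries σ₁ k) (x : M) (y : N) :
    complTmul c ha (r • x) y = MvPowerSeries.rename e₁ r • complTmul c ha x y := by
  change _ = psMap _ c a ha (MvPowerSeries.rename e₁ r) •
    AdicCompletion.of _ (ExtTensor B (MvPowerSeries σ₁ k) (MvPowerSeries σ₂ k) M N)
      (ExtTensor.tmul B x y)
  rw [h.psMap_rename_left ha, of_smul_of, ExtTensor.smul_tmul, one_smul]
  rfl

include h in
theorem complTmul_smul_right (r : MvPowerSeries σ₂ k) (x : M) (y : N) :
    complTmul c ha x (r • y) = MvPowerSeries.rename e₂ r • complTmul c ha x y := by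
  change _ = psMap _ c a ha (MvPowerSeries.rename e₂ r) •
    AdicCompletion.of _ (ExtTensor B (MvPowerSeries σ₁ k) (MvPowerSeries σ₂ k) M N)
      (ExtTensor.tmul B x y)
  rw [h.psMap_rename_right ha, of_smul_of, ExtTensor.smul_tmul, one_smul]
  rfl

include h in
theorem exists_basis_complTmul {ι κ : Type*} [Finite ι] [Finite κ]
    (b : Module.Basis ι (MvPowerSeries σ₁ k) M) (b' : Module.Basis κ (MvPowerSeries σ₂ k) N) :
    ∃ β : Module.Basis (ι × κ) (MvPowerSeries σ k) (Restrict (psMap _ c a ha)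
        (CompletedTensor B (varIdeal k σ₁) (varIdeal k σ₂) M N)),
      ∀ i j, β (i, j) = complTmul c ha (b i) (b' j) := by
  obtain ⟨β₁, h₁⟩ := exists_basis_extTensor (B := B) b b'
  obtain ⟨β₂, h₂⟩ := exists_basis_adicCompletion
    (tensorIdeal B (varIdeal k σ₁) (varIdeal k σ₂)) β₁
  obtain ⟨β₃, h₃⟩ := exists_basis_restrict_of_bijective _ (h.psMap_bijective ha) β₂
  refine ⟨β₃, fun i j => ?_⟩
  rw [h₃, h₂, h₁]
  rfl

include h in
-- Exactness of completion is avoided, as the tensor product of rings need not be Noetherian. The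
-- coordinates of a kernel element are shown to lie in the ideal of `t` plus `varIdeal ^ j` for
-- every `j`, and Krull's theorem in `k⟦σ⟧` removes the second term.
theorem ker_complMap {f : M →ₗ[MvPowerSeries σ₁ k] M'} {g : N →ₗ[MvPowerSeries σ₂ k] N'}
    (hf : Function.Surjective f) (hg : Function.Surjective g) {τ : Type*} (t : τ → B)
    (hkf : LinearMap.ker f =
      Ideal.span (Set.range fun i => algebraMap B (MvPowerSeries σ₁ k) (t i)) • ⊤)
    (hkg : LinearMap.ker g =
      Ideal.span (Set.range fun i => algebraMap B (MvPowerSeries σ₂ k) (t i)) • ⊤)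
    {ι κ : Type*} [Finite ι] [Finite κ]
    (b : Module.Basis ι (MvPowerSeries σ₁ k) M) (b' : Module.Basis κ (MvPowerSeries σ₂ k) N) :
    LinearMap.ker (complMap c ha f g) = Ideal.span (Set.range fun i =>
      MvPowerSeries.rename (R := k) e₁ (algebraMap B _ (t i))) • ⊤ := by
  set I := tensorIdeal B (varIdeal k σ₁) (varIdeal k σ₂) with hI
  set ρ := psMap I c a ha with hρ
  let A := MvPowerSeries σ₁ k ⊗[B] MvPowerSeries σ₂ k
  apply le_antisymm
  · intro x hx
    obtain ⟨β₁, h₁⟩ := exists_basis_extTensor (B := B) b b'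
    obtain ⟨β₂, h₂⟩ := exists_basis_adicCompletion I β₁
    obtain ⟨β, hβ⟩ := exists_basis_restrict_of_bijective ρ (h.psMap_bijective ha) β₂
    rw [mem_ideal_smul_top_iff_repr β]
    intro i
    refine mem_of_forall_mem_sup_pow _ _ fun j => ?_
    rw [maximalIdeal_eq_varIdeal]
    -- An approximation `z` of `x` modulo `I ^ j` in the uncompleted tensor product; its image under
    -- `f ⊗ g` is only divisible by `I ^ j`.
    choose s hs using fun i => Ideal.Quotient.mk_surjective (psMapMod I c a ha j (β.repr x i))
    have := Fintype.ofFinite (ι × κ)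
    let z : ExtTensor B (MvPowerSeries σ₁ k) (MvPowerSeries σ₂ k) M N := ∑ i, s i • β₁ i
    have hx' : (toRestrict ρ).symm x = ∑ i, ρ (β.repr x i) • AdicCompletion.of I _ (β₁ i) := by
      conv_lhs => rw [← β.sum_repr x, map_sum]
      refine Finset.sum_congr rfl fun i _ => ?_
      rw [hβ, h₂]
      rfl
    have hz : ((toRestrict ρ).symm x).val j = Submodule.Quotient.mk z := by
      rw [hx']
      exact val_sum_psMap_smul I c a ha _ _ _ j hs
    have hzk : ExtTensor.map B f g z ∈ I ^ j • (⊤ : Submodule A _) := by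
      rw [← Submodule.Quotient.mk_eq_zero]
      have h0 : AdicCompletion.map I (ExtTensor.map B f g) ((toRestrict ρ).symm x) = 0 := hx
      have h1 := congrArg (fun y => y.val j) h0
      simp only [AdicCompletion.map_val_apply, hz] at h1
      exact h1
    have hl : ∀ r ∈ Ideal.span (Set.range fun i => algebraMap B (MvPowerSeries σ₁ k) (t i)),
        r ⊗ₜ[B] (1 : MvPowerSeries σ₂ k) ∈ Ideal.span (Set.range fun i =>
          algebraMap B (MvPowerSeries σ₁ k) (t i) ⊗ₜ[B] (1 : MvPowerSeries σ₂ k)) := by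
      intro r hr
      have := Ideal.mem_map_of_mem (Algebra.TensorProduct.includeLeft (S := B) :
        _ →ₐ[B] MvPowerSeries σ₁ k ⊗[B] MvPowerSeries σ₂ k) hr
      rw [Ideal.map_span, ← Set.range_comp] at this
      exact this
    have hr : ∀ r ∈ Ideal.span (Set.range fun i => algebraMap B (MvPowerSeries σ₂ k) (t i)),
        (1 : MvPowerSeries σ₁ k) ⊗ₜ[B] r ∈ Ideal.span (Set.range fun i =>
          algebraMap B (MvPowerSeries σ₁ k) (t i) ⊗ₜ[B] (1 : MvPowerSeries σ₂ k)) := by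
      intro r hr
      have := Ideal.mem_map_of_mem (Algebra.TensorProduct.includeRight :
        _ →ₐ[B] MvPowerSeries σ₁ k ⊗[B] MvPowerSeries σ₂ k) hr
      rw [Ideal.map_span, ← Set.range_comp] at this
      refine (Ideal.span_mono ?_ : _ ≤ _) this
      rintro _ ⟨i, rfl⟩
      refine ⟨i, ?_⟩
      exact (Algebra.TensorProduct.algebraMap_apply (S := B) (t i)).symm.trans
        (Algebra.TensorProduct.algebraMap_apply' (t i))
    have h3 := ExtTensor.repr_mem_of_map_mem hl hr hf hg hkf.le hkg.le β₁ hzk i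
    rw [β₁.repr_sum_self] at h3
    have h4 := Ideal.mem_map_of_mem (Ideal.Quotient.mk (I ^ j)) h3
    rw [Ideal.map_sup, Ideal.map_quotient_self, sup_bot_eq, hs, Ideal.map_span, ← Set.range_comp]
      at h4
    have h5 : (⇑(Ideal.Quotient.mk (I ^ j)) ∘ fun i =>
        algebraMap B (MvPowerSeries σ₁ k) (t i) ⊗ₜ[B] (1 : MvPowerSeries σ₂ k)) =
        psMapMod I c a ha j ∘ fun i =>
          MvPowerSeries.rename (R := k) e₁ (algebraMap B _ (t i)) := by
      funext i
      exact (h.psMapMod_rename_left ha j _).symm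
    -- Back to `k⟦σ⟧` through the isomorphism with the tensor product modulo `j`-th powers.
    rw [h5, Set.range_comp, ← Ideal.map_span,
      Ideal.mem_map_iff_of_surjective _ (h.psMapMod_surjective ha j)] at h4
    obtain ⟨r, hr, hrr⟩ := h4
    rw [← sub_add_cancel (β.repr x i) r, add_comm]
    refine Submodule.add_mem_sup hr ?_
    rw [← h.psMapMod_eq_zero_iff ha, map_sub, hrr, sub_self]
  · rw [Submodule.smul_le]
    intro r hr x _
    rw [LinearMap.mem_ker, map_smul]
    generalize complMap c ha f g x = y
    induction hr using Submodule.span_induction with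
    | zero => exact zero_smul _ _
    | add r s _ _ h1 h2 => rw [add_smul, h1, h2, add_zero]
    | smul r s _ h1 => rw [smul_assoc, h1, smul_zero]
    | mem r hr =>
      obtain ⟨i, rfl⟩ := hr
      change ρ (MvPowerSeries.rename e₁ (algebraMap B _ (t i))) • ((toRestrict ρ).symm y) = 0
      rw [hρ, h.psMap_rename_left ha]
      -- Since `t i` kills `M'`, it kills the tensor product, and hence every Cauchy sequence in it.
      have h0 : ∀ w : ExtTensor B (MvPowerSeries σ₁ k) (MvPowerSeries σ₂ k) M' N',
          (algebraMap B (MvPowerSeries σ₁ k) (t i) ⊗ₜ[B] (1 : MvPowerSeries σ₂ k)) • w = 0 := by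
        intro w
        change extAction B _ (w : M' ⊗[B] N') = 0
        change M' ⊗[B] N' at w
        induction w with
        | zero => exact map_zero _
        | add x y hx hy => rw [map_add, hx, hy, add_zero]
        | tmul x y =>
          obtain ⟨x, rfl⟩ := hf x
          have h2 : algebraMap B (MvPowerSeries σ₁ k) (t i) • x ∈ LinearMap.ker f := by
            rw [hkf]
            exact Submodule.smul_mem_smul (Ideal.subset_span ⟨i, rfl⟩) Submodule.mem_top
          rw [extAction_tmul, ← map_smul, LinearMap.mem_ker.mp h2, TensorProduct.zero_tmul]
      induction (toRestrict ρ).symm y using AdicCompletion.induction_on with | _ y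
      ext l
      exact congrArg (Submodule.Quotient.mk (p := (I ^ l • ⊤ : Submodule A _))) (h0 (y l))

end CompletedReduction


/-! ### Biadditive maps determined on bases -/

section Bisemilinear

/-- A biadditive map that is semilinear in both variables. -/
structure IsBisemilinear {A₁ A₂ R M N Z : Type*} [CommRing A₁] [CommRing A₂] [CommRing R]
    [AddCommGroup M] [AddCommGroup N] [AddCommGroup Z] [Module A₁ M] [Module A₂ N] [Module R Z]
    (r₁ : A₁ → R) (r₂ : A₂ → R) (P : M → N → Z) : Prop where
  add_left : ∀ x x' y, P (x + x') y = P x y + P x' y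
  add_right : ∀ x y y', P x (y + y') = P x y + P x y'
  smul_left : ∀ a x y, P (a • x) y = r₁ a • P x y
  smul_right : ∀ a x y, P x (a • y) = r₂ a • P x y

namespace IsBisemilinear

variable {A₁ A₂ R M N Z Z' : Type*} [CommRing A₁] [CommRing A₂] [CommRing R]
  [AddCommGroup M] [AddCommGroup N] [AddCommGroup Z] [AddCommGroup Z'] [Module A₁ M] [Module A₂ N]
  [Module R Z] [Module R Z'] {r₁ : A₁ → R} {r₂ : A₂ → R} {P Q : M → N → Z}
  (hP : IsBisemilinear r₁ r₂ P) (hQ : IsBisemilinear r₁ r₂ Q)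

include hP

theorem map_zero_left (y : N) : P 0 y = 0 := by
  have h := hP.add_left 0 0 y
  rw [add_zero] at h
  exact left_eq_add.mp h

theorem map_zero_right (x : M) : P x 0 = 0 := by
  have h := hP.add_right x 0 0
  rw [add_zero] at h
  exact left_eq_add.mp h

theorem comp (f : Z →ₗ[R] Z') : IsBisemilinear r₁ r₂ fun x y => f (P x y) where
  add_left x x' y := by rw [hP.add_left, map_add]
  add_right x y y' := by rw [hP.add_right, map_add]
  smul_left a x y := by rw [hP.smul_left, map_smul]
  smul_right a x y := by rw [hP.smul_right, map_smul]

include hQ in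
theorem eq_of_basis {ι κ : Type*} (b : Module.Basis ι A₁ M) (b' : Module.Basis κ A₂ N)
    (h : ∀ i j, P (b i) (b' j) = Q (b i) (b' j)) (x : M) (y : N) : P x y = Q x y := by
  induction b.mem_span x using Submodule.span_induction with
  | zero => rw [hP.map_zero_left, hQ.map_zero_left]
  | add x x' _ _ h h' => rw [hP.add_left, hQ.add_left, h, h']
  | smul a x _ h => rw [hP.smul_left, hQ.smul_left, h]
  | mem x hx =>
    obtain ⟨i, rfl⟩ := hx
    induction b'.mem_span y using Submodule.span_induction with
    | zero => rw [hP.map_zero_right, hQ.map_zero_right]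
    | add y y' _ _ h h' => rw [hP.add_right, hQ.add_right, h, h']
    | smul a y _ h => rw [hP.smul_right, hQ.smul_right, h]
    | mem y hy =>
      obtain ⟨j, rfl⟩ := hy
      exact h i j

end IsBisemilinear

end Bisemilinear

/-! ### Reduction of `F ⊠ E` modulo `t` -/

section Reduction

variable {k : Type u} [Field k] {n m p : ℕ}
  {F : Type w} [AddCommGroup F] [Module (MvPowerSeries (Fin m ⊕ Fin p) k) F]
  [Module k F] [IsScalarTower k (MvPowerSeries (Fin m ⊕ Fin p) k) F]
  {E : Type v} [AddCommGroup E] [Module (MvPowerSeries (Fin n ⊕ Fin m) k) E]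
  [Module k E] [IsScalarTower k (MvPowerSeries (Fin n ⊕ Fin m) k) E]
  {V : MvPowerSeries (Fin m) k}
  {DE : OddEnd (MvPowerSeries (Fin n ⊕ Fin m) k) E}
  {DF : OddEnd (MvPowerSeries (Fin m ⊕ Fin p) k) F}

theorem isBisemilinear_boxTmul : IsBisemilinear (R := MvPowerSeries (Fin n ⊕ Fin m ⊕ Fin p) k)
    (MvPowerSeries.rename (R := k) (Sum.inr : Fin m ⊕ Fin p → Fin n ⊕ Fin m ⊕ Fin p))
    (MvPowerSeries.rename (R := k) (Sum.map id Sum.inl))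
    (boxTmul : F → E → Box k n m p F E) where
  add_left f f' e := by
    have h := extIn_add (rhoF k n m p) f f'
    exact (congrArg (· ⊗ₜ _) h).trans (TensorProduct.add_tmul _ _ _)
  add_right f e e' := by
    have h := extIn_add (rhoE k n m p) e e'
    exact (congrArg (_ ⊗ₜ ·) h).trans (TensorProduct.tmul_add _ _ _)
  smul_left a f e := by
    have h := smul_extIn (rhoF k n m p) (rhoF_rename k n m p a) f
    exact (congrArg (· ⊗ₜ _) h.symm).trans (TensorProduct.smul_tmul' _ _ _).symm
  smul_right a f e := by
    have h := smul_extIn (rhoE k n m p) (rhoE_rename k n m p a) e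
    exact (congrArg (_ ⊗ₜ ·) h.symm).trans (TensorProduct.tmul_smul _ _ _)

theorem box_G_boxTmul (f : F) (e : E) :
    (box DF DE).G (boxTmul f e : Box k n m p F E) = boxTmul (DF.G f) (DE.G e) :=
  congrArg₂ (· ⊗ₜ[MvPowerSeries (Fin n ⊕ Fin m ⊕ Fin p) k] ·)
    (extMap_extIn (rhoF k n m p) DF.G f) (extMap_extIn (rhoE k n m p) DE.G e)

theorem box_d_boxTmul (f : F) (e : E) :
    (box DF DE).d (boxTmul f e : Box k n m p F E) =
      boxTmul (DF.d f) e + boxTmul (DF.G f) (DE.d e) :=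
  congrArg₂ (· + ·)
    (congrArg (· ⊗ₜ[MvPowerSeries (Fin n ⊕ Fin m ⊕ Fin p) k] extIn (rhoE k n m p) e)
      (extOddEnd_d_extIn (rhoF k n m p) DF f))
    (congrArg₂ (· ⊗ₜ[MvPowerSeries (Fin n ⊕ Fin m ⊕ Fin p) k] ·)
      (extMap_extIn (rhoF k n m p) DF.G f) (extOddEnd_d_extIn (rhoE k n m p) DE e))

variable [Module (MvPowerSeries (Fin m) k) F]
  [IsScalarTower (MvPowerSeries (Fin m) k) (MvPowerSeries (Fin m ⊕ Fin p) k) F]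
  [Module (MvPowerSeries (Fin m) k) E]
  [IsScalarTower (MvPowerSeries (Fin m) k) (MvPowerSeries (Fin n ⊕ Fin m) k) E]

omit [Module k F] [IsScalarTower k (MvPowerSeries (Fin m ⊕ Fin p) k) F] [Module k E]
  [IsScalarTower k (MvPowerSeries (Fin n ⊕ Fin m) k) E] in
theorem quotTensorXYZ_G_quotTmul (f : F) (e : E) :
    (quotTensorXYZ V DF DE).G (quotTmul V f e : QuotTensor n p F E V) =
      quotTmul V (DF.G f) (DE.G e) :=
  AdicCompletion.map_of _ _ _

omit [Module k F] [IsScalarTower k (MvPowerSeries (Fin m ⊕ Fin p) k) F] [Module k E]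
  [IsScalarTower k (MvPowerSeries (Fin n ⊕ Fin m) k) E] in
theorem quotTensorXYZ_d_quotTmul (f : F) (e : E) :
    (quotTensorXYZ V DF DE).d (quotTmul V f e : QuotTensor n p F E V) =
      quotTmul V (DF.d f) e + quotTmul V (DF.G f) (DE.d e) :=
  congrArg₂ (· + ·) (AdicCompletion.map_of _ _ _) (AdicCompletion.map_of _ _ _)

variable [Module.Free (MvPowerSeries (Fin n ⊕ Fin m) k) E]
  [Module.Finite (MvPowerSeries (Fin n ⊕ Fin m) k) E]
  [Module.Free (MvPowerSeries (Fin m ⊕ Fin p) k) F]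
  [Module.Finite (MvPowerSeries (Fin m ⊕ Fin p) k) F]

theorem tSeqXYZ_eq (V : MvPowerSeries (Fin m) k) (i : Fin m) :
    tSeqXYZ n p V i = MvPowerSeries.rename (R := k) (Sum.inr : Fin m ⊕ Fin p → _)
      (algebraMap (MvPowerSeries (Fin m) k) _ (tSeq V i)) :=
  (MvPowerSeries.rename_rename _ _ _).symm

variable (n p F E V) in
-- `F ⊠ E` and `F ⊗̂_{k⟦y⟧} E` are both free over `k⟦x, y, z⟧` on the tensors of basis elements,
-- which identifies them compatibly with all pure tensors. Then `ker_complMap` applies to the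
-- reduction of the second module.
theorem exists_isReduction : ∃ γ : Box k n m p F E →ₗ[MvPowerSeries (Fin n ⊕ Fin m ⊕ Fin p) k]
    QuotTensor n p F E V, IsReduction V γ := by
  let bF := Module.Free.chooseBasis (MvPowerSeries (Fin m ⊕ Fin p) k) F
  let bE := Module.Free.chooseBasis (MvPowerSeries (Fin n ⊕ Fin m) k) E
  obtain ⟨β, hβ⟩ := exists_basis_box (n := n) bF bE
  let B := MvPowerSeries (Fin m) k
  let C := Restrict (rhoFE k n m p) (CompletedTensor B (varIdeal k (Fin m ⊕ Fin p))
    (varIdeal k (Fin n ⊕ Fin m)) F E)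
  have hpres := isPresentation_rhoFE k n m p
  obtain ⟨β', hβ'⟩ : ∃ β' : Module.Basis _ (MvPowerSeries (Fin n ⊕ Fin m ⊕ Fin p) k) C,
      ∀ i j, β' (i, j) = complTmul _ _ (bF i) (bE j) :=
    exists_basis_complTmul _ hpres bF bE
  let e := β.equiv β' (Equiv.refl _)
  have hP : IsBisemilinear (R := MvPowerSeries (Fin n ⊕ Fin m ⊕ Fin p) k)
      (MvPowerSeries.rename (R := k) (Sum.inr : Fin m ⊕ Fin p → Fin n ⊕ Fin m ⊕ Fin p))
      (MvPowerSeries.rename (R := k) (Sum.map id Sum.inl))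
      (fun (f : F) (x : E) => (complTmul _ _ f x : C)) :=
    { add_left := fun f f' x => complTmul_add_left _ f f' x
      add_right := fun f x x' => complTmul_add_right _ f x x'
      smul_left := fun a f x => complTmul_smul_left _ hpres a f x
      smul_right := fun a f x => complTmul_smul_right _ hpres a f x }
  have he : ∀ (f : F) (x : E), e (boxTmul f x) = complTmul _ _ f x := by
    refine (isBisemilinear_boxTmul.comp e.toLinearMap).eq_of_basis hP bF bE fun i j => ?_
    rw [LinearEquiv.coe_coe, ← hβ, Module.Basis.equiv_apply, Equiv.refl_apply, hβ']
  let π : C →ₗ[MvPowerSeries (Fin n ⊕ Fin m ⊕ Fin p) k] QuotTensor n p F E V :=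
    complMap _ _ (Submodule.mkQ _) (Submodule.mkQ _)
  have hker : LinearMap.ker π = Ideal.span (Set.range (tSeqXYZ n p V)) • ⊤ := by
    rw [funext (tSeqXYZ_eq V)]
    exact ker_complMap _ hpres (Submodule.mkQ_surjective _) (Submodule.mkQ_surjective _) (tSeq V)
      (Submodule.ker_mkQ _) (Submodule.ker_mkQ _) bF bE
  refine ⟨π ∘ₗ e, fun f x => ?_, ?_, ?_⟩
  · rw [LinearMap.comp_apply, LinearEquiv.coe_coe, he]
    exact complMap_complTmul _ _ _ _ _
  · exact (complMap_surjective _ (Submodule.mkQ_surjective _)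
      (Submodule.mkQ_surjective _)).comp e.surjective
  · rw [LinearMap.ker_comp, hker]
    refine (Submodule.map_equiv_eq_comap_symm e.symm _).symm.trans ?_
    rw [Submodule.map_smul'', Submodule.map_top, LinearEquiv.range]

variable {γ : Box k n m p F E →ₗ[MvPowerSeries (Fin n ⊕ Fin m ⊕ Fin p) k] QuotTensor n p F E V}

theorem IsReduction.map_G (hγ : IsReduction V γ) (x : Box k n m p F E) :
    γ ((box DF DE).G x) = (quotTensorXYZ V DF DE).G (γ x) := by
  obtain ⟨β, hβ⟩ := exists_basis_box (n := n) (Module.Free.chooseBasis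
    (MvPowerSeries (Fin m ⊕ Fin p) k) F)
    (Module.Free.chooseBasis (MvPowerSeries (Fin n ⊕ Fin m) k) E)
  refine LinearMap.congr_fun (f := γ ∘ₗ (box DF DE).G) (g := (quotTensorXYZ V DF DE).G ∘ₗ γ)
    (β.ext fun ⟨i, j⟩ => ?_) x
  rw [LinearMap.comp_apply, LinearMap.comp_apply, hβ, box_G_boxTmul, hγ.apply_tmul, hγ.apply_tmul,
    quotTensorXYZ_G_quotTmul]

theorem IsReduction.map_d (hγ : IsReduction V γ) (x : Box k n m p F E) :
    γ ((box DF DE).d x) = (quotTensorXYZ V DF DE).d (γ x) := by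
  obtain ⟨β, hβ⟩ := exists_basis_box (n := n) (Module.Free.chooseBasis
    (MvPowerSeries (Fin m ⊕ Fin p) k) F)
    (Module.Free.chooseBasis (MvPowerSeries (Fin n ⊕ Fin m) k) E)
  refine LinearMap.congr_fun (f := γ ∘ₗ (box DF DE).d) (g := (quotTensorXYZ V DF DE).d ∘ₗ γ)
    (β.ext fun ⟨i, j⟩ => ?_) x
  rw [LinearMap.comp_apply, LinearMap.comp_apply, hβ, box_d_boxTmul, map_add, hγ.apply_tmul,
    hγ.apply_tmul, hγ.apply_tmul, quotTensorXYZ_d_quotTmul]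

end Reduction


/-! ### Powers of the Atiyah class of a connection over a polynomial ring -/

section AtiyahPower

variable {S : Type*} [CommRing S] {m : ℕ} {M : Type*} [AddCommGroup M]
  [Module (MvPolynomial (Fin m) S) M]

/-- The `j`-th coordinate `M ⊗ Ω¹ → M`. -/
def kaehlerCoord (S M : Type*) [CommRing S] {m : ℕ} [AddCommGroup M]
    [Module (MvPolynomial (Fin m) S) M] (j : Fin m) :
    M ⊗[MvPolynomial (Fin m) S] Ω[MvPolynomial (Fin m) S⁄S] →ₗ[MvPolynomial (Fin m) S] M :=
  (TensorProduct.rid (MvPolynomial (Fin m) S) M).toLinearMap ∘ₗ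
    ((KaehlerDifferential.mvPolynomialBasis S (Fin m)).coord j).lTensor M

theorem kaehlerCoord_tmul (j : Fin m) (x : M) (ω : Ω[MvPolynomial (Fin m) S⁄S]) :
    kaehlerCoord S M j (x ⊗ₜ ω) =
      (KaehlerDifferential.mvPolynomialBasis S (Fin m)).repr ω j • x := by
  simp [kaehlerCoord]

theorem kaehlerCoord_tmul_D (j : Fin m) (x : M) (a : MvPolynomial (Fin m) S) :
    kaehlerCoord S M j (x ⊗ₜ KaehlerDifferential.D S _ a) = MvPolynomial.pderiv j a • x := by
  rw [kaehlerCoord_tmul, KaehlerDifferential.mvPolynomialBasis_repr_apply]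

theorem sum_kaehlerCoord
    (w : M ⊗[MvPolynomial (Fin m) S] Ω[MvPolynomial (Fin m) S⁄S]) :
    ∑ j, kaehlerCoord S M j w ⊗ₜ KaehlerDifferential.D S (MvPolynomial (Fin m) S)
      (MvPolynomial.X j) = w := by
  induction w with
  | zero => simp
  | add w w' h h' =>
    conv_rhs => rw [← h, ← h']
    simp only [map_add, TensorProduct.add_tmul, Finset.sum_add_distrib]
  | tmul x ω =>
    conv_rhs => rw [← (KaehlerDifferential.mvPolynomialBasis S (Fin m)).sum_repr ω]
    rw [TensorProduct.tmul_sum]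
    refine Finset.sum_congr rfl fun j _ => ?_
    rw [kaehlerCoord_tmul, TensorProduct.smul_tmul, KaehlerDifferential.mvPolynomialBasis_apply]

theorem kaehlerCoord_rTensor (f : M →ₗ[MvPolynomial (Fin m) S] M) (j : Fin m)
    (w : M ⊗[MvPolynomial (Fin m) S] Ω[MvPolynomial (Fin m) S⁄S]) :
    kaehlerCoord S M j (f.rTensor _ w) = f (kaehlerCoord S M j w) := by
  induction w with
  | zero => simp
  | add w w' h h' => rw [map_add, map_add, h, h', map_add, map_add]
  | tmul x ω => rw [LinearMap.rTensor_tmul, kaehlerCoord_tmul, kaehlerCoord_tmul, map_smul]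

namespace Connection

variable (N : Connection S (MvPolynomial (Fin m) S) M) (D : OddEnd (MvPolynomial (Fin m) S) M)

/-- The component `∇_{∂/∂t_j}` of a connection. -/
def component (j : Fin m) : M →+ M := (kaehlerCoord S M j).toAddMonoidHom.comp N.nabla

theorem component_smul (j : Fin m) (a : MvPolynomial (Fin m) S) (x : M) :
    N.component j (a • x) = a • N.component j x + MvPolynomial.pderiv j a • x := by
  change kaehlerCoord S M j _ = a • kaehlerCoord S M j _ + _
  rw [N.leibniz, map_add, map_smul, kaehlerCoord_tmul_D]

theorem component_G (hN : N.IsEven D) (j : Fin m) (x : M) :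
    N.component j (D.G x) = D.G (N.component j x) := by
  change kaehlerCoord S M j _ = D.G (kaehlerCoord S M j _)
  rw [hN, kaehlerCoord_rTensor]

/-- The component of the Atiyah class. -/
def atiyahComponent (j : Fin m) : Module.End (MvPolynomial (Fin m) S) M :=
  kaehlerCoord S M j ∘ₗ N.atiyah D

theorem atiyahComponent_apply (j : Fin m) (x : M) :
    N.atiyahComponent D j x = D.d (N.component j x) - N.component j (D.d x) := by
  change kaehlerCoord S M j (_ - _) = D.d (kaehlerCoord S M j _) - kaehlerCoord S M j _
  rw [map_sub, kaehlerCoord_rTensor]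

theorem atiyahWedge_tmul (x : M) (ω : ExteriorAlgebra (MvPolynomial (Fin m) S)
    (Ω[MvPolynomial (Fin m) S⁄S])) :
    N.atiyahWedge D (x ⊗ₜ ω) = ∑ j, N.atiyahComponent D j x ⊗ₜ
      (ExteriorAlgebra.ι _ (KaehlerDifferential.D S _ (MvPolynomial.X j)) * ω) := by
  have h := sum_kaehlerCoord (N.atiyah D x)
  simp only [atiyahWedge, LinearMap.comp_apply, LinearMap.rTensor_tmul, LinearEquiv.coe_coe]
  rw [← h, TensorProduct.sum_tmul, map_sum, map_sum]
  rfl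

/-- Each further factor enters on the left both of the operators and of the forms, so the two orders
agree. -/
theorem atiyahWedge_pow (r : ℕ) (x : M) :
    (N.atiyahWedge D ^ r) (x ⊗ₜ 1) = ∑ f : Fin r → Fin m,
      (List.ofFn fun i => N.atiyahComponent D (f i)).prod x ⊗ₜ
        ExteriorAlgebra.ιMulti (MvPolynomial (Fin m) S) r
          fun i => KaehlerDifferential.D S _ (MvPolynomial.X (f i)) := by
  induction r with
  | zero => simp
  | succ r ih =>
    rw [pow_succ', Module.End.mul_apply, ih, map_sum,
      ← (Fin.consEquiv fun _ : Fin (r + 1) => Fin m).sum_comp, Fintype.sum_prod_type,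
      Finset.sum_comm]
    refine Finset.sum_congr rfl fun f _ => ?_
    rw [atiyahWedge_tmul]
    refine Finset.sum_congr rfl fun j _ => ?_
    rw [ExteriorAlgebra.ιMulti_succ_apply, List.ofFn_succ, List.prod_cons]
    rfl

/-- The antisymmetrised product of the components of the Atiyah class. -/
def atiyahPower : Module.End (MvPolynomial (Fin m) S) M :=
  ∑ π : Equiv.Perm (Fin m),
    Equiv.Perm.sign π • (List.ofFn fun i => N.atiyahComponent D (π i)).prod

/-- A repeated index makes the form vanish, so only permutations contribute, and reordering their
forms to `dt₁ ∧ ⋯ ∧ dt_m` produces the signs. -/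
theorem isAtiyahPower_atiyahPower : N.IsAtiyahPower D (N.atiyahPower D) := by
  intro x
  rw [atiyahWedge_pow, atiyahPower, LinearMap.sum_apply, TensorProduct.sum_tmul]
  refine Finset.sum_of_injOn (fun π i => π i) (fun π _ π' _ h => Equiv.ext (congrFun h))
    (fun _ _ => Finset.mem_coe.mpr (Finset.mem_univ _)) (fun f _ hf => ?_) fun π _ => ?_
  · have hinj : ¬ Function.Injective f := fun hinj => hf
      ⟨Equiv.ofBijective f (Finite.injective_iff_bijective.mp hinj),
        Finset.mem_coe.mpr (Finset.mem_univ _), rfl⟩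
    have h0 : ExteriorAlgebra.ιMulti (MvPolynomial (Fin m) S) m (fun i =>
        KaehlerDifferential.D S (MvPolynomial (Fin m) S) (MvPolynomial.X (f i))) = 0 := by
      refine AlternatingMap.map_eq_zero_of_not_injective _ _ fun h => hinj fun i j hij => h ?_
      exact congrArg (fun l => KaehlerDifferential.D S _ (MvPolynomial.X l)) hij
    rw [h0, TensorProduct.tmul_zero]
  · have h1 := AlternatingMap.map_perm (ExteriorAlgebra.ιMulti (MvPolynomial (Fin m) S) m)
      (fun j => KaehlerDifferential.D S (MvPolynomial (Fin m) S) (MvPolynomial.X j)) π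
    refine Eq.trans ?_ (congrArg (TensorProduct.tmul _ _) h1.symm)
    rw [Units.smul_def, Units.smul_def, LinearMap.smul_apply, TensorProduct.tmul_smul,
      TensorProduct.smul_tmul']
    rfl

/-- The Leibniz rule need only be known for constants and variables; it extends to polynomials by
induction. -/
theorem exists_of_components {Nc : Fin m → M →+ M}
    (hC : ∀ j (s : S) x, Nc j ((MvPolynomial.C s : MvPolynomial (Fin m) S) • x) =
      (MvPolynomial.C s : MvPolynomial (Fin m) S) • Nc j x)
    (hX : ∀ j x, Nc j (MvPolynomial.X (R := S) j • x) = MvPolynomial.X (R := S) j • Nc j x + x)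
    (hX' : ∀ i j x, i ≠ j →
      Nc j (MvPolynomial.X (R := S) i • x) = MvPolynomial.X (R := S) i • Nc j x)
    (hG : ∀ j x, Nc j (D.G x) = D.G (Nc j x)) :
    ∃ N : Connection S (MvPolynomial (Fin m) S) M, N.IsEven D := by
  have hL : ∀ j (a : MvPolynomial (Fin m) S) x,
      Nc j (a • x) = a • Nc j x + MvPolynomial.pderiv j a • x := by
    intro j a
    induction a using MvPolynomial.induction_on with
    | C s => intro x; rw [hC, MvPolynomial.pderiv_C, zero_smul, add_zero]
    | add a b ha hb =>
      intro x
      rw [add_smul, map_add, ha, hb, map_add, add_smul, add_smul]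
      abel
    | mul_X a i ha =>
      intro x
      rw [mul_smul, ha, Derivation.leibniz, smul_eq_mul, smul_eq_mul, add_smul, mul_smul, mul_smul,
        mul_comm (MvPolynomial.X i), mul_smul]
      by_cases hij : i = j
      · subst hij
        rw [hX, MvPolynomial.pderiv_X_self, one_smul, smul_add, add_assoc]
      · rw [hX' _ _ _ hij, MvPolynomial.pderiv_X_of_ne hij, zero_smul, smul_zero, zero_add]
  refine ⟨{
    nabla := ∑ j, ((TensorProduct.mk (MvPolynomial (Fin m) S) M _).flip (KaehlerDifferential.D S _
      (MvPolynomial.X j))).toAddMonoidHom.comp (Nc j)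
    map_base := fun s x => ?_
    leibniz := fun a x => ?_ }, fun x => ?_⟩
  · simp only [AddMonoidHom.finsetSum_apply, Finset.smul_sum]
    refine Finset.sum_congr rfl fun j _ => ?_
    exact (congrArg (· ⊗ₜ _) (hC j s x)).trans (TensorProduct.smul_tmul' _ _ _).symm
  · rw [← sum_kaehlerCoord (x ⊗ₜ KaehlerDifferential.D S (MvPolynomial (Fin m) S) a)]
    simp only [AddMonoidHom.finsetSum_apply, Finset.smul_sum]
    rw [← Finset.sum_add_distrib]
    refine Finset.sum_congr rfl fun j _ => ?_
    rw [kaehlerCoord_tmul_D]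
    refine (congrArg (· ⊗ₜ _) (hL j a x)).trans ?_
    rw [TensorProduct.add_tmul, ← TensorProduct.smul_tmul']
    rfl
  · simp only [AddMonoidHom.finsetSum_apply, map_sum]
    refine Finset.sum_congr rfl fun j _ => ?_
    exact congrArg (· ⊗ₜ _) (hG j x)

end Connection

end AtiyahPower


/-! ### Operators on power series -/

section Shift

variable {k σ τ : Type*} [Field k]

theorem coeff_rename_killCompl [Finite σ] (e : σ ↪ τ) (f : MvPowerSeries τ k) {x : τ →₀ ℕ}
    (hx : ∀ t ∉ Set.range e, x t = 0) :
    MvPowerSeries.coeff x (MvPowerSeries.rename e (MvPowerSeries.killCompl e f)) =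
      MvPowerSeries.coeff x f := by
  obtain ⟨y, rfl⟩ : x ∈ Set.range (Finsupp.embDomain e) := by
    refine ⟨x.comapDomain e e.injective.injOn, ?_⟩
    exact Finsupp.embDomain_comapDomain fun t ht => by_contra fun h =>
      (Finsupp.mem_support_iff.mp ht) (hx t h)
  rw [MvPowerSeries.coeff_embDomain_rename, MvPowerSeries.coeff_killCompl]

theorem X_dvd_sub_rename_killCompl [Finite σ] (s : σ) (f : MvPowerSeries σ k) :
    MvPowerSeries.X s ∣ f - MvPowerSeries.rename (Function.Embedding.subtype (· ≠ s))
      (MvPowerSeries.killCompl (Function.Embedding.subtype (· ≠ s)) f) := by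
  rw [MvPowerSeries.X_dvd_iff]
  intro x hx
  rw [map_sub, coeff_rename_killCompl, sub_self]
  intro t ht
  by_cases h : t = s
  · rw [h, hx]
  · exact absurd ⟨⟨t, h⟩, rfl⟩ ht

/-- Division by the variable `X s`, discarding the remainder. -/
theorem exists_shift [Finite σ] [Finite τ] (s : σ) (e : τ ↪ σ) (hs : s ∉ Set.range e) :
    ∃ H : MvPowerSeries σ k →+ MvPowerSeries σ k,
      (∀ f, H (MvPowerSeries.X s * f) = f) ∧
      (∀ t f, t ≠ s → H (MvPowerSeries.X t * f) = MvPowerSeries.X t * H f) ∧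
      ∀ g f, H (MvPowerSeries.rename e g * f) = MvPowerSeries.rename e g * H f := by
  set i := Function.Embedding.subtype (· ≠ s) with hi
  -- `ε` sets `X s` to zero, and `H f` is the quotient of `f - ε f` by `X s`.
  let ε : MvPowerSeries σ k →ₐ[k] MvPowerSeries σ k :=
    (MvPowerSeries.rename i).comp (MvPowerSeries.killCompl i)
  have hε : ∀ f, MvPowerSeries.X s ∣ f - ε f := X_dvd_sub_rename_killCompl s
  choose H hH using hε
  have hε1 : ε (MvPowerSeries.X s) = 0 := by
    rw [AlgHom.comp_apply, MvPowerSeries.killCompl_X_eq_zero, map_zero]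
    rintro ⟨t, ht⟩
    exact t.2 ht
  have hε2 : ∀ t ≠ s, ε (MvPowerSeries.X t) = MvPowerSeries.X t := fun t ht => by
    have h1 := MvPowerSeries.killCompl_X (R := k) (e := i) ⟨t, ht⟩
    have h2 := MvPowerSeries.rename_X (R := k) (f := i) ⟨t, ht⟩
    rw [AlgHom.comp_apply]
    exact (congrArg _ h1).trans h2
  have hε3 : ∀ g, ε (MvPowerSeries.rename e g) = MvPowerSeries.rename e g := fun g => by
    let e' : τ → {t // t ≠ s} := fun t => ⟨e t, fun h => hs ⟨t, h⟩⟩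
    have h1 : MvPowerSeries.rename e g = MvPowerSeries.rename (R := k) i
        (MvPowerSeries.rename e' g) := by
      rw [MvPowerSeries.rename_rename]
      rfl
    rw [h1, AlgHom.comp_apply, MvPowerSeries.killCompl_rename_app]
  have hX : (MvPowerSeries.X s : MvPowerSeries σ k) ≠ 0 := fun h => by
    have := congrArg (MvPowerSeries.coeff (Finsupp.single s 1)) h
    rw [MvPowerSeries.coeff_index_single_self_X, map_zero] at this
    exact one_ne_zero this
  -- The division is linear over the series that do not involve `X s`.
  have hmul : ∀ c f, ε c = c → H (c * f) = c * H f := fun c f hc => mul_left_cancel₀ hX (by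
    rw [← hH, map_mul, hc, ← mul_sub, hH, mul_left_comm])
  refine ⟨AddMonoidHom.mk' H fun f g => mul_left_cancel₀ hX ?_, fun f => ?_,
    fun t f ht => hmul _ _ (hε2 t ht), fun g f => hmul _ _ (hε3 g)⟩
  · rw [mul_add, ← hH, ← hH, ← hH, map_add, add_sub_add_comm]
  · refine mul_left_cancel₀ hX ((hH _).symm.trans ?_)
    rw [map_mul, hε1, zero_mul, sub_zero]

end Shift

/-! ### Operators in coordinates -/

section Coordinates

variable {S R : Type*} [CommRing S] [CommRing R] (π : S →+* R) (φ : R →+* R)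
  (hφ : ∀ s, φ (π s) = π s) {X : Type*} [AddCommGroup X] [Module R X] {ι : Type*} [Finite ι]
  (b : Module.Basis ι R (Restrict φ X))

/-- The operator acting as `h` on coordinates. -/
def coordOp (h : R →+ R) (hh : ∀ s f, h (π s * f) = π s * h f) :
    Module.End S (Restrict π X) where
  toFun x := b.equivFun.symm fun i => h (b.equivFun x i)
  map_add' x y := by
    refine Eq.trans (congrArg b.equivFun.symm (funext fun i => ?_)) (map_add b.equivFun.symm _ _)
    exact (congrArg h (congrFun (map_add b.equivFun x y) i)).trans (map_add h _ _)
  map_smul' s x := by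
    have h1 : ∀ x : X, toRestrict φ (π s • x) = π s • toRestrict φ x := fun x => by
      rw [smul_toRestrict, hφ]
    change b.equivFun.symm
      (fun i => h (b.equivFun (toRestrict φ (π s • (toRestrict π).symm x)) i)) =
      toRestrict φ (π s • (toRestrict φ).symm (b.equivFun.symm _))
    rw [h1, h1, AddEquiv.apply_symm_apply]
    refine Eq.trans (congrArg b.equivFun.symm (funext fun i => ?_)) (map_smul b.equivFun.symm _ _)
    rw [map_smul]
    exact hh _ _

/-- One rule covers all uses: `(c, d) = (0, 1)` for a left inverse of `a`, `(a, 0)` for an operator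
commuting with `a`, and `(a, ∂a)` for a derivation. -/
theorem coordOp_smul (h : R →+ R) (hh : ∀ s f, h (π s * f) = π s * h f) {a c d : R}
    (ha : ∀ f, h (a * f) = c * h f + d * f) (x : X) :
    coordOp π φ hφ b h hh (toRestrict π (φ a • x)) =
      toRestrict π (φ c • (toRestrict π).symm (coordOp π φ hφ b h hh (toRestrict π x)) +
        φ d • x) := by
  change b.equivFun.symm (fun i => h (b.equivFun (a • toRestrict φ x) i)) =
    c • b.equivFun.symm (fun i => h (b.equivFun (toRestrict φ x) i)) + d • toRestrict φ x
  apply b.equivFun.injective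
  rw [map_add, map_smul, map_smul, LinearEquiv.apply_symm_apply, LinearEquiv.apply_symm_apply]
  funext i
  rw [map_smul]
  exact ha _

include hφ b in
-- Coordinates over the substituted ring need not be homogeneous, so the operator is averaged with
-- its conjugate by `G`. The rule survives because `G` is `R`-linear.
theorem exists_even_coordOp [Invertible (2 : S)] (D : OddEnd R X) (h : R →+ R)
    (hh : ∀ s f, h (π s * f) = π s * h f) :
    ∃ N : Module.End S (Restrict π X),
      (∀ x, N ((D.restrict π).G x) = (D.restrict π).G (N x)) ∧
      ∀ a c d : R, (∀ f, h (a * f) = c * h f + d * f) → ∀ x : X,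
        N (toRestrict π (φ a • x)) =
          toRestrict π (φ c • (toRestrict π).symm (N (toRestrict π x)) + φ d • x) := by
  set N := coordOp π φ hφ b h hh with hN
  set G := (D.restrict π).G with hG
  have hGG : ∀ x, G (G x) = x := (D.restrict π).G_G
  refine ⟨⅟(2 : S) • (N + G * N * G), fun x => ?_, fun a c d ha x => ?_⟩
  · simp only [LinearMap.smul_apply, LinearMap.add_apply, Module.End.mul_apply, map_smul, map_add,
      hGG]
    rw [add_comm]
  · have h1 := coordOp_smul π φ hφ b h hh ha
    have h2 : ∀ (r : R) (x : X), G (toRestrict π (r • x)) =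
        toRestrict π (r • (toRestrict π).symm (G (toRestrict π x))) := fun r x => map_smul D.G r x
    have h3 : ∀ x y : X, toRestrict π (x + y) = toRestrict π x + toRestrict π y :=
      map_add (toRestrict π)
    have h4 : ∀ (s : S) (r : R) (x : X), s • toRestrict π (r • x) =
        toRestrict π (r • (toRestrict π).symm (s • toRestrict π x)) := fun s r x =>
      smul_comm (π s) r x
    have h5 : ∀ (r : R) (x y : Restrict π X), toRestrict π (r • (toRestrict π).symm x) +
        toRestrict π (r • (toRestrict π).symm y) =
        toRestrict π (r • (toRestrict π).symm (x + y)) := fun r x y =>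
        (smul_add r ((toRestrict π).symm x) ((toRestrict π).symm y)).symm
    simp only [LinearMap.smul_apply, LinearMap.add_apply, Module.End.mul_apply]
    have h6 : G (N (G (toRestrict π (φ a • x)))) =
        toRestrict π (φ c • (toRestrict π).symm (G (N (G (toRestrict π x))))) +
          toRestrict π (φ d • x) := by
      rw [h2, hN, h1, ← hN, h3, map_add, h2, h2]
      simp only [AddEquiv.apply_symm_apply, hGG, AddEquiv.symm_apply_apply]
    rw [h6, h1, h3, h3, add_add_add_comm, h5, smul_add, h4, ← two_smul S (toRestrict π (φ d • x)),
      invOf_smul_smul]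
    rfl

end Coordinates


/-! ### Freeness after restriction of scalars and reduction -/

section RestrictFree

variable {A R : Type*} [CommRing A] [CommRing R] (φ : A →+* R) {X : Type*} [AddCommGroup X]
  [Module R X]

/-- A free module over `R` is a power of `R` over `A`. -/
def restrictEquivFun {ι : Type*} [Finite ι] (b : Module.Basis ι R X) :
    Restrict φ X ≃ₗ[A] (ι → Restrict φ R) where
  toFun x i := toRestrict φ (b.equivFun ((toRestrict φ).symm x) i)
  map_add' x y := map_add b.equivFun x y
  map_smul' a x := map_smul b.equivFun (φ a) ((toRestrict φ).symm x)
  invFun f := toRestrict φ (b.equivFun.symm f)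
  left_inv x := b.equivFun.symm_apply_apply x
  right_inv f := b.equivFun.apply_symm_apply f

theorem free_finite_restrict [Module.Free A (Restrict φ R)] [Module.Finite A (Restrict φ R)]
    [Module.Free R X] [Module.Finite R X] :
    Module.Free A (Restrict φ X) ∧ Module.Finite A (Restrict φ X) := by
  let e := restrictEquivFun φ (Module.Free.chooseBasis R X)
  exact ⟨Module.Free.of_equiv e.symm, Module.Finite.equiv e.symm⟩

end RestrictFree

section ReductionBasis

variable {S R : Type*} [CommRing S] [CommRing R] {π : S →+* R} {φ : R →+* R}
  (hφ : ∀ s, φ (π s) = π s) {X : Type*} [AddCommGroup X] [Module R X] {ι : Type*}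
  (b : Module.Basis ι R (Restrict φ X))

include b in
theorem repr_mem_of_mem_map_smul_top (J : Ideal R) {x : X}
    (hx : x ∈ (J.map φ • ⊤ : Submodule R X)) (i : ι) : b.repr (toRestrict φ x) i ∈ J := by
  suffices h : toRestrict φ x ∈ (J • ⊤ : Submodule R (Restrict φ X)) from
    (mem_ideal_smul_top_iff_repr b J _).mp h i
  induction hx using Submodule.smul_induction_on' with
  | add x _ y _ hx hy => exact add_mem hx hy
  | smul r hr x _ =>
    induction hr using Submodule.span_induction generalizing x with
    | zero =>
      rw [zero_smul]
      exact zero_mem _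
    | add r s _ _ hr hs =>
      rw [add_smul]
      exact add_mem (hr x trivial) (hs x trivial)
    | smul a r _ hr =>
      rw [smul_eq_mul, mul_comm, mul_smul]
      exact hr (a • x) trivial
    | mem r hr =>
      obtain ⟨j, hj, rfl⟩ := hr
      exact Submodule.smul_mem_smul hj (Submodule.mem_top (x := toRestrict φ x))

include hφ b in
/-- The reduction modulo the variables in `J`, as a module over the remaining variables. -/
theorem free_finite_of_reduction [Finite ι] {Y : Type*} [AddCommGroup Y] [Module R Y]
    (γ : X →ₗ[R] Y) (hγ : Function.Surjective γ) (κ : R →+* S) (hκ : ∀ s, κ (π s) = s) (J : Ideal R)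
    (hJ : J = RingHom.ker κ) (hker : LinearMap.ker γ = J.map φ • ⊤) :
    Module.Free S (Restrict π Y) ∧ Module.Finite S (Restrict π Y) := by
  have := Fintype.ofFinite ι
  let v : ι → Restrict π Y := fun i => toRestrict π (γ ((toRestrict φ).symm (b i)))
  have hv : ∀ s : ι → S, ∑ i, s i • v i =
      toRestrict π (γ ((toRestrict φ).symm (∑ i, π (s i) • b i))) := fun s => by
    rw [map_sum, map_sum, map_sum]
    refine Finset.sum_congr rfl fun i _ => ?_
    change π (s i) • γ _ = γ (φ (π (s i)) • (toRestrict φ).symm (b i))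
    rw [map_smul, hφ]
  have hli : LinearIndependent S v := by
    rw [Fintype.linearIndependent_iff]
    intro s hs i
    rw [hv] at hs
    have h1 : (toRestrict φ).symm (∑ i, π (s i) • b i) ∈ LinearMap.ker γ := hs
    rw [hker] at h1
    have h2 := repr_mem_of_mem_map_smul_top b J h1 i
    rw [AddEquiv.apply_symm_apply, b.repr_sum_self, hJ, RingHom.mem_ker, hκ] at h2
    exact h2
  have hsp : ⊤ ≤ Submodule.span S (Set.range v) := by
    rintro y -
    obtain ⟨x, hx⟩ := hγ ((toRestrict π).symm y)
    -- Modulo `J` a coordinate `r` may be replaced by `π (κ r)`, since `κ` kills the difference.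
    have h1 : y = ∑ i, κ (b.repr (toRestrict φ x) i) • v i := by
      rw [hv]
      apply (toRestrict π).symm.injective
      rw [← hx, AddEquiv.symm_apply_apply, ← sub_eq_zero, ← map_sub, ← LinearMap.mem_ker, hker]
      have h2 : x = (toRestrict φ).symm (∑ i, b.repr (toRestrict φ x) i • b i) := by
        rw [b.sum_repr, AddEquiv.symm_apply_apply]
      nth_rewrite 1 [h2]
      rw [← map_sub, ← Finset.sum_sub_distrib, map_sum]
      refine Submodule.sum_mem _ fun i _ => ?_
      rw [← sub_smul]
      refine Submodule.smul_mem_smul (Ideal.mem_map_of_mem φ ?_) Submodule.mem_top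
      rw [hJ, RingHom.mem_ker, map_sub, hκ, sub_self]
    rw [h1]
    exact Submodule.sum_mem _ fun i _ => Submodule.smul_mem _ _ (Submodule.subset_span ⟨i, rfl⟩)
  let b' := Module.Basis.mk hli hsp
  exact ⟨Module.Free.of_basis b', Module.Finite.of_basis b'⟩

end ReductionBasis

/-! ### Homogeneous components over a local ring -/

section Homogeneous

variable {S X : Type*} [CommRing S] [IsLocalRing S] [IsNoetherianRing S]
  [AddCommGroup X] [Module S X] [Module.Free S X] [Module.Finite S X]

/-- A direct summand of a finite free module is projective, hence free over a local ring. -/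
theorem free_of_isCompl {p q : Submodule S X} (h : IsCompl p q) : Module.Free S p := by
  have h1 : Module.Projective S p := Module.Projective.of_split p.subtype
    (p.projectionOnto q h) (by ext x; simp)
  exact Module.free_of_flat_of_isLocalRing

theorem OddEnd.isFiniteRankMF_of_free [Invertible (2 : S)] (D : OddEnd S X) {c : S}
    (hD : D.IsLinearFactorisation c) :
    D.IsFiniteRankMF c where
  sq := hD
  free_even := free_of_isCompl D.isCompl_evenPart_oddPart
  finite_even := inferInstance
  free_odd := free_of_isCompl D.isCompl_evenPart_oddPart.symm
  finite_odd := inferInstance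

end Homogeneous


/-! ### Setting variables to zero -/

section KillCompl

variable {k σ τ : Type*} [Field k] [Finite σ] [Finite τ] (e : σ ↪ τ)

theorem ker_killCompl : RingHom.ker (MvPowerSeries.killCompl (R := k) e) =
    Ideal.span (MvPowerSeries.X '' (Set.range e)ᶜ) := by
  classical
  have := Fintype.ofFinite τ
  apply le_antisymm
  · intro f hf
    have h1 := mem_span_X_pow_iff (k := k) (Finset.univ.filter (· ∉ Set.range e)) 1 f
    simp only [pow_one, Finset.coe_filter, Finset.mem_univ, true_and] at h1
    refine h1.mpr fun x hx => ?_
    rw [← coeff_rename_killCompl e f fun t ht => ?_, RingHom.mem_ker.mp hf, map_zero, map_zero]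
    exact Nat.lt_one_iff.mp (hx t (by simpa using ht))
  · rw [Ideal.span_le]
    rintro _ ⟨t, ht, rfl⟩
    exact MvPowerSeries.killCompl_X_eq_zero ht

theorem sub_rename_killCompl_mem (f : MvPowerSeries τ k) :
    f - MvPowerSeries.rename e (MvPowerSeries.killCompl e f) ∈
      Ideal.span (MvPowerSeries.X '' (Set.range e)ᶜ) := by
  rw [← ker_killCompl, RingHom.mem_ker, map_sub, MvPowerSeries.killCompl_rename_app, sub_self]

end KillCompl

/-! ### The substitution `y ↦ t` -/

section Substitution

variable {k : Type u} [Field k] {n m p : ℕ}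

/-- The variables `x`, `z` among `x`, `y`, `z`. -/
def embXZ (n m p : ℕ) : Fin n ⊕ Fin p ↪ Fin n ⊕ Fin m ⊕ Fin p :=
  Function.Embedding.sumMap (Function.Embedding.refl _) Function.Embedding.inr

theorem piXZ_apply (f : MvPowerSeries (Fin n ⊕ Fin p) k) :
    piXZ k n m p f = MvPowerSeries.rename (embXZ n m p) f := rfl

theorem compl_range_embXZ :
    (Set.range (embXZ n m p))ᶜ = Set.range fun j : Fin m => Sum.inr (Sum.inl j) := by
  ext s
  rcases s with i | j | l
  · simp [embXZ]
  · simp [embXZ]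
  · simp [embXZ]

theorem inr_inl_notMem_range_embXZ (j : Fin m) : Sum.inr (Sum.inl j) ∉ Set.range (embXZ n m p) := by
  simp [embXZ]

/-- Otherwise some `t_i` would be a unit and `J_V` zero. -/
theorem constantCoeff_tSeq (V : MvPowerSeries (Fin m) k) [Nontrivial (Jacobi V)] (i : Fin m) :
    MvPowerSeries.constantCoeff (tSeq V i) = 0 := by
  by_contra h
  have h1 : IsUnit (tSeq V i) := MvPowerSeries.isUnit_iff_constantCoeff.mpr (Ne.isUnit h)
  exact (Ideal.Quotient.nontrivial_iff.mp ‹_›)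
    (Ideal.eq_top_of_isUnit_mem _ (Ideal.subset_span (Set.mem_range_self i)) h1)

variable (n p) in
/-- The sequence `x, t, z`. -/
def xtzSeq (V : MvPowerSeries (Fin m) k) :
    Fin n ⊕ Fin m ⊕ Fin p → MvPowerSeries (Fin n ⊕ Fin m ⊕ Fin p) k :=
  Sum.elim (fun i => MvPowerSeries.X (Sum.inl i))
    (Sum.elim (tSeqXYZ n p V) fun l => MvPowerSeries.X (Sum.inr (Sum.inr l)))

theorem constantCoeff_xtzSeq (V : MvPowerSeries (Fin m) k) [Nontrivial (Jacobi V)]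
    (s : Fin n ⊕ Fin m ⊕ Fin p) : MvPowerSeries.constantCoeff (xtzSeq n p V s) = 0 := by
  rcases s with i | j | l
  · exact MvPowerSeries.constantCoeff_X _
  · exact (MvPowerSeries.constantCoeff_rename _ _).trans (constantCoeff_tSeq V j)
  · exact MvPowerSeries.constantCoeff_X _

/-- Modulo `x` and `z` every series comes from `k⟦y⟧`, so `J_V` surjects onto this quotient. -/
theorem finite_quotient_xtzSeq (V : MvPowerSeries (Fin m) k) [Module.Finite k (Jacobi V)] :
    Module.Finite k (MvPowerSeries (Fin n ⊕ Fin m ⊕ Fin p) k ⧸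
      Ideal.span (Set.range (xtzSeq n p V))) := by
  let e : Fin m ↪ Fin n ⊕ Fin m ⊕ Fin p := Function.Embedding.inl.trans Function.Embedding.inr
  set J := Ideal.span (Set.range (xtzSeq n p V)) with hJ
  let f : MvPowerSeries (Fin m) k →ₐ[k] MvPowerSeries (Fin n ⊕ Fin m ⊕ Fin p) k ⧸ J :=
    (Ideal.Quotient.mkₐ k J).comp (MvPowerSeries.rename e)
  have hf : ∀ a ∈ Ideal.span (Set.range (tSeq V)), f a = 0 := by
    intro a ha
    rw [← RingHom.mem_ker]
    refine (Ideal.span_le.mpr ?_ : Ideal.span (Set.range (tSeq V)) ≤ RingHom.ker f) ha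
    rintro _ ⟨i, rfl⟩
    exact Ideal.Quotient.eq_zero_iff_mem.mpr (Ideal.subset_span ⟨Sum.inr (Sum.inl i), rfl⟩)
  refine Module.Finite.of_surjective (Ideal.Quotient.liftₐ _ f hf).toLinearMap fun x => ?_
  obtain ⟨g, rfl⟩ := Ideal.Quotient.mk_surjective x
  refine ⟨Ideal.Quotient.mk _ (MvPowerSeries.killCompl e g), ?_⟩
  refine Eq.symm (Ideal.Quotient.eq.mpr ?_)
  refine (Ideal.span_mono ?_ : _ ≤ _) (sub_rename_killCompl_mem e g)
  rintro _ ⟨s, hs, rfl⟩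
  rcases s with i | j | l
  · exact ⟨Sum.inl i, rfl⟩
  · exact absurd ⟨j, rfl⟩ hs
  · exact ⟨Sum.inr (Sum.inr l), rfl⟩

/-- The substitution sends `x, y, z` to the system of parameters `x, t, z`. It fixes the variables
`x` and `z`, hence all series in them. -/
theorem exists_substitution (V : MvPowerSeries (Fin m) k) [Module.Finite k (Jacobi V)]
    [Nontrivial (Jacobi V)] :
    ∃ φ : MvPowerSeries (Fin n ⊕ Fin m ⊕ Fin p) k →+* MvPowerSeries (Fin n ⊕ Fin m ⊕ Fin p) k,
      (∀ s, φ (piXZ k n m p s) = piXZ k n m p s) ∧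
      (∀ j, φ (MvPowerSeries.X (Sum.inr (Sum.inl j))) = tSeqXYZ n p V j) ∧
      Module.Free (MvPowerSeries (Fin n ⊕ Fin m ⊕ Fin p) k)
        (Restrict φ (MvPowerSeries (Fin n ⊕ Fin m ⊕ Fin p) k)) ∧
      Module.Finite (MvPowerSeries (Fin n ⊕ Fin m ⊕ Fin p) k)
        (Restrict φ (MvPowerSeries (Fin n ⊕ Fin m ⊕ Fin p) k)) := by
  have h0 := constantCoeff_xtzSeq (n := n) (p := p) V
  have hs : MvPowerSeries.HasSubst (xtzSeq n p V) := MvPowerSeries.hasSubst_of_constantCoeff_zero h0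
  have := finite_quotient_xtzSeq (n := n) (p := p) V
  let φ : MvPowerSeries (Fin n ⊕ Fin m ⊕ Fin p) k →ₐ[k] MvPowerSeries (Fin n ⊕ Fin m ⊕ Fin p) k :=
    MvPowerSeries.substAlgHom hs
  have hX : ∀ s, φ (MvPowerSeries.X s) = xtzSeq n p V s := MvPowerSeries.substAlgHom_X hs
  obtain ⟨μ, ⟨b⟩⟩ := exists_basis_restrict (xtzSeq n p V) h0 φ hX
  refine ⟨φ, fun s => ?_, fun j => hX _, Module.Free.of_basis b, Module.Finite.of_basis b⟩
  rw [piXZ_apply, MvPowerSeries.rename_eq_subst]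
  refine (MvPowerSeries.substAlgHom_apply hs _).trans ?_
  rw [MvPowerSeries.subst_comp_subst_apply (MvPowerSeries.HasSubst.X_comp _) hs]
  congr 1
  funext t
  rw [Function.comp_apply, MvPowerSeries.subst_X hs]
  rcases t with i | l
  · rfl
  · rfl

variable (n p) in
theorem exists_sum_tSeqXYZ_eq_one (V : MvPowerSeries (Fin m) k) [Subsingleton (Jacobi V)] :
    ∃ c : Fin m → MvPowerSeries (Fin n ⊕ Fin m ⊕ Fin p) k, ∑ i, c i * tSeqXYZ n p V i = 1 := by
  have h1 : Ideal.span (Set.range (tSeq V)) = ⊤ := Ideal.Quotient.subsingleton_iff.mp ‹_›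
  have h2 : (1 : MvPowerSeries (Fin m) k) ∈ Ideal.span (Set.range (tSeq V)) := h1 ▸ trivial
  obtain ⟨c, hc⟩ := Ideal.mem_span_range_iff_exists_fun.mp h2
  refine ⟨fun i => MvPowerSeries.rename (fun j => Sum.inr (Sum.inl j)) (c i), ?_⟩
  have h3 := congrArg (MvPowerSeries.rename (R := k)
    (fun j : Fin m => (Sum.inr (Sum.inl j) : Fin n ⊕ Fin m ⊕ Fin p))) hc
  rw [map_sum, map_one] at h3
  rw [← h3]
  exact Finset.sum_congr rfl fun i _ => (map_mul _ _ _).symm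

end Substitution


theorem OddEnd.shift_homotopic_zero_id {S X : Type*} [CommRing S] [AddCommGroup X] [Module S X]
    (D : OddEnd S X) (m : ℕ) (H : Module.End S X) (hG : ∀ x, H (D.G x) = -D.G (H x))
    (hd : ∀ x, D.d (H x) + H (D.d x) = x) :
    (D.shift m).Homotopic (D.shift m) 0 LinearMap.id := by
  have hone : (-1 : S) ^ m * (-1) ^ m = 1 := by rw [← pow_add, Even.neg_one_pow ⟨_, rfl⟩]
  refine ⟨-((-1 : S) ^ m • H), fun x => ?_, fun x => ?_⟩
  · simp only [shift, LinearMap.smul_apply, LinearMap.neg_apply, map_smul, map_neg, hG, smul_neg]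
  · simp only [shift, LinearMap.smul_apply, LinearMap.neg_apply, map_smul, map_neg,
      smul_neg, smul_smul, hone, one_smul, LinearMap.zero_apply, LinearMap.id_apply]
    rw [← neg_add, hd, zero_sub]

/-! ### Contraction, split sequence and connection on `F ⋆ E` -/

section Convolution

variable {k : Type u} [Field k] {n m p : ℕ}
  {F : Type w} [AddCommGroup F] [Module (MvPowerSeries (Fin m ⊕ Fin p) k) F]
  [Module k F] [IsScalarTower k (MvPowerSeries (Fin m ⊕ Fin p) k) F]
  {E : Type v} [AddCommGroup E] [Module (MvPowerSeries (Fin n ⊕ Fin m) k) E]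
  [Module k E] [IsScalarTower k (MvPowerSeries (Fin n ⊕ Fin m) k) E]
  {W : MvPowerSeries (Fin n) k} {V : MvPowerSeries (Fin m) k} {U : MvPowerSeries (Fin p) k}
  {DE : OddEnd (MvPowerSeries (Fin n ⊕ Fin m) k) E}
  {DF : OddEnd (MvPowerSeries (Fin m ⊕ Fin p) k) F}
  [Module.Free (MvPowerSeries (Fin n ⊕ Fin m) k) E]
  [Module.Finite (MvPowerSeries (Fin n ⊕ Fin m) k) E]

/-- If `J_V = 0`, then `F ⋆ E` is contractible. -/
theorem exists_contraction [Subsingleton (Jacobi V)]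
    (hE : DE.IsLinearFactorisation
      (MvPowerSeries.rename Sum.inr V - MvPowerSeries.rename Sum.inl W))
    {ι : Type*} [Fintype ι] [DecidableEq ι]
    (b : Module.Basis ι (MvPowerSeries (Fin n ⊕ Fin m) k) E) (hb : DE.IsHomogeneousBasis b) :
    ((conv DF DE).shift m).Homotopic ((conv DF DE).shift m) 0 LinearMap.id := by
  obtain ⟨c, hc⟩ := exists_sum_tSeqXYZ_eq_one n p V
  -- With `∑ c i * t_i = 1`, the boundary of `∑ c i • λ_i` is the identity.
  let h : Box k n m p F E →ₗ[MvPowerSeries (Fin n ⊕ Fin m ⊕ Fin p) k] Box k n m p F E :=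
    ∑ i, c i • lam DF DE b i
  have hG : ∀ x, h ((box DF DE).G x) = -(box DF DE).G (h x) := fun x => by
    simp only [h, LinearMap.sum_apply, LinearMap.smul_apply, lam_G b hb, map_sum, map_smul,
      smul_neg, Finset.sum_neg_distrib]
  have hd : ∀ x, (box DF DE).d (h x) + h ((box DF DE).d x) = x := fun x => by
    simp only [h, LinearMap.sum_apply, LinearMap.smul_apply, map_sum, map_smul]
    rw [← Finset.sum_add_distrib]
    refine Eq.trans (Finset.sum_congr rfl fun i _ => ?_) ((Finset.sum_smul).symm.trans
      ((congrArg (· • x) hc).trans (one_smul _ x)))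
    rw [← smul_add, lam_d b hE, mul_smul]
  exact OddEnd.shift_homotopic_zero_id (conv DF DE) m (restrictMap (piXZ k n m p) h) hG hd

section Coordinates

variable [Module.Free (MvPowerSeries (Fin m ⊕ Fin p) k) F]
  [Module.Finite (MvPowerSeries (Fin m ⊕ Fin p) k) F]

variable (n p F E) in
/-- Coordinates on `F ⊠ E` over `k⟦x, t, z⟧`. -/
theorem exists_basis_restrict_box (V : MvPowerSeries (Fin m) k) [Module.Finite k (Jacobi V)]
    [Nontrivial (Jacobi V)] :
    ∃ φ : MvPowerSeries (Fin n ⊕ Fin m ⊕ Fin p) k →+* MvPowerSeries (Fin n ⊕ Fin m ⊕ Fin p) k,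
      (∀ s, φ (piXZ k n m p s) = piXZ k n m p s) ∧
      (∀ j, φ (MvPowerSeries.X (Sum.inr (Sum.inl j))) = tSeqXYZ n p V j) ∧
      ∃ ν : ℕ, Nonempty (Module.Basis (Fin ν) (MvPowerSeries (Fin n ⊕ Fin m ⊕ Fin p) k)
        (Restrict φ (Box k n m p F E))) := by
  obtain ⟨φ, h1, h2, h3, h4⟩ := exists_substitution (n := n) (p := p) V
  obtain ⟨β, -⟩ := exists_basis_box (n := n) (Module.Free.chooseBasis
    (MvPowerSeries (Fin m ⊕ Fin p) k) F)
    (Module.Free.chooseBasis (MvPowerSeries (Fin n ⊕ Fin m) k) E)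
  have h5 := Module.Free.of_basis β
  have h6 := Module.Finite.of_basis β
  obtain ⟨h7, h8⟩ := free_finite_restrict φ (X := Box k n m p F E)
  exact ⟨φ, h1, h2, _, ⟨Module.finBasis _ _⟩⟩

variable (n p F E) in
/-- Multiplication by `t_i` on `F ⋆ E`. -/
def mulT (V : MvPowerSeries (Fin m) k) (i : Fin m) :
    Module.End (MvPowerSeries (Fin n ⊕ Fin p) k) (Restrict (piXZ k n m p) (Box k n m p F E)) :=
  restrictMap (piXZ k n m p) (LinearMap.lsmul (MvPowerSeries (Fin n ⊕ Fin m ⊕ Fin p) k)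
    (Box k n m p F E) (tSeqXYZ n p V i))

theorem conv_isLinearFactorisation
    (hE : DE.IsLinearFactorisation
      (MvPowerSeries.rename Sum.inr V - MvPowerSeries.rename Sum.inl W))
    (hF : DF.IsLinearFactorisation
      (MvPowerSeries.rename Sum.inr U - MvPowerSeries.rename Sum.inl V)) :
    (conv DF DE).IsLinearFactorisation
      (MvPowerSeries.rename Sum.inr U - MvPowerSeries.rename Sum.inl W) :=
  fun x => box_isLinearFactorisation hE hF x

variable [Invertible (2 : MvPowerSeries (Fin n ⊕ Fin p) k)]

/-- The left inverse of `t_j` is division by the variable `t_j` in coordinates over `k⟦x, t, z⟧`,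
made even. The `λ_i` commute with `t` because they are `k⟦x, y, z⟧`-linear. -/
theorem exists_splitSequence [Module.Finite k (Jacobi V)] [Nontrivial (Jacobi V)]
    (hE : DE.IsLinearFactorisation
      (MvPowerSeries.rename Sum.inr V - MvPowerSeries.rename Sum.inl W))
    {ι : Type*} [Fintype ι] [DecidableEq ι]
    (b : Module.Basis ι (MvPowerSeries (Fin n ⊕ Fin m) k) E) (hb : DE.IsHomogeneousBasis b) :
    ∃ P : SplitSequence (conv DF DE) m,
      (∀ i, P.T i = mulT n p F E V i) ∧
      ∀ i, P.L i = restrictMap (piXZ k n m p) (lam DF DE b i) := by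
  obtain ⟨φ, hφ, hφt, ν, ⟨β⟩⟩ := exists_basis_restrict_box n p F E V
  have h1 : ∀ j : Fin m, ∃ H : Module.End (MvPowerSeries (Fin n ⊕ Fin p) k)
      (Restrict (piXZ k n m p) (Box k n m p F E)),
      (∀ x, H ((conv DF DE).G x) = (conv DF DE).G (H x)) ∧
      (∀ x, H (toRestrict _ (tSeqXYZ n p V j • x)) = toRestrict _ x) ∧
      ∀ i x, j ≠ i → H (toRestrict _ (tSeqXYZ n p V i • x)) =
        toRestrict _ (tSeqXYZ n p V i • (toRestrict _).symm (H (toRestrict _ x))) := by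
    intro j
    obtain ⟨h, h1, h2, h3⟩ := exists_shift (k := k) (Sum.inr (Sum.inl j)) (embXZ n m p)
      (inr_inl_notMem_range_embXZ j)
    obtain ⟨N, hN, hN'⟩ := exists_even_coordOp (piXZ k n m p) φ hφ β (box DF DE) h
      (fun s f => h3 s f)
    refine ⟨N, hN, fun x => ?_, fun i x hij => ?_⟩
    · have h4 := hN' (MvPowerSeries.X (Sum.inr (Sum.inl j))) 0 1 (fun f => by
        rw [h1, zero_mul, one_mul, zero_add]) x
      rw [hφt, map_zero, map_one, zero_smul, one_smul, zero_add] at h4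
      exact h4
    · have h4 := hN' (MvPowerSeries.X (Sum.inr (Sum.inl i))) (MvPowerSeries.X (Sum.inr (Sum.inl i)))
        0 (fun f => by rw [h2 _ _ (by simpa using hij.symm), zero_mul, add_zero]) x
      rw [hφt, map_zero, zero_smul, add_zero] at h4
      exact h4
  choose H hG hT hT' using h1
  exact ⟨{
    T := mulT n p F E V
    L := fun i => restrictMap (piXZ k n m p) (lam DF DE b i)
    H := H
    T_T := fun i j x => smul_comm (tSeqXYZ n p V i) (tSeqXYZ n p V j) ((toRestrict _).symm x)
    G_T := fun i x => map_smul (box DF DE).G (tSeqXYZ n p V i) ((toRestrict _).symm x)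
    d_T := fun i x => map_smul (box DF DE).d (tSeqXYZ n p V i) ((toRestrict _).symm x)
    L_G := fun i x => lam_G b hb i x
    d_L := fun i x => lam_d b hE i x
    L_T := fun i j x => map_smul (lam DF DE b i) (tSeqXYZ n p V j) ((toRestrict _).symm x)
    H_G := hG
    H_T_self := fun i x => hT i x
    H_T := fun i j x hij => hT' i j x hij }, fun _ => rfl, fun _ => rfl⟩

/-- The components are the partial derivatives `∂/∂t_j` of coordinates over `k⟦x, t, z⟧`, made even
by averaging. -/
theorem exists_boxConnection [Module.Finite k (Jacobi V)] [Nontrivial (Jacobi V)] :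
    ∃ N : BoxConnection k n p F E V, N.IsEven (boxT V DF DE) := by
  obtain ⟨φ, hφ, hφt, ν, ⟨β⟩⟩ := exists_basis_restrict_box n p F E V
  have h1 : ∀ j : Fin m, ∃ N : Module.End (MvPowerSeries (Fin n ⊕ Fin p) k)
      (Restrict (piXZ k n m p) (Box k n m p F E)),
      (∀ x, N ((conv DF DE).G x) = (conv DF DE).G (N x)) ∧
      (∀ x, N (toRestrict _ (tSeqXYZ n p V j • x)) =
        toRestrict _ (tSeqXYZ n p V j • (toRestrict _).symm (N (toRestrict _ x)) + x)) ∧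
      ∀ i x, i ≠ j → N (toRestrict _ (tSeqXYZ n p V i • x)) =
        toRestrict _ (tSeqXYZ n p V i • (toRestrict _).symm (N (toRestrict _ x))) := by
    intro j
    let δ := MvPowerSeries.pderiv k (Sum.inr (Sum.inl j) : Fin n ⊕ Fin m ⊕ Fin p)
    obtain ⟨N, hN, hN'⟩ := exists_even_coordOp (piXZ k n m p) φ hφ β (box DF DE)
      (δ : MvPowerSeries (Fin n ⊕ Fin m ⊕ Fin p) k →ₗ[k] _).toAddMonoidHom (fun s f => by
        have h3 := pderiv_rename_of_notMem (embXZ n m p) (inr_inl_notMem_range_embXZ j) s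
        refine (δ.leibniz (piXZ k n m p s) f).trans ?_
        rw [piXZ_apply, h3, smul_zero, add_zero]
        rfl)
    have hδ : ∀ i f, δ (MvPowerSeries.X i * f) = MvPowerSeries.X i * δ f +
        δ (MvPowerSeries.X i) * f := fun i f => by
      rw [δ.leibniz, smul_eq_mul, smul_eq_mul, mul_comm f]
    refine ⟨N, hN, fun x => ?_, fun i x hij => ?_⟩
    · have h4 := hN' (MvPowerSeries.X (Sum.inr (Sum.inl j))) (MvPowerSeries.X (Sum.inr (Sum.inl j)))
        (δ (MvPowerSeries.X (Sum.inr (Sum.inl j)))) (hδ _) x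
      rw [hφt, MvPowerSeries.pderiv_X_self, map_one, one_smul] at h4
      exact h4
    · have h4 := hN' (MvPowerSeries.X (Sum.inr (Sum.inl i))) (MvPowerSeries.X (Sum.inr (Sum.inl i)))
        (δ (MvPowerSeries.X (Sum.inr (Sum.inl i)))) (hδ _) x
      rw [hφt, MvPowerSeries.pderiv_X_of_ne (by simpa using hij), map_zero, zero_smul,
        add_zero] at h4
      exact h4
  choose N hG hT hT' using h1
  have hX : ∀ (j : Fin m) (x : Box k n m p F E),
      (MvPolynomial.X j : MvPolynomial (Fin m) (MvPowerSeries (Fin n ⊕ Fin p) k)) •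
        toRestrict (evalT n p V) x = toRestrict (evalT n p V) (tSeqXYZ n p V j • x) := fun j x => by
    rw [smul_toRestrict, evalT, MvPolynomial.coe_eval₂Hom, MvPolynomial.eval₂_X]
  have hC : ∀ (s : MvPowerSeries (Fin n ⊕ Fin p) k) (x : Box k n m p F E),
      (MvPolynomial.C s : MvPolynomial (Fin m) (MvPowerSeries (Fin n ⊕ Fin p) k)) •
        toRestrict (evalT n p V) x = toRestrict (evalT n p V) (piXZ k n m p s • x) := fun j x => by
    rw [smul_toRestrict, evalT, MvPolynomial.coe_eval₂Hom, MvPolynomial.eval₂_C]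
  refine Connection.exists_of_components (boxT V DF DE)
    (Nc := fun j => (N j).toAddMonoidHom) (fun j s x => ?_) (fun j x => ?_) (fun i j x hij => ?_) hG
  · refine (congrArg (N j) (hC s x)).trans (Eq.trans ?_ (hC s _).symm)
    exact map_smul (N j) s (toRestrict (piXZ k n m p) ((toRestrict (evalT n p V)).symm x))
  · refine (congrArg (N j) (hX j x)).trans (Eq.trans (hT j x) ?_)
    exact congrArg (· + x) (hX j (N j x)).symm
  · exact (congrArg (N j) (hX i x)).trans (Eq.trans (hT' j i x hij) (hX i (N j x)).symm)

end Coordinates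

end Convolution


/-! ### `F/tF ⊗̂ E/tE` as a finite rank matrix factorisation -/

section Convolution

variable {k : Type u} [Field k] {n m p : ℕ}
  {F : Type w} [AddCommGroup F] [Module (MvPowerSeries (Fin m ⊕ Fin p) k) F]
  [Module k F] [IsScalarTower k (MvPowerSeries (Fin m ⊕ Fin p) k) F]
  [Module (MvPowerSeries (Fin m) k) F]
  [IsScalarTower (MvPowerSeries (Fin m) k) (MvPowerSeries (Fin m ⊕ Fin p) k) F]
  {E : Type v} [AddCommGroup E] [Module (MvPowerSeries (Fin n ⊕ Fin m) k) E]
  [Module k E] [IsScalarTower k (MvPowerSeries (Fin n ⊕ Fin m) k) E]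
  [Module (MvPowerSeries (Fin m) k) E]
  [IsScalarTower (MvPowerSeries (Fin m) k) (MvPowerSeries (Fin n ⊕ Fin m) k) E]
  {W : MvPowerSeries (Fin n) k} {V : MvPowerSeries (Fin m) k} {U : MvPowerSeries (Fin p) k}
  {DE : OddEnd (MvPowerSeries (Fin n ⊕ Fin m) k) E}
  {DF : OddEnd (MvPowerSeries (Fin m ⊕ Fin p) k) F}
  {γ : Box k n m p F E →ₗ[MvPowerSeries (Fin n ⊕ Fin m ⊕ Fin p) k] QuotTensor n p F E V}

theorem IsReduction.ker_restrictMap (hγ : IsReduction V γ) :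
    LinearMap.ker (restrictMap (piXZ k n m p) γ) = ⨆ i, LinearMap.range (mulT n p F E V i) := by
  apply le_antisymm
  · intro x hx
    have h1 : (toRestrict _).symm x ∈ LinearMap.ker γ := hx
    rw [hγ.ker] at h1
    suffices h2 : ∀ y : Box k n m p F E, y ∈ (Ideal.span (Set.range (tSeqXYZ n p V)) • ⊤ :
        Submodule (MvPowerSeries (Fin n ⊕ Fin m ⊕ Fin p) k) (Box k n m p F E)) →
        toRestrict (piXZ k n m p) y ∈ ⨆ i, LinearMap.range (mulT n p F E V i) from h2 _ h1
    intro y hy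
    induction hy using Submodule.smul_induction_on' with
    | add x _ y _ hx hy => exact add_mem hx hy
    | smul r hr y _ =>
      induction hr using Submodule.span_induction generalizing y with
      | zero =>
        rw [zero_smul]
        exact zero_mem _
      | add r s _ _ hr hs =>
        rw [add_smul]
        exact add_mem (hr y trivial) (hs y trivial)
      | smul a r _ hr =>
        rw [smul_eq_mul, mul_comm, mul_smul]
        exact hr (a • y) trivial
      | mem r hr =>
        obtain ⟨i, rfl⟩ := hr
        exact Submodule.mem_iSup_of_mem i ⟨toRestrict _ y, rfl⟩
  · refine iSup_le fun i => ?_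
    rintro _ ⟨x, rfl⟩
    have h1 : tSeqXYZ n p V i • (toRestrict (piXZ k n m p)).symm x ∈ LinearMap.ker γ := by
      rw [hγ.ker]
      exact Submodule.smul_mem_smul (Ideal.subset_span ⟨i, rfl⟩) Submodule.mem_top
    exact h1

theorem subsingleton_quotTensor (hγ : IsReduction V γ) [Subsingleton (Jacobi V)] :
    Subsingleton (QuotTensor n p F E V) := by
  have h1 : Ideal.span (Set.range (tSeq V)) = ⊤ := Ideal.Quotient.subsingleton_iff.mp ‹_›
  have h2 : Ideal.span (Set.range (tSeqXYZ n p V)) = ⊤ := by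
    have h3 := congrArg (Ideal.map (MvPowerSeries.rename (R := k)
      (fun j : Fin m => (Sum.inr (Sum.inl j) : Fin n ⊕ Fin m ⊕ Fin p)))) h1
    rw [Ideal.map_span, ← Set.range_comp, Ideal.map_top] at h3
    exact h3
  refine ⟨fun x y => ?_⟩
  have h4 : ∀ x, γ x = 0 := fun x => by
    rw [← LinearMap.mem_ker, hγ.ker, h2, Submodule.top_smul]
    trivial
  obtain ⟨x, rfl⟩ := hγ.surjective x
  obtain ⟨y, rfl⟩ := hγ.surjective y
  rw [h4, h4]

variable [Module.Free (MvPowerSeries (Fin n ⊕ Fin m) k) E]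
  [Module.Finite (MvPowerSeries (Fin n ⊕ Fin m) k) E]

variable [Module.Free (MvPowerSeries (Fin m ⊕ Fin p) k) F]
  [Module.Finite (MvPowerSeries (Fin m ⊕ Fin p) k) F]

theorem quotTensor_isLinearFactorisation (hγ : IsReduction V γ)
    (hE : DE.IsLinearFactorisation
      (MvPowerSeries.rename Sum.inr V - MvPowerSeries.rename Sum.inl W))
    (hF : DF.IsLinearFactorisation
      (MvPowerSeries.rename Sum.inr U - MvPowerSeries.rename Sum.inl V)) :
    (quotTensor V DF DE).IsLinearFactorisation
      (MvPowerSeries.rename Sum.inr U - MvPowerSeries.rename Sum.inl W) := by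
  intro x
  obtain ⟨x, rfl⟩ := hγ.surjective x
  have h1 := congrArg γ (box_isLinearFactorisation hE hF x)
  rw [hγ.map_d, hγ.map_d, map_smul] at h1
  exact h1

/-- The kernel of the reduction is generated by the images of the variables `y` under the
substitution, so dividing it out of a free module over `k⟦x, t, z⟧` sets `t` to zero and leaves a
free module over `k⟦x, z⟧`. -/
theorem free_finite_quotTensor [Module.Finite k (Jacobi V)] [Nontrivial (Jacobi V)]
    (hγ : IsReduction V γ) :
    Module.Free (MvPowerSeries (Fin n ⊕ Fin p) k)
        (Restrict (piXZ k n m p) (QuotTensor n p F E V)) ∧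
      Module.Finite (MvPowerSeries (Fin n ⊕ Fin p) k)
        (Restrict (piXZ k n m p) (QuotTensor n p F E V)) := by
  obtain ⟨φ, hφ, hφt, ν, ⟨β⟩⟩ := exists_basis_restrict_box n p F E V
  refine free_finite_of_reduction hφ β γ hγ.surjective
    (MvPowerSeries.killCompl (R := k) (embXZ n m p))
    (fun s => MvPowerSeries.killCompl_rename_app s) _ (ker_killCompl _).symm ?_
  rw [hγ.ker, Ideal.map_span, compl_range_embXZ, ← Set.range_comp, ← Set.range_comp]
  congr 3
  funext j
  exact (hφt j).symm

theorem quotTensor_isFiniteRankMF [Invertible (2 : MvPowerSeries (Fin n ⊕ Fin p) k)]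
    [Module.Finite k (Jacobi V)] (hγ : IsReduction V γ)
    (hE : DE.IsLinearFactorisation
      (MvPowerSeries.rename Sum.inr V - MvPowerSeries.rename Sum.inl W))
    (hF : DF.IsLinearFactorisation
      (MvPowerSeries.rename Sum.inr U - MvPowerSeries.rename Sum.inl V)) :
    (quotTensor V DF DE).IsFiniteRankMF
      (MvPowerSeries.rename Sum.inr U - MvPowerSeries.rename Sum.inl W) := by
  obtain ⟨h1, h2⟩ : Module.Free (MvPowerSeries (Fin n ⊕ Fin p) k)
      (Restrict (piXZ k n m p) (QuotTensor n p F E V)) ∧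
      Module.Finite (MvPowerSeries (Fin n ⊕ Fin p) k)
        (Restrict (piXZ k n m p) (QuotTensor n p F E V)) := by
    obtain h | h := subsingleton_or_nontrivial (Jacobi V)
    · have h3 : Subsingleton (Restrict (piXZ k n m p) (QuotTensor n p F E V)) :=
        subsingleton_quotTensor hγ
      exact ⟨Module.Free.of_subsingleton _ _, inferInstance⟩
    · exact free_finite_quotTensor hγ
  exact OddEnd.isFiniteRankMF_of_free _ (quotTensor_isLinearFactorisation hγ hE hF)

end Convolution


/-! ### Passage from `k⟦x, z⟧[t]`-modules to operators over `k⟦x, z⟧` -/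

theorem Connection.exists_components {S R X : Type*} [CommRing S] [CommRing R]
    [AddCommGroup X] [Module R X] (D : OddEnd R X) (π : S →+* R) {m : ℕ} (t : Fin m → R)
    (ε : MvPolynomial (Fin m) S →+* R) (hεC : ∀ s, ε (MvPolynomial.C s) = π s)
    (hεX : ∀ i, ε (MvPolynomial.X i) = t i)
    (N : Connection S (MvPolynomial (Fin m) S) (Restrict ε X))
    (hN : N.IsEven (D.restrict ε)) :
    ∃ N' : Fin m → Module.End S (Restrict π X),
      (∀ i x, N' i ((D.restrict π).G x) = (D.restrict π).G (N' i x)) ∧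
      (∀ i x, N' i (toRestrict π (t i • x)) =
        toRestrict π (t i • (toRestrict π).symm (N' i (toRestrict π x)) + x)) ∧
      (∀ i j x, i ≠ j → N' i (toRestrict π (t j • x)) =
        toRestrict π (t j • (toRestrict π).symm (N' i (toRestrict π x)))) ∧
      ∀ x, (toRestrict _).symm (N.atiyahPower (D.restrict ε)
        (toRestrict ε x)) = (toRestrict π).symm
          ((∑ σ : Equiv.Perm (Fin m), Equiv.Perm.sign σ •
            (List.ofFn fun i => atiyahEnd (D.restrict π) (N' (σ i))).prod) (toRestrict π x)) := by
  have hC : ∀ (s : S) (x : X), (MvPolynomial.C s : MvPolynomial (Fin m) S) • toRestrict ε x =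
      toRestrict ε (π s • x) := fun s x => by
    rw [smul_toRestrict, hεC]
  have hX : ∀ (i : Fin m) (x : X), (MvPolynomial.X i : MvPolynomial (Fin m) S) • toRestrict ε x =
      toRestrict ε (t i • x) := fun s x => by
    rw [smul_toRestrict, hεX]
  let N' : Fin m → Module.End S (Restrict π X) := fun i =>
    { toFun := fun x => N.component i x
      map_add' := fun x y => map_add (N.component i) x y
      map_smul' := fun s x => by
        have h1 := N.component_smul i (MvPolynomial.C s) (toRestrict ε ((toRestrict π).symm x))
        rw [hC, MvPolynomial.pderiv_C, zero_smul, add_zero] at h1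
        exact h1.trans (hC s _) }
  refine ⟨N', fun i x => N.component_G _ hN i x, fun i x => ?_, fun i j x hij => ?_, fun x => ?_⟩
  · have h1 := N.component_smul i (MvPolynomial.X i) (toRestrict ε x)
    rw [hX, MvPolynomial.pderiv_X_self, one_smul] at h1
    exact h1.trans (congrArg (· + x) (hX i (N.component i (toRestrict ε x))))
  · have h1 := N.component_smul i (MvPolynomial.X j) (toRestrict ε x)
    rw [hX, MvPolynomial.pderiv_X_of_ne hij.symm, zero_smul, add_zero] at h1
    exact h1.trans (hX j (N.component i (toRestrict ε x)))
  · have h1 : ∀ σ : Equiv.Perm (Fin m),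
        ((List.ofFn fun i => N.atiyahComponent (D.restrict ε) (σ i)).prod (toRestrict ε x) : X) =
        (List.ofFn fun i => atiyahEnd (D.restrict π) (N' (σ i))).prod (toRestrict π x) := by
      intro σ
      rw [List.ofFn_eq_map, List.ofFn_eq_map]
      refine list_prod_map_apply (fun x : Restrict π X => toRestrict ε ((toRestrict π).symm x)) _ _
        (fun i x => ?_) _ (toRestrict π x)
      exact N.atiyahComponent_apply (D.restrict ε) (σ i) x
    rw [Connection.atiyahPower, LinearMap.sum_apply, LinearMap.sum_apply, map_sum, map_sum]
    refine Finset.sum_congr rfl fun σ _ => ?_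
    rw [Units.smul_def, Units.smul_def, LinearMap.smul_apply, LinearMap.smul_apply, map_zsmul,
      map_zsmul]
    exact congrArg (_ • ·) (h1 σ)

section Convolution

variable {k : Type u} [Field k] {n m p : ℕ}
  {F : Type w} [AddCommGroup F] [Module (MvPowerSeries (Fin m ⊕ Fin p) k) F]
  [Module k F] [IsScalarTower k (MvPowerSeries (Fin m ⊕ Fin p) k) F]
  {E : Type v} [AddCommGroup E] [Module (MvPowerSeries (Fin n ⊕ Fin m) k) E]
  [Module k E] [IsScalarTower k (MvPowerSeries (Fin n ⊕ Fin m) k) E]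
  {V : MvPowerSeries (Fin m) k}
  {DE : OddEnd (MvPowerSeries (Fin n ⊕ Fin m) k) E}
  {DF : OddEnd (MvPowerSeries (Fin m ⊕ Fin p) k) F}

theorem idemFormula_eq {ι : Type*} [Fintype ι] [DecidableEq ι]
    (b : Module.Basis ι (MvPowerSeries (Fin n ⊕ Fin m) k) E)
    (L : Fin m → Module.End (MvPowerSeries (Fin n ⊕ Fin p) k)
      (Restrict (piXZ k n m p) (Box k n m p F E)))
    (hL : ∀ i, L i = restrictMap (piXZ k n m p) (lam DF DE b i))
    (α : Module.End (MvPolynomial (Fin m) (MvPowerSeries (Fin n ⊕ Fin p) k))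
      (Restrict (evalT n p V) (Box k n m p F E)))
    (x : Box k n m p F E) (y : Restrict (piXZ k n m p) (Box k n m p F E))
    (hy : (toRestrict (evalT n p V)).symm (α (toRestrict (evalT n p V) x)) =
      (toRestrict (piXZ k n m p)).symm y) :
    (MvPowerSeries.C (m.factorial : k)⁻¹ * (-1 : MvPowerSeries (Fin n ⊕ Fin p) k) ^
      (m + 1).choose 2) • (List.ofFn L).prod y =
      toRestrict (piXZ k n m p) (idemFormula V DF DE b α x) := by
  have h1 : piXZ k n m p (MvPowerSeries.C (m.factorial : k)⁻¹ * (-1) ^ (m + 1).choose 2) =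
      MvPowerSeries.C ((m.factorial : k)⁻¹ * (-1) ^ (m + 1).choose 2) := by
    rw [map_mul, map_pow, map_neg, map_one, map_mul, map_pow, map_neg, map_one, piXZ_apply,
      MvPowerSeries.rename_C]
  have h2 : (List.ofFn (lam DF DE b)).prod ((toRestrict (piXZ k n m p)).symm y) =
      (toRestrict (piXZ k n m p)).symm ((List.ofFn L).prod y) := by
    rw [List.ofFn_eq_map, List.ofFn_eq_map]
    refine list_prod_map_apply (toRestrict (piXZ k n m p)).symm _ _ (fun i x => ?_) _ y
    rw [hL]
    rfl
  rw [idemFormula, lamProd, hy, h2, ← h1]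
  rfl

end Convolution

/-! ### Construction of the morphisms -/

section Main

theorem nonempty_invertible_two (k σ : Type*) [Field k] [CharZero k] :
    Nonempty (Invertible (2 : MvPowerSeries σ k)) := by
  refine ⟨⟨MvPowerSeries.C 2⁻¹, ?_, ?_⟩⟩
  · rw [← map_ofNat MvPowerSeries.C 2, ← map_mul, inv_mul_cancel₀ two_ne_zero, map_one]
  · rw [← map_ofNat MvPowerSeries.C 2, ← map_mul, mul_inv_cancel₀ two_ne_zero, map_one]

variable {k : Type u} [Field k] [CharZero k] {n m p : ℕ}
  {F : Type w} [AddCommGroup F] [Module (MvPowerSeries (Fin m ⊕ Fin p) k) F]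
  [Module k F] [IsScalarTower k (MvPowerSeries (Fin m ⊕ Fin p) k) F]
  [Module (MvPowerSeries (Fin m) k) F]
  [IsScalarTower (MvPowerSeries (Fin m) k) (MvPowerSeries (Fin m ⊕ Fin p) k) F]
  {E : Type v} [AddCommGroup E] [Module (MvPowerSeries (Fin n ⊕ Fin m) k) E]
  [Module k E] [IsScalarTower k (MvPowerSeries (Fin n ⊕ Fin m) k) E]
  [Module (MvPowerSeries (Fin m) k) E]
  [IsScalarTower (MvPowerSeries (Fin m) k) (MvPowerSeries (Fin n ⊕ Fin m) k) E]
  {W : MvPowerSeries (Fin n) k} {V : MvPowerSeries (Fin m) k} {U : MvPowerSeries (Fin p) k}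
  {DE : OddEnd (MvPowerSeries (Fin n ⊕ Fin m) k) E}
  {DF : OddEnd (MvPowerSeries (Fin m ⊕ Fin p) k) F}
  {γ : Box k n m p F E →ₗ[MvPowerSeries (Fin n ⊕ Fin m ⊕ Fin p) k] QuotTensor n p F E V}
  [Module.Free (MvPowerSeries (Fin n ⊕ Fin m) k) E]
  [Module.Finite (MvPowerSeries (Fin n ⊕ Fin m) k) E]
  [Module.Free (MvPowerSeries (Fin m ⊕ Fin p) k) F]
  [Module.Finite (MvPowerSeries (Fin m ⊕ Fin p) k) F]

variable [Module.Finite k (Jacobi V)] (hγ : IsReduction V γ)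
    (hE : DE.IsLinearFactorisation
      (MvPowerSeries.rename Sum.inr V - MvPowerSeries.rename Sum.inl W))
    (hF : DF.IsLinearFactorisation
      (MvPowerSeries.rename Sum.inr U - MvPowerSeries.rename Sum.inl V))
    {ι : Type*} [Fintype ι] [DecidableEq ι]
    (b : Module.Basis ι (MvPowerSeries (Fin n ⊕ Fin m) k) E) (hb : DE.IsHomogeneousBasis b)

include hγ hE hF hb in
-- For `J_V = 0` the target of `θ` is zero and `F ⋆ E` is contractible, so zero maps serve.
-- Otherwise the split sequence of `t`, with null-homotopies `λ_i`, gives `ψ` and `θ` before any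
-- connection is chosen, so that the same pair serves for all connections.
theorem exists_morphisms :
    ∃ (ψ : Restrict (piXZ k n m p) (QuotTensor n p F E V)
          →ₗ[MvPowerSeries (Fin n ⊕ Fin p) k] Restrict (piXZ k n m p) (Box k n m p F E))
      (θ : Restrict (piXZ k n m p) (Box k n m p F E)
          →ₗ[MvPowerSeries (Fin n ⊕ Fin p) k] Restrict (piXZ k n m p) (QuotTensor n p F E V)),
      (quotTensor V DF DE).IsMorphism ((conv DF DE).shift m) ψ ∧
      ((conv DF DE).shift m).IsMorphism (quotTensor V DF DE) θ ∧
      ((conv DF DE).shift m).Homotopic ((conv DF DE).shift m) (ψ ∘ₗ θ) LinearMap.id ∧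
      ∀ N : BoxConnection k n p F E V, N.IsEven (boxT V DF DE) →
        ∃ e : Restrict (piXZ k n m p) (QuotTensor n p F E V)
            →ₗ[MvPowerSeries (Fin n ⊕ Fin p) k] Restrict (piXZ k n m p) (QuotTensor n p F E V),
          (∀ x : Box k n m p F E, e (toRestrict (piXZ k n m p) (γ x)) =
            toRestrict (piXZ k n m p)
              (γ (idemFormula V DF DE b (N.atiyahPower (boxT V DF DE)) x))) ∧
          (quotTensor V DF DE).Homotopic (quotTensor V DF DE) (θ ∘ₗ ψ) e := by
  obtain h | h := subsingleton_or_nontrivial (Jacobi V)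
  · have h3 : Subsingleton (Restrict (piXZ k n m p) (QuotTensor n p F E V)) :=
      subsingleton_quotTensor hγ
    refine ⟨0, 0, ⟨fun x => ?_, fun x => ?_⟩, ⟨fun x => Subsingleton.elim _ _,
      fun x => Subsingleton.elim _ _⟩, ?_, fun N _ => ⟨0, fun x => Subsingleton.elim _ _, 0,
      fun x => Subsingleton.elim _ _, fun x => Subsingleton.elim _ _⟩⟩
    · rw [LinearMap.zero_apply, LinearMap.zero_apply, map_zero]
    · rw [LinearMap.zero_apply, LinearMap.zero_apply, map_zero]
    · rw [LinearMap.zero_comp]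
      exact exists_contraction hE b hb
  · obtain ⟨_⟩ := nonempty_invertible_two k (Fin n ⊕ Fin p)
    obtain ⟨P, hT, hL⟩ := exists_splitSequence (DF := DF) hE b hb
    have hu : (MvPowerSeries.C (m.factorial : k)⁻¹ : MvPowerSeries (Fin n ⊕ Fin p) k) *
        (m.factorial : MvPowerSeries (Fin n ⊕ Fin p) k) = 1 := by
      rw [← map_natCast MvPowerSeries.C, ← map_mul,
        inv_mul_cancel₀ (Nat.cast_ne_zero.mpr m.factorial_ne_zero), map_one]
    obtain ⟨ψ, θ, h1, h2, h3, h4⟩ := P.exists_idempotent (isUnit_of_invertible 2) _ hu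
      (conv_isLinearFactorisation hE hF) (quotTensor V DF DE) (restrictMap (piXZ k n m p) γ)
      hγ.surjective hγ.map_G hγ.map_d (by rw [hγ.ker_restrictMap, funext hT])
    refine ⟨ψ, θ, h1, h2, h3, fun N hN => ?_⟩
    obtain ⟨N', hG, hN1, hN2, hα⟩ := N.exists_components (box DF DE) (piXZ k n m p)
      (tSeqXYZ n p V) (evalT n p V) (fun s => MvPolynomial.eval₂_C _ _ _)
      (fun i => MvPolynomial.eval₂_X _ _ _) hN
    obtain ⟨e, he, he'⟩ := h4 N' hG (fun i x => by rw [hT]; exact hN1 i x)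
      (fun i j x hij => by rw [hT]; exact hN2 i j x hij)
    refine ⟨e, fun x => ?_, he'⟩
    refine (he (toRestrict _ x)).trans (congrArg (restrictMap (piXZ k n m p) γ) ?_)
    exact idemFormula_eq b P.L hL (N.atiyahPower (boxT V DF DE)) x _ (hα x)

end Main

end
end MFConv

theorem mainTheorem4 {k : Type u} [Field k] [CharZero k] (n m p : ℕ)
    (W : MvPowerSeries (Fin n) k) (V : MvPowerSeries (Fin m) k) (U : MvPowerSeries (Fin p) k)
    (hV : Module.Finite k (MFConv.Jacobi V))
    {F : Type w} [AddCommGroup F] [Module (MvPowerSeries (Fin m ⊕ Fin p) k) F]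
    [Module k F] [IsScalarTower k (MvPowerSeries (Fin m ⊕ Fin p) k) F]
    [Module (MvPowerSeries (Fin m) k) F]
    [IsScalarTower (MvPowerSeries (Fin m) k) (MvPowerSeries (Fin m ⊕ Fin p) k) F]
    {E : Type v} [AddCommGroup E] [Module (MvPowerSeries (Fin n ⊕ Fin m) k) E]
    [Module k E] [IsScalarTower k (MvPowerSeries (Fin n ⊕ Fin m) k) E]
    [Module (MvPowerSeries (Fin m) k) E]
    [IsScalarTower (MvPowerSeries (Fin m) k) (MvPowerSeries (Fin n ⊕ Fin m) k) E]
    (DE : MFConv.OddEnd (MvPowerSeries (Fin n ⊕ Fin m) k) E)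
    (hE : DE.IsFiniteRankMF
      (MvPowerSeries.rename Sum.inr V - MvPowerSeries.rename Sum.inl W))
    (DF : MFConv.OddEnd (MvPowerSeries (Fin m ⊕ Fin p) k) F)
    (hF : DF.IsFiniteRankMF
      (MvPowerSeries.rename Sum.inr U - MvPowerSeries.rename Sum.inl V))
    {ι : Type*} [Fintype ι] [DecidableEq ι]
    (b : Module.Basis ι (MvPowerSeries (Fin n ⊕ Fin m) k) E) (hb : DE.IsHomogeneousBasis b) :
    -- `F ⋆ E` is a linear factorisation and `F/tF ⊗̂ E/tE` a finite rank matrix factorisation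
    -- of `U - W` over `k⟦x, z⟧`
    (MFConv.conv DF DE).IsLinearFactorisation
      (MvPowerSeries.rename Sum.inr U - MvPowerSeries.rename Sum.inl W) ∧
    (MFConv.quotTensor V DF DE).IsFiniteRankMF
      (MvPowerSeries.rename Sum.inr U - MvPowerSeries.rename Sum.inl W) ∧
    -- a connection on `F ⊠ E` exists, so that the Atiyah class is defined
    (Nontrivial (MFConv.Jacobi V) →
      ∃ N : MFConv.BoxConnection k n p F E V, N.IsEven (MFConv.boxT V DF DE)) ∧
    -- the canonical identification of `F/tF ⊗̂ E/tE` with `(F ⊠ E)/t(F ⊠ E)`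
    ∃ γ : MFConv.Box k n m p F E →ₗ[MvPowerSeries (Fin n ⊕ Fin m ⊕ Fin p) k]
        MFConv.QuotTensor n p F E V,
      MFConv.IsReduction V γ ∧
    ∃ (ψ : MFConv.Restrict (MFConv.piXZ k n m p) (MFConv.QuotTensor n p F E V)
          →ₗ[MvPowerSeries (Fin n ⊕ Fin p) k]
          MFConv.Restrict (MFConv.piXZ k n m p) (MFConv.Box k n m p F E))
      (θ : MFConv.Restrict (MFConv.piXZ k n m p) (MFConv.Box k n m p F E)
          →ₗ[MvPowerSeries (Fin n ⊕ Fin p) k]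
          MFConv.Restrict (MFConv.piXZ k n m p) (MFConv.QuotTensor n p F E V)),
      (MFConv.quotTensor V DF DE).IsMorphism ((MFConv.conv DF DE).shift m) ψ ∧
      ((MFConv.conv DF DE).shift m).IsMorphism (MFConv.quotTensor V DF DE) θ ∧
      -- `ψ ∘ θ = 1` in the homotopy category
      ((MFConv.conv DF DE).shift m).Homotopic ((MFConv.conv DF DE).shift m)
        (ψ ∘ₗ θ) LinearMap.id ∧
      -- for every connection, with `α = At(F ⊠ E)^m`, the operator
      -- `(1/m!) (-1)^(m+1 choose 2) ∂_{y₁}(d_E) ⋯ ∂_{y_m}(d_E) At(F ⊠ E)^m`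
      -- descends to an operator `e` on `F/tF ⊗̂ E/tE`, and `θ ∘ ψ = e` in the homotopy category
      ∀ N : MFConv.BoxConnection k n p F E V, N.IsEven (MFConv.boxT V DF DE) →
        ∃ α, N.IsAtiyahPower (MFConv.boxT V DF DE) α ∧
        ∃ e : MFConv.Restrict (MFConv.piXZ k n m p) (MFConv.QuotTensor n p F E V)
            →ₗ[MvPowerSeries (Fin n ⊕ Fin p) k]
            MFConv.Restrict (MFConv.piXZ k n m p) (MFConv.QuotTensor n p F E V),
          (∀ x : MFConv.Box k n m p F E,
            e (MFConv.toRestrict (MFConv.piXZ k n m p) (γ x)) =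
              MFConv.toRestrict (MFConv.piXZ k n m p)
                (γ (MFConv.idemFormula V DF DE b α x))) ∧
          (MFConv.quotTensor V DF DE).Homotopic (MFConv.quotTensor V DF DE) (θ ∘ₗ ψ) e := by
  obtain ⟨_⟩ := MFConv.nonempty_invertible_two k (Fin n ⊕ Fin m)
  obtain ⟨_⟩ := MFConv.nonempty_invertible_two k (Fin m ⊕ Fin p)
  obtain ⟨_⟩ := MFConv.nonempty_invertible_two k (Fin n ⊕ Fin p)
  -- As `2` is invertible, the even and odd parts are complementary, so the modules themselves are
  -- free of finite rank.
  obtain ⟨_, _⟩ := hE.free_finite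
  obtain ⟨_, _⟩ := hF.free_finite
  obtain ⟨γ, hγ⟩ := MFConv.exists_isReduction n p F E V
  obtain ⟨ψ, θ, hψ, hθ, h, hN⟩ := MFConv.exists_morphisms hγ hE.sq hF.sq b hb
  refine ⟨MFConv.conv_isLinearFactorisation hE.sq hF.sq,
    MFConv.quotTensor_isFiniteRankMF hγ hE.sq hF.sq, fun _ => MFConv.exists_boxConnection,
    γ, hγ, ψ, θ, hψ, hθ, h, fun N hNe => ?_⟩
  exact ⟨N.atiyahPower (MFConv.boxT V DF DE), N.isAtiyahPower_atiyahPower _, hN N hNe⟩
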